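/- Fix $\tau$ with $\operatorname{Im}\tau>0$, put $q=e^{2\pi i\tau}$ and $$\theta(x)=2q^{1/8}\sin(\pi x)\prod_{n\ge1}(1-q^n)(1-q^ne^{2\pi ix})(1-q^ne^{-2\pi ix}),\qquad \delta(e^{2\pi ix},e^{2\pi iy})=\frac{\theta'(0)\,\theta(x+y)}{\theta(x)\theta(y)}.$$ Let $r\ge0$ and $m\ge2r$ be integers. We consider meromorphic functions of $x_1,\dots,x_m,\mu_1,\dots,\mu_r,u,h\in\mathbb C^*$. All of them are also regarded, through $z\mapsto e^{2\pi iz}$ in each variable, as meromorphic functions on $\mathbb C^N$, $N=m+r+2$. Such a function $f$ is called pure if there is a symmetric integral $N\times N$ matrix $M$ such that, writing $a\cdot b=a^{T}Mb$, $$f(z+k+l\tau)=(-1)^{k\cdot k}(-q^{-1/2})^{l\cdot l}e^{-2\pi i\,l\cdot z}f(z)\qquad(k,l\in\mathbb Z^N,\ q^{1/2}=e^{\pi i\tau}),$$ i.e. if $f$ is a section of the line bundle given by $M$ on $(\mathbb C/\langle1,\tau\rangle)^N$. For $1\le i<m$ and a nontrivial character $\nu$ in the variables $\mu_1,\dots,\mu_r,h$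 (a Laurent monomial) let $$\mathfrak C_i^\nu(f)=\delta\big(\tfrac{x_{i+1}}{x_i},\nu\big)f+\delta\big(\tfrac{x_i}{x_{i+1}},h\big)s_if,$$ where $s_i$ exchanges $x_i$ and $x_{i+1}$. The parameter $\nu$ is admissible for $\mathfrak C_i$ applied to a pure function $f$ if $\mathfrak C_i^\nu(f)$ is pure. For a reduced word $w=s_{i_1}\cdots s_{i_\ell}$ in $\mathfrak S_m$ let $\mathfrak C_w^\diamond(f)=\mathfrak C_{i_1}^{\nu_1}\cdots\mathfrak C_{i_\ell}^{\nu_\ell}(f)$, with each $\nu_k$ admissible for $\mathfrak C_{i_k}$ applied to $\mathfrak C_{i_{k+1}}^{\nu_{k+1}}\cdots\mathfrak C_{i_\ell}^{\nu_\ell}(f)$. A labelled link pattern of size $m$ and rank $r$ is a sequence $\mathcal P=((a_1,b_1),\dots,(a_r,b_r))$ with $a_1,\dots,a_r,b_1,\dots,b_r\in\{1,\dots,m\}$ all different. The group $\mathfrak S_r\times\mathfrak S_m$ acts on them: $w\in\mathfrak S_m$ sends $(a,b)$ to $(w(a),w(b))$, and $\sigma\in\mathfrak S_r$, written $\sigma^\mu$,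 moves the pair in position $i$ to position $\sigma(i)$. On functions, $\sigma^\mu$ replaces $\mu_i$ by $\mu_{\sigma(i)}$. Let $\mathcal P^{\min}_{m,r}=((m-r+1,1),(m-r+2,2),\dots,(m,r))$ and $$\mathcal E\ell\ell(\mathcal P^{\min}_{m,r})=\prod_{i=1}^r\Big(\delta\big(u\tfrac{x_i}{x_{m-r+i}},\mu_i\big)\prod_{j=m-r+i+1}^m\delta\big(u\tfrac{x_i}{x_j},h\big)\Big).$$ Theorem. Let $\mathcal P$ be a labelled link pattern of size $m$ and rank $r$. There is a unique meromorphic function $\mathcal E\ell\ell(\mathcal P)$ such that for every pair $(\sigma,w)\in\mathfrak S_r\times\mathfrak S_m$ with $\mathcal P=\sigma^\mu w\mathcal P^{\min}_{m,r}$ and with $w$ of minimal length among all such pairs, the function $\mathfrak C_w^\diamond(\mathcal E\ell\ell(\mathcal P^{\min}_{m,r}))$ is well defined (for every reduced word of $w$ admissible parameters exist, and the result depends neither on the word nor on the choice of the parameters) and $$\sigma^\mu\,\mathfrak C_w^\diamond\big(\mathcal E\ell\ell(\mathcal P^{\min}_{m,r})\big)=\mathcal E\ell\ell(\mathcal P).$$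 That is, $\sigma^\mu\mathfrak C_w^\diamond(\mathcal E\ell\ell(\mathcal P^{\min}_{m,r}))$ does not depend on such a pair $(\sigma,w)$. -/

import Mathlib

noncomputable section

open Complex Filter Topology

namespace LinkPattern

/-! ### Meromorphic functions on `ℂ^ι` -/

/-- The ring of entire (holomorphic) functions on `ℂ^ι`. -/
def Entire (ι : Type) [Fintype ι] : Subalgebra ℂ ((ι → ℂ) → ℂ) where
  carrier := {f | AnalyticOnNhd ℂ f Set.univ}
  mul_mem' hf hg := AnalyticOnNhd.mul hf hg
  add_mem' hf hg := AnalyticOnNhd.add hf hg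
  algebraMap_mem' _ := analyticOnNhd_const

instance instIsDomainEntire (ι : Type) [Fintype ι] : IsDomain (Entire ι) := by
  have : NoZeroDivisors (Entire ι) := by
    refine ⟨fun {f g} hfg => ?_⟩
    by_contra! h
    obtain ⟨hf, hg⟩ := h
    obtain ⟨z, hz⟩ : ∃ z, f.1 z ≠ 0 := by
      by_contra! h0
      exact hf (Subtype.ext (funext h0))
    apply hg
    apply Subtype.ext
    refine AnalyticOnNhd.eq_of_eventuallyEq (𝕜 := ℂ) (z₀ := z) g.2 analyticOnNhd_const ?_
    have hc : ContinuousAt f.1 z := (f.2 z (Set.mem_univ z)).continuousAt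
    filter_upwards [hc.eventually_ne hz] with y hy
    have hy' : f.1 y * g.1 y = 0 := congrFun (congrArg Subtype.val hfg) y
    exact (mul_eq_zero.mp hy').resolve_left hy
  exact NoZeroDivisors.to_isDomain _

/-- The field of meromorphic functions on `ℂ^ι`: every meromorphic function on `ℂ^ι` is a quotient
of two entire functions, so this is the fraction field of the domain of entire functions.
A meromorphic function on `(ℂˣ)^ι` is identified with its pull-back along
`z ↦ (exp (2πi z_v))_v`; thus coordinates are written additively. -/
abbrev Mero (ι : Type) [Fintype ι] : Type := FractionRing (Entire ι)

/-- Pull-back of entire functions along an analytic map, `f ↦ f ∘ A`. -/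
def Entire.comp {ι : Type} [Fintype ι] (A : (ι → ℂ) → (ι → ℂ))
    (hA : AnalyticOnNhd ℂ A Set.univ) : Entire ι →+* Entire ι where
  toFun f := ⟨fun z => f.1 (A z), fun z _ =>
    AnalyticAt.fun_comp (f.2 (A z) (Set.mem_univ _)) (hA z (Set.mem_univ _))⟩
  map_one' := rfl
  map_mul' _ _ := rfl
  map_zero' := rfl
  map_add' _ _ := rfl

theorem Entire.comp_injective {ι : Type} [Fintype ι] (A : (ι → ℂ) → (ι → ℂ))
    (hA : AnalyticOnNhd ℂ A Set.univ) (hs : Function.Surjective A) :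
    Function.Injective (Entire.comp A hA) := by
  intro f g hfg
  apply Subtype.ext
  funext z
  obtain ⟨y, rfl⟩ := hs z
  exact congrFun (congrArg Subtype.val hfg) y

/-- Pull-back of meromorphic functions along a surjective analytic map, `f ↦ f ∘ A`. -/
def Mero.comp {ι : Type} [Fintype ι] (A : (ι → ℂ) → (ι → ℂ))
    (hA : AnalyticOnNhd ℂ A Set.univ) (hs : Function.Surjective A) : Mero ι →+* Mero ι :=
  IsFractionRing.map (Entire.comp_injective A hA hs)

/-- The meromorphic function `z ↦ f (z + a)`. -/
def Mero.translate {ι : Type} [Fintype ι] (a : ι → ℂ) : Mero ι →+* Mero ι :=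
  Mero.comp (fun z => z + a) (fun _ _ => analyticAt_id.add analyticAt_const)
    (fun z => ⟨z - a, sub_add_cancel z a⟩)

/-- The meromorphic function `z ↦ f (z ∘ π)`: the permutation `π` of the variables acts by
renaming the variable `v` to `π v`. -/
def Mero.rename {ι : Type} [Fintype ι] (π : Equiv.Perm ι) : Mero ι →+* Mero ι :=
  Mero.comp (fun z v => z (π v))
    (fun _ _ => analyticAt_pi_iff.mpr fun v =>
      (ContinuousLinearMap.proj (R := ℂ) (φ := fun _ : ι => ℂ) (π v)).analyticAt _)
    (fun z => ⟨fun v => z (π.symm v), by funext v; simp⟩)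

/-- The linear form `z ↦ ∑ v, c v * z v`, the additive version of the character
`∏ v, v ^ (c v)`. -/
def linForm {ι : Type} [Fintype ι] (c : ι → ℤ) (z : ι → ℂ) : ℂ := ∑ v, (c v : ℂ) * z v

theorem analyticAt_linForm {ι : Type} [Fintype ι] (c : ι → ℤ) (z : ι → ℂ) :
    AnalyticAt ℂ (linForm c) z := by
  have h : linForm c = fun y => ∑ v, (c v : ℂ) * y v := rfl
  rw [h]
  exact Finset.analyticAt_fun_sum _ fun v _ => analyticAt_const.mul
    ((ContinuousLinearMap.proj (R := ℂ) (φ := fun _ : ι => ℂ) v).analyticAt z)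

/-! ### The theta function and `δ` -/

/-- The nome `q = exp (2πiτ)`. -/
def nome (τ : UpperHalfPlane) : ℂ := exp (2 * Real.pi * I * τ)

/-- The theta function
`θ(x) = 2 q^{1/8} sin(πx) ∏_{n ≥ 1} (1 - q^n) (1 - q^n e^{2πix}) (1 - q^n e^{-2πix})`. -/
def theta (τ : UpperHalfPlane) (x : ℂ) : ℂ :=
  2 * exp (Real.pi * I * τ / 4) * sin (Real.pi * x) *
    ∏' n : ℕ, ((1 - nome τ ^ (n + 1)) * (1 - nome τ ^ (n + 1) * exp (2 * Real.pi * I * x)) *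
      (1 - nome τ ^ (n + 1) * exp (-(2 * Real.pi * I * x))))

theorem norm_nome_lt_one (τ : UpperHalfPlane) : ‖nome τ‖ < 1 :=
  UpperHalfPlane.norm_exp_two_pi_I_lt_one τ

theorem multipliable_nome (τ : UpperHalfPlane) (w : ℂ) :
    Multipliable fun n : ℕ => 1 - nome τ ^ (n + 1) * w := by
  have hs : Summable fun n : ℕ => ‖-(nome τ ^ (n + 1) * w)‖ := by
    simpa using ((summable_nat_add_iff 1).mpr (summable_geometric_of_lt_one (norm_nonneg _)
      (norm_nome_lt_one τ))).mul_right ‖w‖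
  simpa [sub_eq_add_neg] using multipliable_one_add_of_summable hs

theorem differentiable_nomeProd (τ : UpperHalfPlane) :
    Differentiable ℂ fun w : ℂ => ∏' n : ℕ, (1 - nome τ ^ (n + 1) * w) := by
  have hp : HasProdLocallyUniformlyOn (fun (n : ℕ) (w : ℂ) => 1 - nome τ ^ (n + 1) * w)
      (fun w => ∏' n : ℕ, (1 - nome τ ^ (n + 1) * w)) Set.univ := by
    simp_rw [sub_eq_add_neg]
    apply hasProdLocallyUniformlyOn_of_forall_compact isOpen_univ
    intro K _ hK
    obtain ⟨C, hC⟩ := hK.isBounded.exists_norm_le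
    refine (((summable_nat_add_iff 1).mpr (summable_geometric_of_lt_one (norm_nonneg _)
      (norm_nome_lt_one τ))).mul_right C).hasProdUniformlyOn_nat_one_add hK
      (.of_forall fun n w hw => ?_) (fun _ => by fun_prop)
    simp only [norm_neg, norm_mul, norm_pow]
    exact mul_le_mul_of_nonneg_left (hC w hw) (by positivity)
  rw [← differentiableOn_univ]
  exact hp.differentiableOn (.of_forall fun _ => by
    simpa [Finset.prod_fn] using DifferentiableOn.finsetProd (fun _ _ => by fun_prop)) isOpen_univ

theorem differentiable_theta (τ : UpperHalfPlane) : Differentiable ℂ (theta τ) := by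
  have h : theta τ = fun x => 2 * exp (Real.pi * I * τ / 4) * sin (Real.pi * x) *
      ((∏' n : ℕ, (1 - nome τ ^ (n + 1) * 1)) *
        (fun w : ℂ => ∏' n : ℕ, (1 - nome τ ^ (n + 1) * w)) (exp (2 * Real.pi * I * x)) *
        (fun w : ℂ => ∏' n : ℕ, (1 - nome τ ^ (n + 1) * w)) (exp (-(2 * Real.pi * I * x)))) := by
    funext x
    have h1 := multipliable_nome τ 1
    have h2 := multipliable_nome τ (exp (2 * Real.pi * I * x))
    have h3 := multipliable_nome τ (exp (-(2 * Real.pi * I * x)))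
    simp only [theta]
    rw [← h1.tprod_mul h2, ← (h1.mul h2).tprod_mul h3]
    simp
  rw [h]
  have e1 : Differentiable ℂ fun x : ℂ => exp (2 * Real.pi * I * x) := by fun_prop
  have e2 : Differentiable ℂ fun x : ℂ => exp (-(2 * Real.pi * I * x)) := by fun_prop
  have e3 : Differentiable ℂ fun x : ℂ => 2 * exp (Real.pi * I * τ / 4) * sin (Real.pi * x) := by
    fun_prop
  exact e3.mul (((differentiable_const _).mul ((differentiable_nomeProd τ).comp e1)).mul
    ((differentiable_nomeProd τ).comp e2))

/-- The entire function `z ↦ g (linForm c z)` as a meromorphic function. -/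
def ofLinForm {ι : Type} [Fintype ι] (g : ℂ → ℂ) (hg : Differentiable ℂ g) (c : ι → ℤ) : Mero ι :=
  algebraMap (Entire ι) (Mero ι)
    ⟨fun z => g (linForm c z), fun z _ =>
      AnalyticAt.fun_comp (hg.analyticAt _) (analyticAt_linForm c z)⟩

/-- `θ` evaluated at an integral linear form in the variables. -/
def thetaAt {ι : Type} [Fintype ι] (τ : UpperHalfPlane) (c : ι → ℤ) : Mero ι :=
  ofLinForm (theta τ) (differentiable_theta τ) c

/-- `δ(a, b) = θ'(0) θ(a + b) / (θ(a) θ(b))` for two nonzero integral linear forms `a`, `b` in the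
additive variables (equivalently, for two nontrivial characters in the multiplicative ones). -/
def delta {ι : Type} [Fintype ι] (τ : UpperHalfPlane) (a b : ι → ℤ) : Mero ι :=
  algebraMap ℂ (Mero ι) (deriv (theta τ) 0) * thetaAt τ (a + b) / (thetaAt τ a * thetaAt τ b)

/-! ### Types and purity -/

/-- The bilinear form `k · l = ∑ v w, M v w * k v * l w`. -/
def pairing {ι : Type} [Fintype ι] (M : Matrix ι ι ℤ) (k l : ι → ℤ) : ℤ :=
  ∑ v, ∑ w, M v w * k v * l w

/-- The automorphy factor at `(k, l)` of the line bundle on `(ℂ / ⟨1, τ⟩)^ι` given by the symmetric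
integral matrix `M`:
`z ↦ (-1)^{k·k} (-q^{-1/2})^{l·l} exp (-2πi l·z)`, with `q^{1/2} = exp (πiτ)`. -/
def automorphy {ι : Type} [Fintype ι] (τ : UpperHalfPlane) (M : Matrix ι ι ℤ) (k l : ι → ℤ) :
    Mero ι :=
  algebraMap ℂ (Mero ι)
      ((-1) ^ pairing M k k * (-exp (-(Real.pi * I * τ))) ^ pairing M l l) *
    ofLinForm (fun s => exp (-(2 * Real.pi * I * s))) (by fun_prop)
      (fun w => ∑ v, M v w * l v)

/-- `f` has the type of the quadratic form `½ ∑ v w, M v w z_v z_w`, that is, `f` is a meromorphic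
section of the line bundle on `(ℂ / ⟨1, τ⟩)^ι` given by the symmetric integral matrix `M`:
`f(z + k + l τ) = (-1)^{k·k} (-q^{-1/2})^{l·l} exp (-2πi l·z) f(z)` for all `k`, `l`. -/
def HasType {ι : Type} [Fintype ι] (τ : UpperHalfPlane) (f : Mero ι) (M : Matrix ι ι ℤ) : Prop :=
  M.IsSymm ∧ ∀ k l : ι → ℤ,
    Mero.translate (fun v => (k v : ℂ) + (l v : ℂ) * (τ : ℂ)) f = automorphy τ M k l * f

/-- `f` is pure: it has some type, i.e. it is a section of a single line bundle. -/
def IsPure {ι : Type} [Fintype ι] (τ : UpperHalfPlane) (f : Mero ι) : Prop :=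
  ∃ M : Matrix ι ι ℤ, HasType τ f M

/-! ### The variables `x_1, …, x_m, μ_1, …, μ_r, u, h` -/

/-- The `m + r + 2` variables. -/
abbrev Var (m r : ℕ) : Type := (Fin m ⊕ Fin r) ⊕ Bool

/-- The linear form given by the variable `x_i`. -/
def X {m r : ℕ} (i : Fin m) : Var m r → ℤ := Pi.single (Sum.inl (Sum.inl i)) 1

/-- The linear form given by the variable `μ_j`. -/
def Mu {m r : ℕ} (j : Fin r) : Var m r → ℤ := Pi.single (Sum.inl (Sum.inr j)) 1

/-- The linear form given by the variable `u`. -/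
def U {m r : ℕ} : Var m r → ℤ := Pi.single (Sum.inr false) 1

/-- The linear form given by the variable `h`. -/
def H {m r : ℕ} : Var m r → ℤ := Pi.single (Sum.inr true) 1

/-- The action of `w ∈ S_m` on functions by permuting the `x` variables, `x_i ↦ x_{w i}`. -/
def permX {m r : ℕ} (w : Equiv.Perm (Fin m)) : Mero (Var m r) →+* Mero (Var m r) :=
  Mero.rename (Equiv.sumCongr (Equiv.sumCongr w (Equiv.refl _)) (Equiv.refl _))

/-- The action `σ^μ` of `σ ∈ S_r` on functions by permuting the `μ` variables,
`μ_j ↦ μ_{σ j}`. -/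
def permMu {m r : ℕ} (σ : Equiv.Perm (Fin r)) : Mero (Var m r) →+* Mero (Var m r) :=
  Mero.rename (Equiv.sumCongr (Equiv.sumCongr (Equiv.refl _) σ) (Equiv.refl _))

/-! ### Permutations, lengths and reduced words -/

/-- The left node `i` of the `i`-th simple transposition of `{0, …, m - 1}`. -/
def lo {m : ℕ} (i : Fin (m - 1)) : Fin m := ⟨i, by have := i.2; omega⟩

/-- The right node `i + 1` of the `i`-th simple transposition of `{0, …, m - 1}`. -/
def hi {m : ℕ} (i : Fin (m - 1)) : Fin m := ⟨i + 1, by have := i.2; omega⟩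

/-- The simple transposition `s_i = (i, i + 1)`. -/
def simple {m : ℕ} (i : Fin (m - 1)) : Equiv.Perm (Fin m) := Equiv.swap (lo i) (hi i)

/-- The length of a permutation: its number of inversions. -/
def len {m : ℕ} (w : Equiv.Perm (Fin m)) : ℕ :=
  (Finset.univ.filter fun p : Fin m × Fin m => p.1 < p.2 ∧ w p.2 < w p.1).card

/-- `L = [i_1, …, i_l]` is a reduced word of `w`: `w = s_{i_1} ⋯ s_{i_l}` with `l = len w`. -/
def IsReducedWord {m : ℕ} (L : List (Fin (m - 1))) (w : Equiv.Perm (Fin m)) : Prop :=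
  (L.map simple).prod = w ∧ L.length = len w

/-! ### Elliptic Demazure operations -/

/-- The elliptic Demazure operation
`𝔠_i^ν f = δ(x_{i+1}/x_i, ν) f + δ(x_i/x_{i+1}, h) s_i f`, for a nontrivial character `ν`. -/
def demazure {m r : ℕ} (τ : UpperHalfPlane) (i : Fin (m - 1)) (ν : Var m r → ℤ)
    (f : Mero (Var m r)) : Mero (Var m r) :=
  delta τ (X (hi i) - X (lo i)) ν * f + delta τ (X (lo i) - X (hi i)) H * permX (simple i) f

/-- `ν` is a character in the variables `μ_1, …, μ_r, h` only. -/
def IsParameter {m r : ℕ} (ν : Var m r → ℤ) : Prop :=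
  (∀ i : Fin m, ν (Sum.inl (Sum.inl i)) = 0) ∧ ν (Sum.inr false) = 0

/-- `g = 𝔠_i^⋄ f`: `g` is pure and `g = 𝔠_i^ν f` for some nontrivial character `ν` in the
variables `μ_1, …, μ_r, h` (an admissible parameter for `𝔠_i` applied to `f`). -/
def DiamondStep {m r : ℕ} (τ : UpperHalfPlane) (i : Fin (m - 1)) (f g : Mero (Var m r)) : Prop :=
  ∃ ν : Var m r → ℤ, IsParameter ν ∧ ν ≠ 0 ∧ g = demazure τ i ν f ∧ IsPure τ g

/-- `g = 𝔠_{i_1}^{ν_1} 𝔠_{i_2}^{ν_2} ⋯ 𝔠_{i_l}^{ν_l} f` for the word `[i_1, …, i_l]`, where each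
parameter is admissible for the operation it belongs to. -/
def DiamondWord {m r : ℕ} (τ : UpperHalfPlane) :
    List (Fin (m - 1)) → Mero (Var m r) → Mero (Var m r) → Prop
  | [], f, g => g = f
  | i :: L, f, g => ∃ g' : Mero (Var m r), DiamondWord τ L f g' ∧ DiamondStep τ i g' g

/-- `𝔠_w^⋄ f` is well defined and equal to `g`: `w` has a reduced word, and along every reduced
word of `w` the composition of admissible operations exists and has `g` as its only value. -/
def IsDiamond {m r : ℕ} (τ : UpperHalfPlane) (w : Equiv.Perm (Fin m))
    (f g : Mero (Var m r)) : Prop :=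
  (∃ L, IsReducedWord L w) ∧
    ∀ L, IsReducedWord L w → ∀ g' : Mero (Var m r), DiamondWord τ L f g' ↔ g' = g

/-! ### Labelled link patterns -/

/-- A labelled link pattern of size `m` and rank `r`: a sequence of `r` arrows
(source, target), whose `2r` ends are all different. -/
@[ext]
structure Pattern (m r : ℕ) where
  source : Fin r → Fin m
  target : Fin r → Fin m
  distinct : Function.Injective (Sum.elim source target)

/-- The minimal link pattern `((m-r+1, 1), (m-r+2, 2), …, (m, r))` (with nodes counted from
`1`). -/
def minPattern (m r : ℕ) (hm : 2 * r ≤ m) : Pattern m r where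
  source i := ⟨m - r + i, by have := i.2; omega⟩
  target i := ⟨i, by have := i.2; omega⟩
  distinct := by
    rintro (i | i) (j | j) h <;> have hi := i.2 <;> have hj := j.2 <;>
      simp only [Sum.elim_inl, Sum.elim_inr, Fin.mk.injEq] at h
    · exact congrArg Sum.inl (Fin.ext (by omega))
    · omega
    · omega
    · exact congrArg Sum.inr (Fin.ext (by omega))

/-- The action `(σ, w) ↦ σ^μ w P` of `S_r × S_m` on labelled link patterns: `w` moves the nodes and
`σ` moves the labels, i.e. the arrow `(a, b)` with label `i` becomes the arrow `(w a, w b)` with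
label `σ i`. -/
def Pattern.act {m r : ℕ} (σ : Equiv.Perm (Fin r)) (w : Equiv.Perm (Fin m)) (P : Pattern m r) :
    Pattern m r where
  source i := w (P.source (σ.symm i))
  target i := w (P.target (σ.symm i))
  distinct := by
    have h : Sum.elim (fun i => w (P.source (σ.symm i))) (fun i => w (P.target (σ.symm i))) =
        w ∘ Sum.elim P.source P.target ∘ Sum.map σ.symm σ.symm := by
      funext x
      rcases x with i | i <;> rfl
    rw [h]
    exact w.injective.comp (P.distinct.comp
      (Sum.map_injective.mpr ⟨σ.symm.injective, σ.symm.injective⟩))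

/-- `P = σ^μ w P^min` and `w` has minimal length among all pairs with this property. -/
def IsMinimalPresentation {m r : ℕ} (hm : 2 * r ≤ m) (P : Pattern m r)
    (σ : Equiv.Perm (Fin r)) (w : Equiv.Perm (Fin m)) : Prop :=
  P = (minPattern m r hm).act σ w ∧
    ∀ (σ' : Equiv.Perm (Fin r)) (w' : Equiv.Perm (Fin m)),
      P = (minPattern m r hm).act σ' w' → len w ≤ len w'

/-- The elliptic class of the minimal link pattern,
`∏_{i=1}^r (δ(u x_i/x_{m-r+i}, μ_i) ∏_{j=m-r+i+1}^m δ(u x_i/x_j, h))`. -/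
def ellMin {m r : ℕ} (τ : UpperHalfPlane) (hm : 2 * r ≤ m) : Mero (Var m r) :=
  ∏ i : Fin r,
    (delta τ (U + X ((minPattern m r hm).target i) - X ((minPattern m r hm).source i)) (Mu i) *
      ∏ j ∈ Finset.univ.filter (fun j : Fin m => (minPattern m r hm).source i < j),
        delta τ (U + X ((minPattern m r hm).target i) - X j) H)

end LinkPattern

end

/-!
The proof rests on two facts: the weights of the nodes of a link pattern determine the admissible
parameters, and the three-term identity of the theta function yields both the braid relations and
one more relation, which exchanges two neighbouring arrows of the minimal link pattern.

**Admissible parameters.** `δ(a, b)` has the type of the quadratic form `a b` (`hasType_delta`). So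
the elliptic class of the minimal link pattern is pure, and its type is
`∑ x_p (wt p - p h) + u ρ` (`weightType`) for certain pairwise different characters `wt p` in the
variables `μ_i`, `h` (`minWeight`, `hasType_ellMin`). If a function of this type is given, then the
operation at the nodes `i`, `i + 1` with the parameter `wt i - wt (i + 1)` gives a pure function
again, with these two weights exchanged (`HasType.demazure`). No other parameter is admissible: if
the sum of two nonzero pure functions is pure, then both have the same type
(`HasType.eq_of_isPure_add`), because sections of pairwise different line bundles are linearly
independent. For three of them (`HasType.three_add_ne_zero`) one translates the relation twice by a
period `l τ`; the determinant of the resulting linear system is a sum of products of automorphy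
factors, one of which dominates along a suitable line. Hence along each word the admissible parameters exist, are unique, and are differences
of weights (`diamondWord_iff`).

**Independence of the word.** By Matsumoto's theorem (`eq_of_isReducedWord`) it is enough to check
the commutation relations and the braid relations for the operations with these parameters
(`demazure_comm`, `demazure_braid`). The braid relation reduces to two instances of the three-term
identity and a cubic identity (`delta_fay`, `delta_cubic`). The three-term identity itself
(`threeTerm_eq_zero`) is Liouville's theorem applied to a quotient of quasi-periodic functions.

**Independence of the presentation.** Let `a_j` and `b_j` be the sources and the targets of the
arrows of the minimal link pattern. Applied to its elliptic class, the operation at `b_j`, `b_{j+1}`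
agrees with the operation at `a_j`, `a_{j+1}` up to an exchange of `μ_j` and `μ_{j+1}`
(`demazure_exchange`, again a consequence of the three-term identity). So if a minimal presentation
`(σ, w)` inverts the sources of the arrows `j`, `j + 1`, it can be replaced by the presentation
`(σ s_j, w s s')`, where `s` and `s'` exchange the two sources and the two targets; it is again
minimal and gives the same function (`IsMinimalPresentation.exchange`, `ellOf_exchange`). Repeating
this one arrives at a minimal presentation whose `w` is increasing on the sources. As `w` is
increasing on the isolated nodes by minimality, there is only one such presentation
(`IsMinimalPresentation.eq_of_strictMono_src`).
-/

noncomputable section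

open Complex Filter Topology

namespace LinkPattern

/-! ### The theta function: zeros and quasi-periods -/

/-- The product `∏ (1 - q^n w)` over `n ≥ 1`. -/
def nomeProd (τ : UpperHalfPlane) (w : ℂ) : ℂ := ∏' n : ℕ, (1 - nome τ ^ (n + 1) * w)

theorem nomeProd_eq_mul (τ : UpperHalfPlane) (w : ℂ) :
    nomeProd τ w = (1 - nome τ * w) * nomeProd τ (nome τ * w) := by
  have e : (fun n : ℕ => 1 - nome τ ^ (n + 1) * (nome τ * w)) =
      fun n : ℕ => 1 - nome τ ^ (n + 1 + 1) * w :=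
    funext fun n => by rw [pow_succ _ (n + 1), mul_assoc]
  have h : Multipliable fun n : ℕ => 1 - nome τ ^ (n + 1 + 1) * w :=
    e ▸ multipliable_nome τ (nome τ * w)
  have h' := tprod_eq_zero_mul' (f := fun n : ℕ => 1 - nome τ ^ (n + 1) * w) h
  rw [← e, zero_add, pow_one] at h'
  exact h'

theorem exists_of_nomeProd_eq_zero {τ : UpperHalfPlane} {w : ℂ} (h : nomeProd τ w = 0) :
    ∃ n : ℕ, nome τ ^ (n + 1) * w = 1 := by
  by_contra! hn
  have hs : Summable fun n : ℕ => ‖-(nome τ ^ (n + 1) * w)‖ := by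
    simpa using ((summable_nat_add_iff 1).mpr (summable_geometric_of_lt_one (norm_nonneg _)
      (norm_nome_lt_one τ))).mul_right ‖w‖
  refine tprod_one_add_ne_zero_of_summable (f := fun n : ℕ => -(nome τ ^ (n + 1) * w))
    (fun n h0 => hn n ?_) hs ?_
  · linear_combination -h0
  · simpa [sub_eq_add_neg, nomeProd] using h

theorem theta_eq (τ : UpperHalfPlane) (x : ℂ) :
    theta τ x = 2 * exp (Real.pi * I * τ / 4) * sin (Real.pi * x) *
      (nomeProd τ 1 * nomeProd τ (exp (2 * Real.pi * I * x)) *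
        nomeProd τ (exp (-(2 * Real.pi * I * x)))) := by
  have h1 := multipliable_nome τ 1
  have h2 := multipliable_nome τ (exp (2 * Real.pi * I * x))
  have h3 := multipliable_nome τ (exp (-(2 * Real.pi * I * x)))
  simp only [theta, nomeProd]
  rw [← h1.tprod_mul h2, ← (h1.mul h2).tprod_mul h3]
  simp

theorem theta_neg (τ : UpperHalfPlane) (x : ℂ) : theta τ (-x) = -theta τ x := by
  simp only [theta_eq, mul_neg, sin_neg, neg_neg]
  ring

theorem theta_zero (τ : UpperHalfPlane) : theta τ 0 = 0 := by simp [theta_eq]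

theorem theta_add_one (τ : UpperHalfPlane) (x : ℂ) : theta τ (x + 1) = -theta τ x := by
  have e1 : exp (2 * Real.pi * I * (x + 1)) = exp (2 * Real.pi * I * x) := by
    rw [mul_add, mul_one, exp_add, exp_two_pi_mul_I, mul_one]
  rw [theta_eq, theta_eq, exp_neg, e1, ← exp_neg, mul_add, mul_one, sin_add_pi]
  ring

theorem theta_add_tau (τ : UpperHalfPlane) (x : ℂ) :
    theta τ (x + τ) =
      -exp (-(Real.pi * I * τ)) * exp (-(2 * Real.pi * I * x)) * theta τ x := by
  have hw : exp (2 * Real.pi * I * (x + τ)) = nome τ * exp (2 * Real.pi * I * x) := by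
    rw [nome, ← exp_add]
    ring_nf
  have hw' : exp (-(2 * Real.pi * I * x)) = nome τ * exp (-(2 * Real.pi * I * (x + τ))) := by
    rw [nome, ← exp_add]
    ring_nf
  -- Moving `x` by `τ` moves one factor from the first product to the sine, and one factor from
  -- the sine to the second product.
  have h1 := nomeProd_eq_mul τ (exp (2 * Real.pi * I * x))
  have h2 := nomeProd_eq_mul τ (exp (-(2 * Real.pi * I * (x + τ))))
  rw [← hw'] at h2
  rw [← hw] at h1
  have s1 : sin (Real.pi * (x + τ)) = -exp (-(Real.pi * I * τ)) * exp (-(Real.pi * I * x)) *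
      (1 - exp (2 * Real.pi * I * (x + τ))) * (-I / 2) := by
    have a : exp (-(Real.pi * I * τ)) * exp (-(Real.pi * I * x)) =
        exp (-(Real.pi * (x + τ)) * I) := by
      rw [← exp_add]
      ring_nf
    have b : exp (2 * Real.pi * I * (x + τ)) =
        exp (Real.pi * (x + τ) * I) * exp (Real.pi * (x + τ) * I) := by
      rw [← exp_add]
      ring_nf
    have d : exp (-(Real.pi * (x + τ)) * I) * exp (Real.pi * (x + τ) * I) = 1 := by
      rw [← exp_add]
      simp
    rw [sin, b]
    linear_combination (I / 2) * exp (Real.pi * (x + τ) * I) * d - (I / 2) *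
      (1 - exp (Real.pi * (x + τ) * I) * exp (Real.pi * (x + τ) * I)) * a
  have s2 : (1 - exp (-(2 * Real.pi * I * x))) * exp (-(Real.pi * I * x)) * (-I / 2) =
      exp (-(2 * Real.pi * I * x)) * sin (Real.pi * x) := by
    have a : exp (-(Real.pi * I * x)) = exp (-(Real.pi * x) * I) := by ring_nf
    have b : exp (-(2 * Real.pi * I * x)) =
        exp (-(Real.pi * x) * I) * exp (-(Real.pi * x) * I) := by
      rw [← exp_add]
      ring_nf
    have d : exp (-(Real.pi * x) * I) * exp (Real.pi * x * I) = 1 := by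
      rw [← exp_add]
      simp
    rw [sin, a, b]
    linear_combination (I / 2) * exp (-(Real.pi * x) * I) * d
  rw [theta_eq, theta_eq, h1, h2, s1]
  rw [hw'] at s2 ⊢
  linear_combination (-2 * exp (Real.pi * I * τ / 4) * exp (-(Real.pi * I * τ)) * nomeProd τ 1 *
    (1 - exp (2 * Real.pi * I * (x + τ))) * nomeProd τ (exp (2 * Real.pi * I * (x + τ))) *
    nomeProd τ (nome τ * exp (-(2 * Real.pi * I * (x + τ))))) * s2

theorem theta_add_int (τ : UpperHalfPlane) (x : ℂ) (k : ℤ) :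
    theta τ (x + k) = (-1) ^ k * theta τ x := by
  induction k with
  | zero => simp
  | succ n ih =>
    have : x + ((n : ℤ) + 1 : ℤ) = (x + (n : ℤ)) + 1 := by push_cast; ring
    rw [this, theta_add_one, ih, zpow_add_one₀ (by norm_num)]
    ring
  | pred n ih =>
    have : x + (-(n : ℤ) : ℤ) = (x + (-(n : ℤ) - 1 : ℤ)) + 1 := by push_cast; ring
    rw [this, theta_add_one] at ih
    rw [zpow_sub_one₀ (by norm_num), inv_neg_one]
    linear_combination -ih

theorem theta_add_int_mul_tau (τ : UpperHalfPlane) (x : ℂ) (l : ℤ) :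
    theta τ (x + l * τ) =
      (-exp (-(Real.pi * I * τ))) ^ (l * l) * exp (-(2 * Real.pi * I * (l * x))) * theta τ x := by
  have hQ : -exp (-(Real.pi * I * τ)) ≠ 0 := neg_ne_zero.mpr (exp_ne_zero _)
  have key : ∀ l : ℤ, (-exp (-(Real.pi * I * τ))) ^ ((l + 1) * (l + 1)) *
      exp (-(2 * Real.pi * I * ((l + 1 : ℤ) * x))) =
      -exp (-(Real.pi * I * τ)) * exp (-(2 * Real.pi * I * (x + l * τ))) *
      ((-exp (-(Real.pi * I * τ))) ^ (l * l) * exp (-(2 * Real.pi * I * (l * x)))) := by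
    intro l
    have h1 : (-exp (-(Real.pi * I * τ))) ^ ((l + 1) * (l + 1)) =
        (-exp (-(Real.pi * I * τ))) ^ (l * l) * exp (-(2 * Real.pi * I * (l * τ))) *
          (-exp (-(Real.pi * I * τ))) := by
      rw [show (l + 1) * (l + 1) = l * l + 2 * l + 1 by ring, zpow_add₀ hQ, zpow_add₀ hQ, zpow_one,
        zpow_mul _ 2 l]
      have : exp (-(2 * Real.pi * I * (l * τ))) = (exp (-(2 * Real.pi * I * τ))) ^ l := by
        rw [← exp_int_mul]
        ring_nf
      rw [this]
      congr 3
      rw [zpow_two, neg_mul_neg, ← exp_add]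
      ring_nf
    have h2 : exp (-(2 * Real.pi * I * ((l + 1 : ℤ) * x))) =
        exp (-(2 * Real.pi * I * x)) * exp (-(2 * Real.pi * I * (l * x))) := by
      rw [← exp_add]
      push_cast
      ring_nf
    have h3 : exp (-(2 * Real.pi * I * (x + l * τ))) =
        exp (-(2 * Real.pi * I * x)) * exp (-(2 * Real.pi * I * (l * τ))) := by
      rw [← exp_add]
      ring_nf
    rw [h1, h2, h3]
    ring
  induction l with
  | zero => simp
  | succ n ih =>
    have : x + ((n : ℤ) + 1 : ℤ) * (τ : ℂ) = (x + (n : ℤ) * τ) + τ := by push_cast; ring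
    rw [this, theta_add_tau, ih, key]
    ring
  | pred n ih =>
    have : x + (-(n : ℤ) : ℤ) * (τ : ℂ) = (x + (-(n : ℤ) - 1 : ℤ) * τ) + τ := by
      push_cast; ring
    have hk := key (-(n : ℤ) - 1)
    rw [sub_add_cancel] at hk
    rw [this, theta_add_tau, hk, mul_assoc _ _ (theta τ x)] at ih
    exact mul_left_cancel₀ (mul_ne_zero hQ (exp_ne_zero _)) ih

/-- The quasi-periodicity of `θ`, in the form of the automorphy factors of line bundles. -/
theorem theta_add_lattice (τ : UpperHalfPlane) (x : ℂ) (k l : ℤ) :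
    theta τ (x + (k + l * τ)) = (-1) ^ (k * k) * (-exp (-(Real.pi * I * τ))) ^ (l * l) *
      exp (-(2 * Real.pi * I * (l * x))) * theta τ x := by
  have h : x + (k + l * (τ : ℂ)) = (x + l * τ) + k := by ring
  have hk : ((-1 : ℂ)) ^ (k * k) = (-1) ^ k := by
    rcases Int.even_or_odd k with h | h
    · rw [h.neg_one_zpow, (h.mul_left k).neg_one_zpow]
    · rw [h.neg_one_zpow, (h.mul h).neg_one_zpow]
  rw [h, theta_add_int, theta_add_int_mul_tau, hk]
  ring

theorem exists_of_theta_eq_zero {τ : UpperHalfPlane} {x : ℂ} (h : theta τ x = 0) :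
    ∃ k l : ℤ, x = k + l * τ := by
  have hpi : (2 * Real.pi * I : ℂ) ≠ 0 := two_pi_I_ne_zero
  rw [theta_eq] at h
  simp only [mul_eq_zero, exp_ne_zero, OfNat.ofNat_ne_zero, or_self, false_or] at h
  rcases h with h | (h | h) | h
  · obtain ⟨k, hk⟩ := sin_eq_zero_iff.mp h
    refine ⟨k, 0, ?_⟩
    have : (Real.pi : ℂ) ≠ 0 := by exact_mod_cast Real.pi_ne_zero
    apply mul_left_cancel₀ this
    rw [hk]
    push_cast
    ring
  · obtain ⟨n, hn⟩ := exists_of_nomeProd_eq_zero h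
    rw [mul_one] at hn
    have := pow_lt_one₀ (norm_nonneg _) (norm_nome_lt_one τ) (Nat.succ_ne_zero n)
    rw [← norm_pow, Nat.succ_eq_add_one, hn, norm_one] at this
    exact absurd this (lt_irrefl _)
  · obtain ⟨n, hn⟩ := exists_of_nomeProd_eq_zero h
    rw [nome, ← exp_nat_mul, ← exp_add, exp_eq_one_iff] at hn
    obtain ⟨k, hk⟩ := hn
    refine ⟨k, -(n + 1 : ℕ), mul_left_cancel₀ hpi ?_⟩
    push_cast at hk ⊢
    linear_combination hk
  · obtain ⟨n, hn⟩ := exists_of_nomeProd_eq_zero h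
    rw [nome, ← exp_nat_mul, ← exp_add, exp_eq_one_iff] at hn
    obtain ⟨k, hk⟩ := hn
    refine ⟨-k, (n + 1 : ℕ), mul_left_cancel₀ hpi ?_⟩
    push_cast at hk ⊢
    linear_combination -hk

theorem deriv_theta_zero_ne_zero (τ : UpperHalfPlane) : deriv (theta τ) 0 ≠ 0 := by
  set R : ℂ → ℂ := fun x => 2 * exp (Real.pi * I * τ / 4) *
    (nomeProd τ 1 * nomeProd τ (exp (2 * Real.pi * I * x)) *
        nomeProd τ (exp (-(2 * Real.pi * I * x)))) with hR
  have hd : Differentiable ℂ (nomeProd τ) := differentiable_nomeProd τ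
  have hRd : Differentiable ℂ R := by
    have e1 : Differentiable ℂ fun x : ℂ => exp (2 * Real.pi * I * x) := by fun_prop
    have e2 : Differentiable ℂ fun x : ℂ => exp (-(2 * Real.pi * I * x)) := by fun_prop
    exact (differentiable_const _).mul
      (((differentiable_const _).mul (hd.comp e1)).mul (hd.comp e2))
  have h : theta τ = fun x => sin (Real.pi * x) * R x := by
    funext x
    rw [theta_eq, hR]
    ring
  have hsin : HasDerivAt (fun x : ℂ => sin (Real.pi * x)) (Real.pi : ℂ) 0 := by
    have := ((hasDerivAt_id (0 : ℂ)).const_mul (Real.pi : ℂ)).csin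
    simpa using this
  have := (hsin.mul (hRd 0).hasDerivAt).deriv
  simp only [Pi.mul_def] at this
  rw [h, this]
  have h1 : nomeProd τ 1 ≠ 0 := by
    intro h0
    obtain ⟨n, hn⟩ := exists_of_nomeProd_eq_zero h0
    rw [mul_one] at hn
    have := pow_lt_one₀ (norm_nonneg _) (norm_nome_lt_one τ) (Nat.succ_ne_zero n)
    rw [← norm_pow, Nat.succ_eq_add_one, hn, norm_one] at this
    exact absurd this (lt_irrefl _)
  have hpi : (Real.pi : ℂ) ≠ 0 := by exact_mod_cast Real.pi_ne_zero
  simp [hR, h1, hpi, exp_ne_zero]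

theorem deriv_theta_ne_zero {τ : UpperHalfPlane} {x : ℂ} (h : theta τ x = 0) :
    deriv (theta τ) x ≠ 0 := by
  obtain ⟨k, l, rfl⟩ := exists_of_theta_eq_zero h
  set c : ℂ → ℂ := fun x => (-1) ^ (k * k) * (-exp (-(Real.pi * I * τ))) ^ (l * l) *
      exp (-(2 * Real.pi * I * (l * x))) with hc
  have hcd : Differentiable ℂ c := by
    rw [hc]
    fun_prop
  have e : (fun x => theta τ (x + (k + l * τ))) = fun x => c x * theta τ x := by
    funext x
    rw [theta_add_lattice]
  have h1 : HasDerivAt (fun x => c x * theta τ x) (deriv c 0 * theta τ 0 + c 0 * deriv (theta τ) 0)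
      0 := (hcd 0).hasDerivAt.mul (differentiable_theta τ 0).hasDerivAt
  have h2 := h1.deriv
  rw [← e, deriv_comp_add_const, zero_add, theta_zero, mul_zero, zero_add] at h2
  rw [h2]
  refine mul_ne_zero ?_ (deriv_theta_zero_ne_zero τ)
  simp only [hc]
  exact mul_ne_zero (mul_ne_zero (zpow_ne_zero _ (by norm_num))
    (zpow_ne_zero _ (neg_ne_zero.mpr (exp_ne_zero _)))) (exp_ne_zero _)

/-! ### The three-term identity -/

theorem exists_fract_add_lattice (τ : UpperHalfPlane) (x : ℂ) :
    ∃ a ∈ Set.Icc (0 : ℝ) 1, ∃ b ∈ Set.Icc (0 : ℝ) 1, ∃ k l : ℤ,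
      x = (a + b * (τ : ℂ)) + k + l * τ := by
  set b : ℝ := x.im / (τ : ℂ).im
  set a : ℝ := x.re - b * (τ : ℂ).re
  refine ⟨Int.fract a, ⟨Int.fract_nonneg a, (Int.fract_lt_one a).le⟩,
    Int.fract b, ⟨Int.fract_nonneg b, (Int.fract_lt_one b).le⟩, ⌊a⌋, ⌊b⌋, ?_⟩
  have h : x = a + b * (τ : ℂ) := by
    apply Complex.ext
    · simp [a]
    · simp [b, div_mul_cancel₀ _ τ.im_ne_zero]
  have ha : ((Int.fract a : ℝ) : ℂ) + (⌊a⌋ : ℂ) = a := by exact_mod_cast Int.fract_add_floor a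
  have hb : ((Int.fract b : ℝ) : ℂ) + (⌊b⌋ : ℂ) = b := by exact_mod_cast Int.fract_add_floor b
  conv_lhs => rw [h]
  linear_combination -ha - (τ : ℂ) * hb

/-- Liouville's theorem for elliptic functions. -/
theorem eq_of_differentiable_of_periodic (τ : UpperHalfPlane) {E : ℂ → ℂ}
    (hE : Differentiable ℂ E) (h1 : ∀ x, E (x + 1) = E x) (hτ : ∀ x, E (x + τ) = E x) (x y : ℂ) :
    E x = E y := by
  apply hE.apply_eq_apply_of_bounded
  have hp1 : Function.Periodic E 1 := h1
  have hpτ : Function.Periodic E τ := hτ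
  have hK : IsCompact ((fun p : ℝ × ℝ => E (p.1 + p.2 * (τ : ℂ))) ''
      (Set.Icc (0 : ℝ) 1 ×ˢ Set.Icc (0 : ℝ) 1)) := by
    apply (isCompact_Icc.prod isCompact_Icc).image
    exact hE.continuous.comp (by fun_prop)
  refine hK.isBounded.subset ?_
  rintro _ ⟨z, rfl⟩
  obtain ⟨a, ha, b, hb, k, l, rfl⟩ := exists_fract_add_lattice τ z
  refine ⟨(a, b), ⟨ha, hb⟩, ?_⟩
  have e1 := hpτ.int_mul l ((a + b * (τ : ℂ)) + k)
  have e2 := hp1.int_mul k (a + b * (τ : ℂ))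
  rw [mul_one] at e2
  rw [e1, e2]

theorem differentiable_dslope {f : ℂ → ℂ} (hf : Differentiable ℂ f) (c : ℂ) :
    Differentiable ℂ (dslope f c) := by
  rw [← differentiableOn_univ] at hf ⊢
  exact (differentiableOn_dslope univ_mem).mpr hf

/-- Two entire functions with the same factors of quasi-periodicity, the first of which vanishes at
the zeros of the second, these being simple, are proportional: the quotient is entire and elliptic.
So the first one is zero as soon as it has a further zero. -/
theorem eq_zero_of_quasiperiodic (τ : UpperHalfPlane) {G D e : ℂ → ℂ} (hG : Differentiable ℂ G)
    (hD : Differentiable ℂ D) (hDs : ∀ x, D x = 0 → deriv D x ≠ 0) (hDG : ∀ x, D x = 0 → G x = 0)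
    (hG1 : ∀ x, G (x + 1) = G x) (hD1 : ∀ x, D (x + 1) = D x)
    (he : ∀ x, e x ≠ 0) (hGτ : ∀ x, G (x + τ) = e x * G x) (hDτ : ∀ x, D (x + τ) = e x * D x)
    {p : ℂ} (hDp : D p ≠ 0) (hGp : G p = 0) (x : ℂ) : G x = 0 := by
  classical
  set E : ℂ → ℂ := fun x => if D x = 0 then deriv G x / deriv D x else G x / D x with hEdef
  have hmul : ∀ x, D x * E x = G x := by
    intro x
    by_cases h : D x = 0
    · rw [h, zero_mul, hDG x h]
    · simp only [hEdef, if_neg h]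
      field_simp
  have hEd : Differentiable ℂ E := by
    intro x
    by_cases h : D x = 0
    · have hd : dslope D x x ≠ 0 := by
        rw [dslope_same]
        exact hDs x h
      have h1 : DifferentiableAt ℂ (fun y => dslope G x y / dslope D x y) x :=
        (differentiable_dslope hG x x).div (differentiable_dslope hD x x) hd
      refine h1.congr_of_eventuallyEq ?_
      filter_upwards [(differentiable_dslope hD x).continuous.continuousAt.eventually_ne hd]
        with y hy
      by_cases hyx : y = x
      · subst hyx
        simp [hEdef, h]
      · have hs : y - x ≠ 0 := sub_ne_zero.mpr hyx
        rw [dslope_of_ne _ hyx, slope_def_field, h, sub_zero] at hy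
        have hDy : D y ≠ 0 := fun h0 => hy (by rw [h0, zero_div])
        simp only [hEdef, if_neg hDy]
        rw [dslope_of_ne _ hyx, dslope_of_ne _ hyx, slope_def_field, slope_def_field, h,
          hDG x h, sub_zero, sub_zero]
        field_simp
    · refine ((hG x).div (hD x) h).congr_of_eventuallyEq ?_
      filter_upwards [hD.continuous.continuousAt.eventually_ne h] with y hy
      simp [hEdef, hy]
  have hdense : Dense {x | D x ≠ 0} := by
    intro x
    by_contra hx
    rw [mem_closure_iff_frequently, not_frequently] at hx
    have h0 : D =ᶠ[𝓝 x] fun _ => 0 := hx.mono fun y hy => not_not.mp hy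
    exact hDs x h0.eq_of_nhds (by rw [h0.deriv_eq, deriv_const])
  have hE1 : ∀ x, E (x + 1) = E x := by
    have hc : Continuous fun x => E (x + 1) := hEd.continuous.comp (by fun_prop)
    refine fun x => congrFun (hc.ext_on hdense hEd.continuous fun x hx => ?_) x
    have := hmul (x + 1)
    rw [hD1, hG1, ← hmul x] at this
    exact mul_left_cancel₀ hx this
  have hEτ : ∀ x, E (x + τ) = E x := by
    have hc : Continuous fun x => E (x + τ) := hEd.continuous.comp (by fun_prop)
    refine fun x => congrFun (hc.ext_on hdense hEd.continuous fun x hx => ?_) x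
    have := hmul (x + τ)
    rw [hDτ, hGτ, ← hmul x, mul_assoc] at this
    exact mul_left_cancel₀ hx (mul_left_cancel₀ (he x) this)
  have hp : E p = 0 := by
    have := hmul p
    rw [hGp] at this
    exact (mul_eq_zero.mp this).resolve_left hDp
  rw [← hmul x, eq_of_differentiable_of_periodic τ hEd hE1 hEτ x p, hp, mul_zero]

/-- The left-hand side of the three-term identity. -/
def threeTerm (τ : UpperHalfPlane) (x y z w : ℂ) : ℂ :=
  theta τ (x + y) * theta τ (x - y) * (theta τ (z + w) * theta τ (z - w)) +
    theta τ (x + z) * theta τ (x - z) * (theta τ (w + y) * theta τ (w - y)) +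
    theta τ (x + w) * theta τ (x - w) * (theta τ (y + z) * theta τ (y - z))

/-- The factor of quasi-periodicity of `θ(x + y) θ(x - y)` in the variable `x`. -/
def quadFactor (τ : UpperHalfPlane) (x : ℂ) : ℂ :=
  (-exp (-(Real.pi * I * τ)) * exp (-(2 * Real.pi * I * x))) ^ 2

theorem theta_mul_add_one (τ : UpperHalfPlane) (x y : ℂ) :
    theta τ (x + 1 + y) * theta τ (x + 1 - y) = theta τ (x + y) * theta τ (x - y) := by
  rw [show x + 1 + y = x + y + 1 by ring, show x + 1 - y = x - y + 1 by ring, theta_add_one,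
    theta_add_one]
  ring

theorem theta_mul_add_tau (τ : UpperHalfPlane) (x y : ℂ) :
    theta τ (x + τ + y) * theta τ (x + τ - y) =
      quadFactor τ x * (theta τ (x + y) * theta τ (x - y)) := by
  have h : exp (-(2 * Real.pi * I * (x + y))) * exp (-(2 * Real.pi * I * (x - y))) =
      exp (-(2 * Real.pi * I * x)) * exp (-(2 * Real.pi * I * x)) := by
    rw [← exp_add, ← exp_add]
    ring_nf
  rw [show x + τ + y = x + y + τ by ring, show x + τ - y = x - y + τ by ring, theta_add_tau,
    theta_add_tau, quadFactor]
  linear_combination (exp (-(Real.pi * I * τ)) * exp (-(Real.pi * I * τ)) * theta τ (x + y) *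
    theta τ (x - y)) * h

theorem threeTerm_of_eq (τ : UpperHalfPlane) (y z w : ℂ) : threeTerm τ y y z w = 0 := by
  have h := theta_neg τ (y - w)
  rw [neg_sub] at h
  simp only [threeTerm, sub_self, theta_zero, h]
  rw [add_comm w y]
  ring

theorem threeTerm_of_eq_third (τ : UpperHalfPlane) (z y w : ℂ) : threeTerm τ z y z w = 0 := by
  have h := theta_neg τ (z - y)
  rw [neg_sub] at h
  simp only [threeTerm, sub_self, theta_zero, h]
  rw [add_comm z y]
  ring

theorem threeTerm_neg (τ : UpperHalfPlane) (x y z w : ℂ) :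
    threeTerm τ (-x) y z w = threeTerm τ x y z w := by
  have h : ∀ v, theta τ (-x + v) * theta τ (-x - v) = theta τ (x + v) * theta τ (x - v) := by
    intro v
    rw [show -x + v = -(x - v) by ring, show -x - v = -(x + v) by ring, theta_neg, theta_neg]
    ring
  simp only [threeTerm, h]

theorem threeTerm_add_one (τ : UpperHalfPlane) (x y z w : ℂ) :
    threeTerm τ (x + 1) y z w = threeTerm τ x y z w := by
  simp only [threeTerm, theta_mul_add_one]

theorem threeTerm_add_tau (τ : UpperHalfPlane) (x y z w : ℂ) :
    threeTerm τ (x + τ) y z w = quadFactor τ x * threeTerm τ x y z w := by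
  simp only [threeTerm, theta_mul_add_tau]
  ring

theorem quadFactor_ne_zero (τ : UpperHalfPlane) (x : ℂ) : quadFactor τ x ≠ 0 :=
  pow_ne_zero _ (mul_ne_zero (neg_ne_zero.mpr (exp_ne_zero _)) (exp_ne_zero _))

theorem threeTerm_add_lattice_eq_zero (τ : UpperHalfPlane) {x y z w : ℂ}
    (h : threeTerm τ x y z w = 0) (k l : ℤ) : threeTerm τ (x + k + l * τ) y z w = 0 := by
  have h1 : Function.Periodic (fun x => threeTerm τ x y z w) 1 :=
    fun x => threeTerm_add_one τ x y z w
  have hτ : Function.Periodic (fun x => threeTerm τ x y z w = 0) τ := fun x => by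
    simp [threeTerm_add_tau, quadFactor_ne_zero]
  have e1 := h1.int_mul k x
  have e2 := hτ.int_mul l (x + k)
  simp only [mul_one] at e1
  simp only [e1, h] at e2
  exact of_eq_true (by simpa using e2)

theorem countable_lattice (τ : UpperHalfPlane) :
    (Set.range fun p : ℤ × ℤ => (p.1 : ℂ) + p.2 * (τ : ℂ)).Countable := Set.countable_range _

/-- The three-term identity of Weierstrass. As a function of `x`, the left-hand side has the same
factors of quasi-periodicity as `θ(x + y) θ(x - y)`, and it vanishes at `±y` and at `z`. -/
theorem threeTerm_eq_zero (τ : UpperHalfPlane) (x y z w : ℂ) : threeTerm τ x y z w = 0 := by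
  have hθ := differentiable_theta τ
  have hθc := hθ.continuous
  -- It is enough to treat the `y` such that `2y` and `z ± y` are not in the lattice.
  set bad : Set ℂ :=
    ((fun y : ℂ => 2 * y) ⁻¹' Set.range fun p : ℤ × ℤ => (p.1 : ℂ) + p.2 * (τ : ℂ)) ∪
    (((fun y : ℂ => z + y) ⁻¹' Set.range fun p : ℤ × ℤ => (p.1 : ℂ) + p.2 * (τ : ℂ)) ∪
    ((fun y : ℂ => z - y) ⁻¹' Set.range fun p : ℤ × ℤ => (p.1 : ℂ) + p.2 * (τ : ℂ))) with hbad
  have hcount : bad.Countable := by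
    have hc := countable_lattice τ
    exact (hc.preimage (mul_right_injective₀ two_ne_zero)).union
      ((hc.preimage (add_right_injective z)).union (hc.preimage sub_right_injective))
  have hdense : Dense badᶜ := hcount.dense_compl ℝ
  have hcont : Continuous fun y => threeTerm τ x y z w := by
    unfold threeTerm
    fun_prop
  refine congrFun (hcont.ext_on hdense (continuous_const (y := (0 : ℂ))) fun y hy => ?_) y
  have hy2 : ∀ k l : ℤ, 2 * y ≠ k + l * τ := fun k l h => hy (Or.inl ⟨(k, l), h.symm⟩)
  have hzy : theta τ (z + y) ≠ 0 := fun h => by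
    obtain ⟨k, l, h⟩ := exists_of_theta_eq_zero h
    exact hy (Or.inr (Or.inl ⟨(k, l), h.symm⟩))
  have hzy' : theta τ (z - y) ≠ 0 := fun h => by
    obtain ⟨k, l, h⟩ := exists_of_theta_eq_zero h
    exact hy (Or.inr (Or.inr ⟨(k, l), h.symm⟩))
  have hd1 : Differentiable ℂ fun x => theta τ (x + y) := hθ.comp (by fun_prop)
  have hd2 : Differentiable ℂ fun x => theta τ (x - y) := hθ.comp (by fun_prop)
  refine eq_zero_of_quasiperiodic τ (G := fun x => threeTerm τ x y z w)
    (D := fun x => theta τ (x + y) * theta τ (x - y)) (e := quadFactor τ) (p := z) ?_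
    (hd1.mul hd2) ?_ ?_ (fun x => threeTerm_add_one τ x y z w) (theta_mul_add_one τ · y)
    (quadFactor_ne_zero τ) (fun x => threeTerm_add_tau τ x y z w) (theta_mul_add_tau τ · y)
    (mul_ne_zero hzy hzy') (threeTerm_of_eq_third τ z y w) x
  · unfold threeTerm
    fun_prop
  · intro x hx
    have hder := ((hd1 x).hasDerivAt.mul (hd2 x).hasDerivAt).deriv
    simp only [Pi.mul_def] at hder
    rw [hder, deriv_comp_add_const, deriv_comp_sub_const]
    have hnot : ¬(theta τ (x + y) = 0 ∧ theta τ (x - y) = 0) := by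
      rintro ⟨h1, h2⟩
      obtain ⟨k, l, h1⟩ := exists_of_theta_eq_zero h1
      obtain ⟨k', l', h2⟩ := exists_of_theta_eq_zero h2
      apply hy2 (k - k') (l - l')
      push_cast
      linear_combination h1 - h2
    rcases mul_eq_zero.mp hx with h | h
    · rw [h, zero_mul, add_zero]
      exact mul_ne_zero (deriv_theta_ne_zero h) fun h' => hnot ⟨h, h'⟩
    · rw [h, mul_zero, zero_add]
      exact mul_ne_zero (fun h' => hnot ⟨h', h⟩) (deriv_theta_ne_zero h)
  · intro x hx
    rcases mul_eq_zero.mp hx with h | h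
    · obtain ⟨k, l, h⟩ := exists_of_theta_eq_zero h
      have e : x = -y + k + l * τ := by linear_combination h
      rw [e]
      apply threeTerm_add_lattice_eq_zero
      rw [threeTerm_neg, threeTerm_of_eq]
    · obtain ⟨k, l, h⟩ := exists_of_theta_eq_zero h
      have e : x = y + k + l * τ := by linear_combination h
      rw [e]
      exact threeTerm_add_lattice_eq_zero τ (threeTerm_of_eq τ y z w) k l

/-- The three-term identity with its arguments in a form that avoids halves. -/
theorem theta_fay (τ : UpperHalfPlane) (x y a b : ℂ) :
    theta τ (x + a) * theta τ (y + b) * theta τ (a + b) * theta τ (y - x) =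
      theta τ (x + a + b) * theta τ (y - x + b) * theta τ y * theta τ a -
        theta τ (y + a + b) * theta τ (x - y + a) * theta τ x * theta τ b := by
  have h := threeTerm_eq_zero τ ((x + y + a + b) / 2) ((x + a - y - b) / 2) ((a + b + y - x) / 2)
    ((a + b + x - y) / 2)
  have hn := theta_neg τ (x - y - b)
  simp only [threeTerm] at h
  ring_nf at h hn ⊢
  linear_combination h - theta τ (x + a + b) * theta τ y * theta τ a * hn

/-! ### Quadratic forms -/

/-- The matrix of the quadratic form `a * b`, for linear forms `a`, `b`. -/
def symProd {ι : Type} (a b : ι → ℤ) : Matrix ι ι ℤ := Matrix.vecMulVec a b + Matrix.vecMulVec b a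

theorem symProd_apply {ι : Type} (a b : ι → ℤ) (v w : ι) :
    symProd a b v w = a v * b w + b v * a w := rfl

theorem symProd_add_left {ι : Type} (a a' b : ι → ℤ) :
    symProd (a + a') b = symProd a b + symProd a' b := by
  ext v w
  simp only [symProd_apply, Matrix.add_apply, Pi.add_apply]
  ring

theorem symProd_add_right {ι : Type} (a b b' : ι → ℤ) :
    symProd a (b + b') = symProd a b + symProd a b' := by
  ext v w
  simp only [symProd_apply, Matrix.add_apply, Pi.add_apply]
  ring

theorem symProd_sub_left {ι : Type} (a a' b : ι → ℤ) :
    symProd (a - a') b = symProd a b - symProd a' b := by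
  ext v w
  simp only [symProd_apply, Matrix.sub_apply, Pi.sub_apply]
  ring

theorem symProd_sub_right {ι : Type} (a b b' : ι → ℤ) :
    symProd a (b - b') = symProd a b - symProd a b' := by
  ext v w
  simp only [symProd_apply, Matrix.sub_apply, Pi.sub_apply]
  ring

theorem symProd_zero_right {ι : Type} (a : ι → ℤ) : symProd a 0 = 0 := by
  ext v w
  simp [symProd_apply]

theorem symProd_sum_right {ι : Type} {κ : Type*} (s : Finset κ) (a : ι → ℤ) (b : κ → ι → ℤ) :
    symProd a (∑ i ∈ s, b i) = ∑ i ∈ s, symProd a (b i) := by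
  classical
  induction s using Finset.induction_on with
  | empty => simp [symProd_zero_right]
  | insert i s hi ih => rw [Finset.sum_insert hi, Finset.sum_insert hi, symProd_add_right, ih]

/-! ### Pull-backs of meromorphic functions -/

section Types

variable {ι : Type} [Fintype ι]

theorem Mero.comp_algebraMap (A : (ι → ℂ) → (ι → ℂ)) (hA : AnalyticOnNhd ℂ A Set.univ)
    (hs : Function.Surjective A) (f : Entire ι) :
    Mero.comp A hA hs (algebraMap (Entire ι) (Mero ι) f) =
      algebraMap (Entire ι) (Mero ι) (Entire.comp A hA f) := by
  exact IsLocalization.map_eq (M := nonZeroDivisors (Entire ι)) (T := nonZeroDivisors (Entire ι))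
    (S := Mero ι) (Q := Mero ι)
    (nonZeroDivisors_le_comap_nonZeroDivisors_of_injective _ (Entire.comp_injective A hA hs)) f

theorem translate_algebraMap {a : ι → ℂ} {f g : Entire ι} (h : ∀ z, f.1 (z + a) = g.1 z) :
    Mero.translate a (algebraMap (Entire ι) (Mero ι) f) = algebraMap (Entire ι) (Mero ι) g :=
  (Mero.comp_algebraMap _ _ _ f).trans (congrArg _ (Subtype.ext (funext h)))

theorem rename_algebraMap {π : Equiv.Perm ι} {f g : Entire ι}
    (h : ∀ z, f.1 (fun v => z (π v)) = g.1 z) :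
    Mero.rename π (algebraMap (Entire ι) (Mero ι) f) = algebraMap (Entire ι) (Mero ι) g :=
  (Mero.comp_algebraMap _ _ _ f).trans (congrArg _ (Subtype.ext (funext h)))

theorem Mero.comp_comp {A B C : (ι → ℂ) → (ι → ℂ)} {hA : AnalyticOnNhd ℂ A Set.univ}
    {hsA : Function.Surjective A} {hB : AnalyticOnNhd ℂ B Set.univ}
    {hsB : Function.Surjective B} {hC : AnalyticOnNhd ℂ C Set.univ}
    {hsC : Function.Surjective C} (h : ∀ z, B (A z) = C z) (f : Mero ι) :
    Mero.comp A hA hsA (Mero.comp B hB hsB f) = Mero.comp C hC hsC f := by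
  suffices e : (Mero.comp A hA hsA).comp (Mero.comp B hB hsB) = Mero.comp C hC hsC from
    congrFun (congrArg DFunLike.coe e) f
  apply IsLocalization.ringHom_ext (nonZeroDivisors (Entire ι))
  ext f
  simp only [RingHom.comp_apply, Mero.comp_algebraMap]
  congr 1
  apply Subtype.ext
  funext z
  exact congrArg f.1 (h z)

theorem Mero.comp_const (A : (ι → ℂ) → (ι → ℂ)) (hA : AnalyticOnNhd ℂ A Set.univ)
    (hs : Function.Surjective A) (c : ℂ) :
    Mero.comp A hA hs (algebraMap ℂ (Mero ι) c) = algebraMap ℂ (Mero ι) c := by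
  rw [IsScalarTower.algebraMap_apply ℂ (Entire ι) (Mero ι), Mero.comp_algebraMap]
  rfl

theorem algebraMap_entire_injective : Function.Injective (algebraMap (Entire ι) (Mero ι)) :=
  IsFractionRing.injective _ _

theorem algebraMap_entire_ne_zero {f : Entire ι} (h : f ≠ 0) :
    algebraMap (Entire ι) (Mero ι) f ≠ 0 := fun h0 =>
  h (algebraMap_entire_injective (h0.trans (RingHom.map_zero _).symm))

theorem linForm_add (c d : ι → ℤ) (z : ι → ℂ) :
    linForm (c + d) z = linForm c z + linForm d z := by
  simp [linForm, add_mul, Finset.sum_add_distrib]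

theorem linForm_neg (c : ι → ℤ) (z : ι → ℂ) : linForm (-c) z = -linForm c z := by
  simp [linForm]

theorem linForm_add_right (c : ι → ℤ) (z y : ι → ℂ) :
    linForm c (z + y) = linForm c z + linForm c y := by
  simp [linForm, mul_add, Finset.sum_add_distrib]

theorem linForm_comp_perm (c : ι → ℤ) (π : Equiv.Perm ι) (z : ι → ℂ) :
    linForm c (fun v => z (π v)) = linForm (fun v => c (π.symm v)) z := by
  unfold linForm
  exact Fintype.sum_equiv π _ _ fun v => by simp

theorem rename_rename (π ρ : Equiv.Perm ι) (f : Mero ι) :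
    Mero.rename π (Mero.rename ρ f) = Mero.rename (π * ρ) f :=
  Mero.comp_comp (fun _ => rfl) f

theorem rename_ofLinForm (π : Equiv.Perm ι) {g : ℂ → ℂ} (hg : Differentiable ℂ g) (c : ι → ℤ) :
    Mero.rename π (ofLinForm g hg c) = ofLinForm g hg (fun v => c (π.symm v)) := by
  exact rename_algebraMap fun z => congrArg g (linForm_comp_perm c π z)

theorem translate_rename (a : ι → ℂ) (π : Equiv.Perm ι) (f : Mero ι) :
    Mero.translate a (Mero.rename π f) = Mero.rename π (Mero.translate (fun v => a (π v)) f) := by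
  have hC : AnalyticOnNhd ℂ (fun (z : ι → ℂ) v => (z + a) (π v)) Set.univ :=
    fun _ _ => analyticAt_pi_iff.mpr fun v =>
      ((ContinuousLinearMap.proj (R := ℂ) (φ := fun _ : ι => ℂ) (π v)).analyticAt _).add
        analyticAt_const
  have hs : Function.Surjective (fun (z : ι → ℂ) v => (z + a) (π v)) := fun z =>
    ⟨(fun v => z (π.symm v)) - a, by funext v; simp⟩
  exact (Mero.comp_comp (hC := hC) (hsC := hs) (fun _ => rfl) f).trans
    (Mero.comp_comp (hC := hC) (hsC := hs) (fun _ => rfl) f).symm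

/-! ### Types of meromorphic sections -/

/-- The automorphy factor as an entire function. -/
def automorphyFun (τ : UpperHalfPlane) (M : Matrix ι ι ℤ) (k l : ι → ℤ) (z : ι → ℂ) : ℂ :=
  ((-1) ^ pairing M k k * (-exp (-(Real.pi * I * τ))) ^ pairing M l l) *
    exp (-(2 * Real.pi * I * linForm (fun w => ∑ v, M v w * l v) z))

theorem analyticOnNhd_automorphyFun (τ : UpperHalfPlane) (M : Matrix ι ι ℤ) (k l : ι → ℤ) :
    AnalyticOnNhd ℂ (automorphyFun τ M k l) Set.univ := fun z _ => by
  refine analyticAt_const.mul ?_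
  have hd : Differentiable ℂ fun s : ℂ => exp (-(2 * Real.pi * I * s)) := by fun_prop
  exact (hd.analyticAt _).fun_comp (analyticAt_linForm _ z)

theorem automorphy_eq (τ : UpperHalfPlane) (M : Matrix ι ι ℤ) (k l : ι → ℤ) :
    automorphy τ M k l = algebraMap (Entire ι) (Mero ι)
      ⟨automorphyFun τ M k l, analyticOnNhd_automorphyFun τ M k l⟩ := by
  rw [automorphy, ofLinForm, IsScalarTower.algebraMap_apply ℂ (Entire ι) (Mero ι), ← map_mul]
  rfl

theorem automorphyFun_ne_zero (τ : UpperHalfPlane) (M : Matrix ι ι ℤ) (k l : ι → ℤ) (z : ι → ℂ) :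
    automorphyFun τ M k l z ≠ 0 :=
  mul_ne_zero (mul_ne_zero (zpow_ne_zero _ (by norm_num))
    (zpow_ne_zero _ (neg_ne_zero.mpr (exp_ne_zero _)))) (exp_ne_zero _)

theorem automorphy_ne_zero (τ : UpperHalfPlane) (M : Matrix ι ι ℤ) (k l : ι → ℤ) :
    automorphy τ M k l ≠ 0 := by
  rw [automorphy_eq]
  refine algebraMap_entire_ne_zero fun h => ?_
  exact automorphyFun_ne_zero τ M k l 0 (congrFun (congrArg Subtype.val h) 0)

theorem pairing_add (M N : Matrix ι ι ℤ) (k l : ι → ℤ) :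
    pairing (M + N) k l = pairing M k l + pairing N k l := by
  simp [pairing, add_mul, Finset.sum_add_distrib]

theorem automorphy_add (τ : UpperHalfPlane) (M N : Matrix ι ι ℤ) (k l : ι → ℤ) :
    automorphy τ (M + N) k l = automorphy τ M k l * automorphy τ N k l := by
  rw [automorphy_eq, automorphy_eq, automorphy_eq, ← map_mul]
  congr 1
  apply Subtype.ext
  funext z
  change automorphyFun τ (M + N) k l z = automorphyFun τ M k l z * automorphyFun τ N k l z
  have h : (fun w => ∑ v, (M + N) v w * l v) =
      (fun w => ∑ v, M v w * l v) + fun w => ∑ v, N v w * l v := by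
    funext w
    simp [add_mul, Finset.sum_add_distrib]
  simp only [automorphyFun, pairing_add, h, linForm_add]
  rw [zpow_add₀ (by norm_num), zpow_add₀ (neg_ne_zero.mpr (exp_ne_zero _)), mul_add, neg_add,
    exp_add]
  ring

theorem automorphy_zero (τ : UpperHalfPlane) (k l : ι → ℤ) :
    automorphy τ (0 : Matrix ι ι ℤ) k l = 1 := by
  have h := automorphy_add τ (0 : Matrix ι ι ℤ) 0 k l
  rw [add_zero] at h
  exact (mul_eq_left₀ (automorphy_ne_zero τ 0 k l)).mp h.symm

theorem automorphy_neg (τ : UpperHalfPlane) (M : Matrix ι ι ℤ) (k l : ι → ℤ) :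
    automorphy τ (-M) k l = (automorphy τ M k l)⁻¹ := by
  apply eq_inv_of_mul_eq_one_left
  rw [← automorphy_add, neg_add_cancel, automorphy_zero]

variable {τ : UpperHalfPlane} {f g : Mero ι} {M N : Matrix ι ι ℤ}

theorem HasType.mul (hf : HasType τ f M) (hg : HasType τ g N) : HasType τ (f * g) (M + N) := by
  refine ⟨hf.1.add hg.1, fun k l => ?_⟩
  rw [map_mul, hf.2, hg.2, automorphy_add]
  ring

theorem HasType.inv (hf : HasType τ f M) : HasType τ f⁻¹ (-M) := by
  refine ⟨hf.1.neg, fun k l => ?_⟩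
  rw [map_inv₀, hf.2, automorphy_neg, mul_inv]

theorem HasType.add (hf : HasType τ f M) (hg : HasType τ g M) : HasType τ (f + g) M := by
  refine ⟨hf.1, fun k l => ?_⟩
  rw [RingHom.map_add, hf.2, hg.2, mul_add]

theorem HasType.neg (hf : HasType τ f M) : HasType τ (-f) M := by
  refine ⟨hf.1, fun k l => ?_⟩
  rw [RingHom.map_neg, hf.2, mul_neg]

theorem hasType_const (c : ℂ) : HasType τ (algebraMap ℂ (Mero ι) c) 0 := by
  refine ⟨Matrix.isSymm_zero, fun k l => ?_⟩
  rw [automorphy_zero, one_mul]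
  exact Mero.comp_const _ _ _ c

theorem HasType.prod {κ : Type*} {s : Finset κ} {F : κ → Mero ι} {Q : κ → Matrix ι ι ℤ}
    (h : ∀ i ∈ s, HasType τ (F i) (Q i)) : HasType τ (∏ i ∈ s, F i) (∑ i ∈ s, Q i) := by
  classical
  induction s using Finset.induction_on with
  | empty => simpa using hasType_const (ι := ι) (τ := τ) 1
  | insert a s ha ih =>
    rw [Finset.prod_insert ha, Finset.sum_insert ha]
    exact (h a (Finset.mem_insert_self a s)).mul
      (ih fun i hi => h i (Finset.mem_insert_of_mem hi))

theorem hasType_thetaAt (τ : UpperHalfPlane) (c : ι → ℤ) :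
    HasType τ (thetaAt τ c) (Matrix.vecMulVec c c) := by
  refine ⟨Matrix.ext fun v w => mul_comm _ _, fun k l => ?_⟩
  rw [automorphy_eq, thetaAt, ofLinForm, ← map_mul]
  refine translate_algebraMap fun z => ?_
  change theta τ (linForm c (z + fun v => (k v : ℂ) + (l v : ℂ) * (τ : ℂ))) =
    automorphyFun τ (Matrix.vecMulVec c c) k l z * theta τ (linForm c z)
  have hp : ∀ k : ι → ℤ,
      pairing (Matrix.vecMulVec c c) k k = (∑ v, c v * k v) * ∑ v, c v * k v := by
    intro k
    rw [Finset.sum_mul_sum]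
    simp only [pairing, Matrix.vecMulVec_apply]
    exact Finset.sum_congr rfl fun v _ => Finset.sum_congr rfl fun w _ => by ring
  have hl : linForm (fun w => ∑ v, Matrix.vecMulVec c c v w * l v) z =
      ((∑ v, c v * l v : ℤ) : ℂ) * linForm c z := by
    simp only [linForm, Matrix.vecMulVec_apply]
    rw [Finset.mul_sum]
    refine Finset.sum_congr rfl fun w _ => ?_
    push_cast
    rw [Finset.sum_mul, Finset.sum_mul]
    exact Finset.sum_congr rfl fun v _ => by ring
  have ha : linForm c (fun v => (k v : ℂ) + (l v : ℂ) * (τ : ℂ)) =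
      ((∑ v, c v * k v : ℤ) : ℂ) + ((∑ v, c v * l v : ℤ) : ℂ) * τ := by
    simp only [linForm]
    push_cast
    rw [Finset.sum_mul, ← Finset.sum_add_distrib]
    exact Finset.sum_congr rfl fun v _ => by ring
  rw [linForm_add_right, ha, theta_add_lattice, automorphyFun, hp, hp, hl]

theorem hasType_delta (τ : UpperHalfPlane) (a b : ι → ℤ) :
    HasType τ (delta τ a b) (symProd a b) := by
  have h := ((hasType_const (ι := ι) (τ := τ) (deriv (theta τ) 0)).mul
    (hasType_thetaAt τ (a + b))).mul
    ((hasType_thetaAt τ a).mul (hasType_thetaAt τ b)).inv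
  rw [← div_eq_mul_inv] at h
  have e : (0 : Matrix ι ι ℤ) + Matrix.vecMulVec (a + b) (a + b) +
      -(Matrix.vecMulVec a a + Matrix.vecMulVec b b) = symProd a b := by
    ext v w
    simp only [symProd_apply, Matrix.add_apply, Matrix.neg_apply, Matrix.zero_apply,
      Matrix.vecMulVec_apply, Pi.add_apply]
    ring
  rwa [e] at h

theorem HasType.rename (π : Equiv.Perm ι) (hf : HasType τ f M) :
    HasType τ (Mero.rename π f) (M.submatrix π.symm π.symm) := by
  refine ⟨hf.1.submatrix _, fun k l => ?_⟩
  have h := hf.2 (fun v => k (π v)) (fun v => l (π v))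
  rw [translate_rename, h, map_mul]
  congr 1
  have hp : ∀ k : ι → ℤ, pairing M (fun v => k (π v)) (fun v => k (π v)) =
      pairing (M.submatrix π.symm π.symm) k k := by
    intro k
    unfold pairing
    refine Fintype.sum_equiv π _ _ fun v => Fintype.sum_equiv π _ _ fun w => ?_
    simp
  rw [automorphy, automorphy, map_mul, rename_ofLinForm, hp, hp]
  congr 1
  · exact Mero.comp_const _ _ _ _
  · congr 1
    funext w
    exact Fintype.sum_equiv π _ _ fun v => by simp

theorem thetaAt_ne_zero (τ : UpperHalfPlane) {c : ι → ℤ} (hc : c ≠ 0) : thetaAt τ c ≠ 0 := by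
  classical
  refine algebraMap_entire_ne_zero fun h => ?_
  obtain ⟨v, hv⟩ : ∃ v, c v ≠ 0 := Function.ne_iff.mp hc
  have h0 : theta τ = fun _ => 0 := by
    funext x
    have := congrFun (congrArg Subtype.val h) (Pi.single v (x / c v))
    have e : linForm c (Pi.single v (x / c v)) = x := by
      have hv' : (c v : ℂ) ≠ 0 := by exact_mod_cast hv
      simp only [linForm]
      rw [Finset.sum_eq_single v (fun w _ hw => by simp [Pi.single_eq_of_ne hw])
        (fun h => absurd (Finset.mem_univ v) h), Pi.single_eq_same, mul_div_cancel₀ _ hv']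
    change theta τ (linForm c (Pi.single v (x / c v))) = 0 at this
    rwa [e] at this
  exact deriv_theta_zero_ne_zero τ (by rw [h0, deriv_const])

theorem delta_ne_zero (τ : UpperHalfPlane) {a b : ι → ℤ} (ha : a ≠ 0) (hb : b ≠ 0)
    (hab : a + b ≠ 0) : delta τ a b ≠ 0 := by
  refine div_ne_zero (mul_ne_zero ?_ (thetaAt_ne_zero τ hab))
    (mul_ne_zero (thetaAt_ne_zero τ ha) (thetaAt_ne_zero τ hb))
  exact (map_ne_zero _).mpr (deriv_theta_zero_ne_zero τ)

end Types

/-! ### Sums of sections of different line bundles -/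

/-- A finite family of nonzero homomorphisms into a torsion-free group has a common point where none
of them vanishes. -/
theorem exists_forall_ne_zero {A B : Type*} [AddCommGroup A] [AddCommGroup B] [IsAddTorsionFree B]
    (S : Finset (A →+ B)) (h : ∀ f ∈ S, f ≠ 0) : ∃ a, ∀ f ∈ S, f a ≠ 0 := by
  classical
  induction S using Finset.induction_on with
  | empty => exact ⟨0, by simp⟩
  | insert f S hf ih =>
    obtain ⟨a, ha⟩ := ih fun g hg => h g (Finset.mem_insert_of_mem hg)
    obtain ⟨b, hb⟩ : ∃ b, f b ≠ 0 := by
      by_contra! h0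
      exact h f (Finset.mem_insert_self f S) (AddMonoidHom.ext h0)
    -- Each of the homomorphisms vanishes at `a + n b` for at most one `n`.
    have hsub : ∀ g ∈ insert f S, {n : ℕ | g (a + n • b) = 0}.Subsingleton := by
      intro g hg n hn n' hn'
      simp only [Set.mem_ofPred_eq, map_add, map_nsmul] at hn hn'
      have hgb : g b ≠ 0 := by
        rcases Finset.mem_insert.mp hg with rfl | hg
        · exact hb
        · intro h0
          rw [h0, smul_zero, add_zero] at hn
          exact ha g hg hn
      have : n • g b = n' • g b := add_left_cancel (hn.trans hn'.symm)
      have hz : ((n : ℤ) - n') • g b = 0 := by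
        rw [sub_smul, natCast_zsmul, natCast_zsmul, this, sub_self]
      rcases (IsAddTorsionFree.zsmul_eq_zero_iff).mp hz with h | h
      · exact absurd h hgb
      · omega
    have hfin : (⋃ g ∈ insert f S, {n : ℕ | g (a + n • b) = 0}).Finite :=
      Set.Finite.biUnion (Finset.finite_toSet _) fun g hg => (hsub g hg).finite
    obtain ⟨n, hn⟩ := hfin.exists_notMem
    refine ⟨a + n • b, fun g hg h0 => hn ?_⟩
    simp only [Set.mem_iUnion]
    exact ⟨g, hg, h0⟩

section Types

variable {ι : Type} [Fintype ι]

/-- The bilinear form of a matrix, as a homomorphism. -/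
def bilin (M : Matrix ι ι ℤ) : (ι → ℤ) →+ (ι → ℤ) →+ ℤ where
  toFun l :=
    { toFun := fun s => ∑ w, (∑ v, M v w * l v) * s w
      map_zero' := by simp
      map_add' := fun s t => by simp [mul_add, Finset.sum_add_distrib] }
  map_zero' := by
    ext s
    simp
  map_add' l l' := by
    ext s
    simp [mul_add, add_mul, Finset.sum_add_distrib]

theorem bilin_apply (M : Matrix ι ι ℤ) (l s : ι → ℤ) :
    bilin M l s = ∑ w, (∑ v, M v w * l v) * s w := rfl

theorem bilin_sub (M N : Matrix ι ι ℤ) (l s : ι → ℤ) :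
    bilin (M - N) l s = bilin M l s - bilin N l s := by
  simp [bilin_apply, sub_mul, Finset.sum_sub_distrib]

theorem bilin_ne_zero {M : Matrix ι ι ℤ} (h : M ≠ 0) : bilin M ≠ 0 := by
  classical
  intro h0
  apply h
  ext v w
  have h1 := DFunLike.congr_fun (DFunLike.congr_fun h0 (Pi.single v 1)) (Pi.single w 1)
  rw [bilin_apply, Finset.sum_eq_single w (fun b _ hb => by simp [Pi.single_eq_of_ne hb])
    (fun h => absurd (Finset.mem_univ w) h), Finset.sum_eq_single v
    (fun b _ hb => by simp [Pi.single_eq_of_ne hb]) (fun h => absurd (Finset.mem_univ v) h)] at h1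
  simpa using h1

theorem exists_bilin_ne_zero (S : Finset (Matrix ι ι ℤ)) (h : ∀ M ∈ S, M ≠ 0) :
    ∃ l s : ι → ℤ, ∀ M ∈ S, bilin M l s ≠ 0 := by
  classical
  have : IsAddTorsionFree ((ι → ℤ) →+ ℤ) := ⟨fun _ hn _ _ h =>
    AddMonoidHom.ext fun s => IsAddTorsionFree.nsmul_right_injective hn (DFunLike.congr_fun h s)⟩
  obtain ⟨l, hl⟩ := exists_forall_ne_zero (S.image bilin) (by
    simpa using fun M hM => bilin_ne_zero (h M hM))
  obtain ⟨s, hs⟩ := exists_forall_ne_zero (S.image fun M => bilin M l) (by simpa using hl)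
  exact ⟨l, s, by simpa using hs⟩

variable {τ : UpperHalfPlane} {f g : Mero ι} {M N : Matrix ι ι ℤ}

/-- The factor by which translation by `l τ` multiplies the automorphy factor at `l`. -/
def automorphyConst (τ : UpperHalfPlane) (M : Matrix ι ι ℤ) (l : ι → ℤ) : ℂ :=
  exp (-(2 * Real.pi * I * linForm (fun w => ∑ v, M v w * l v) fun v => (l v : ℂ) * (τ : ℂ)))

theorem translate_automorphy (τ : UpperHalfPlane) (M : Matrix ι ι ℤ) (l : ι → ℤ) :
    Mero.translate (fun v => (((0 : ι → ℤ) v : ℤ) : ℂ) + (l v : ℂ) * (τ : ℂ))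
      (automorphy τ M 0 l) =
      algebraMap ℂ (Mero ι) (automorphyConst τ M l) * automorphy τ M 0 l := by
  rw [automorphy_eq, IsScalarTower.algebraMap_apply ℂ (Entire ι) (Mero ι), ← map_mul]
  refine translate_algebraMap fun z => ?_
  change automorphyFun τ M 0 l _ = automorphyConst τ M l * automorphyFun τ M 0 l z
  simp only [automorphyFun, automorphyConst, linForm_add_right, Pi.zero_apply, Int.cast_zero,
    zero_add]
  rw [mul_add, neg_add, exp_add]
  ring

/-- On the imaginary line spanned by `s`, the automorphy factor is a multiple of a real
exponential. -/
theorem automorphyFun_line (τ : UpperHalfPlane) (M : Matrix ι ι ℤ) (l s : ι → ℤ) (y : ℝ) :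
    automorphyFun τ M 0 l (fun v => I * y * s v) =
      automorphyFun τ M 0 l 0 * (Real.exp (2 * Real.pi * y * bilin M l s) : ℂ) := by
  have h : -(2 * Real.pi * I * linForm (fun w => ∑ v, M v w * l v) fun v => I * (y : ℂ) * s v) =
      ((2 * Real.pi * y * bilin M l s : ℝ) : ℂ) := by
    simp only [linForm, bilin_apply]
    push_cast
    rw [Finset.mul_sum, Finset.mul_sum, ← Finset.sum_neg_distrib]
    refine Finset.sum_congr rfl fun w _ => ?_
    linear_combination (-2 * (Real.pi : ℂ) * y * s w * ∑ x, (M x w : ℂ) * l x) * I_mul_I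
  have h0 : linForm (fun w => ∑ v, M v w * l v) (0 : ι → ℂ) = 0 := by simp [linForm]
  rw [automorphyFun, h, automorphyFun, h0, mul_zero, neg_zero, exp_zero, mul_one, ofReal_exp]

/-- A nonzero function has only one type. -/
theorem HasType.unique (hf : HasType τ f M) (hf' : HasType τ f N) (h0 : f ≠ 0) : M = N := by
  by_contra hne
  obtain ⟨l, s, hls⟩ := exists_bilin_ne_zero {M - N} (by simpa using sub_ne_zero.mpr hne)
  have hd := hls (M - N) (Finset.mem_singleton_self _)
  rw [bilin_sub, sub_ne_zero] at hd
  have h := mul_right_cancel₀ h0 ((hf.2 0 l).symm.trans (hf'.2 0 l))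
  rw [automorphy_eq, automorphy_eq] at h
  have h' : ∀ z, automorphyFun τ M 0 l z = automorphyFun τ N 0 l z :=
    congrFun (congrArg Subtype.val (algebraMap_entire_injective h))
  have h1 := h' (fun v => I * (1 : ℝ) * s v)
  rw [automorphyFun_line, automorphyFun_line, h' 0] at h1
  have h2 := mul_left_cancel₀ (automorphyFun_ne_zero τ N 0 l 0) h1
  rw [ofReal_inj, Real.exp_eq_exp] at h2
  have h3 : (bilin M l s : ℝ) = bilin N l s :=
    mul_left_cancel₀ (by positivity : 2 * Real.pi * 1 ≠ 0) h2
  exact hd (by exact_mod_cast h3)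

end Types

/-- The generalized Vandermonde determinant of three exponential functions with different rates
does not vanish identically: the first term of the expansion dominates. -/
theorem exists_vandermonde_exp_ne_zero_of_lt {p₁ p₂ p₃ : ℝ} (h12 : p₂ < p₁) (h23 : p₃ < p₂)
    {c₁ c₂ c₃ α₁ α₂ α₃ : ℂ} (hc₁ : c₁ ≠ 0) (hc₂ : c₂ ≠ 0) (hα₁ : α₁ ≠ 0) {e₁ e₂ e₃ : ℝ → ℂ}
    (h₁ : ∀ y, e₁ y = c₁ * (Real.exp (y * p₁) : ℂ)) (h₂ : ∀ y, e₂ y = c₂ * (Real.exp (y * p₂) : ℂ))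
    (h₃ : ∀ y, e₃ y = c₃ * (Real.exp (y * p₃) : ℂ)) :
    ∃ y, α₁ * e₁ y ^ 2 * (e₂ y - e₃ y) + α₂ * e₂ y ^ 2 * (e₃ y - e₁ y) +
      α₃ * e₃ y ^ 2 * (e₁ y - e₂ y) ≠ 0 := by
  by_contra! h
  set u : ℝ → ℂ := fun y => (Real.exp (y * (p₂ - p₁)) : ℂ) with hu
  set v : ℝ → ℂ := fun y => (Real.exp (y * (p₃ - p₂)) : ℂ) with hv
  have lim : ∀ d : ℝ, d < 0 → Tendsto (fun y : ℝ => (Real.exp (y * d) : ℂ)) atTop (𝓝 0) := by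
    intro d hd
    have h1 : Tendsto (fun y : ℝ => Real.exp (y * d)) atTop (𝓝 0) :=
      Real.tendsto_exp_atBot.comp (tendsto_id.atTop_mul_const_of_neg hd)
    have h2 := (continuous_ofReal.tendsto 0).comp h1
    rw [ofReal_zero] at h2
    exact h2
  have hu0 : Tendsto u atTop (𝓝 0) := lim (p₂ - p₁) (by linarith)
  have hv0 : Tendsto v atTop (𝓝 0) := lim (p₃ - p₂) (by linarith)
  set β := c₂ / c₁
  set γ := c₃ / c₂
  have hβ : β ≠ 0 := div_ne_zero hc₂ hc₁
  have e21 : ∀ y, e₂ y = β * u y * e₁ y := by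
    intro y
    have : (Real.exp (y * p₂) : ℂ) = u y * (Real.exp (y * p₁) : ℂ) := by
      rw [hu, ← ofReal_mul, ← Real.exp_add]
      ring_nf
    rw [h₂, h₁, this]
    simp only [β]
    field_simp
  have e32 : ∀ y, e₃ y = γ * v y * e₂ y := by
    intro y
    have : (Real.exp (y * p₃) : ℂ) = v y * (Real.exp (y * p₂) : ℂ) := by
      rw [hv, ← ofReal_mul, ← Real.exp_add]
      ring_nf
    rw [h₃, h₂, this]
    simp only [γ]
    field_simp
  have hu1 : ∀ y, u y ≠ 0 := fun y => ofReal_ne_zero.mpr (Real.exp_ne_zero _)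
  clear_value β γ u v
  have key : ∀ y, α₁ * β * (1 - γ * v y) + α₂ * β ^ 2 * u y * (β * γ * u y * v y - 1) +
      α₃ * β ^ 2 * γ ^ 2 * u y * v y ^ 2 * (1 - β * u y) = 0 := by
    intro y
    have hy := h y
    rw [e32, e21] at hy
    have h1 : e₁ y ≠ 0 := by
      rw [h₁]
      exact mul_ne_zero hc₁ (ofReal_ne_zero.mpr (Real.exp_ne_zero _))
    have h2 := hu1 y
    apply mul_left_cancel₀ (mul_ne_zero h2 (pow_ne_zero 3 h1))
    rw [mul_zero, ← hy]
    ring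
  have hcont : Continuous fun q : ℂ × ℂ => α₁ * β * (1 - γ * q.2) +
      α₂ * β ^ 2 * q.1 * (β * γ * q.1 * q.2 - 1) +
      α₃ * β ^ 2 * γ ^ 2 * q.1 * q.2 ^ 2 * (1 - β * q.1) := by fun_prop
  have hlim := ((hcont.tendsto (0, 0)).comp (hu0.prodMk_nhds hv0)).congr key
  have := tendsto_nhds_unique hlim tendsto_const_nhds
  simp [hα₁, hβ] at this

theorem exists_vandermonde_exp_ne_zero {p₁ p₂ p₃ : ℝ} (h12 : p₁ ≠ p₂) (h23 : p₂ ≠ p₃)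
    (h13 : p₁ ≠ p₃) {c₁ c₂ c₃ α₁ α₂ α₃ : ℂ} (hc₁ : c₁ ≠ 0) (hc₂ : c₂ ≠ 0) (hc₃ : c₃ ≠ 0)
    (hα₁ : α₁ ≠ 0) (hα₂ : α₂ ≠ 0) (hα₃ : α₃ ≠ 0) {e₁ e₂ e₃ : ℝ → ℂ}
    (h₁ : ∀ y, e₁ y = c₁ * (Real.exp (y * p₁) : ℂ)) (h₂ : ∀ y, e₂ y = c₂ * (Real.exp (y * p₂) : ℂ))
    (h₃ : ∀ y, e₃ y = c₃ * (Real.exp (y * p₃) : ℂ)) :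
    ∃ y, α₁ * e₁ y ^ 2 * (e₂ y - e₃ y) + α₂ * e₂ y ^ 2 * (e₃ y - e₁ y) +
      α₃ * e₃ y ^ 2 * (e₁ y - e₂ y) ≠ 0 := by
  rcases h12.lt_or_gt with h | h <;> rcases h23.lt_or_gt with h' | h'
  · obtain ⟨y, hy⟩ := exists_vandermonde_exp_ne_zero_of_lt (α₂ := α₂) (α₃ := α₁) h' h hc₃ hc₂ hα₃
      h₃ h₂ h₁
    exact ⟨y, fun h0 => hy (by linear_combination -h0)⟩
  · rcases h13.lt_or_gt with h'' | h''
    · obtain ⟨y, hy⟩ := exists_vandermonde_exp_ne_zero_of_lt (α₂ := α₃) (α₃ := α₁) h' h'' hc₂ hc₃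
        hα₂ h₂ h₃ h₁
      exact ⟨y, fun h0 => hy (by linear_combination h0)⟩
    · obtain ⟨y, hy⟩ := exists_vandermonde_exp_ne_zero_of_lt (α₂ := α₁) (α₃ := α₃) h h'' hc₂ hc₁
        hα₂ h₂ h₁ h₃
      exact ⟨y, fun h0 => hy (by linear_combination -h0)⟩
  · rcases h13.lt_or_gt with h'' | h''
    · obtain ⟨y, hy⟩ := exists_vandermonde_exp_ne_zero_of_lt (α₂ := α₁) (α₃ := α₂) h'' h hc₃ hc₁
        hα₃ h₃ h₁ h₂
      exact ⟨y, fun h0 => hy (by linear_combination h0)⟩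
    · obtain ⟨y, hy⟩ := exists_vandermonde_exp_ne_zero_of_lt (α₂ := α₃) (α₃ := α₂) h'' h' hc₁ hc₃
        hα₁ h₁ h₃ h₂
      exact ⟨y, fun h0 => hy (by linear_combination -h0)⟩
  · obtain ⟨y, hy⟩ := exists_vandermonde_exp_ne_zero_of_lt (α₂ := α₂) (α₃ := α₃) h h' hc₁ hc₂ hα₁
      h₁ h₂ h₃
    exact ⟨y, hy⟩

/-- The relation between `A`, `B`, `C` and its translates under an automorphism that multiplies `A`,
`B`, `C` by `e₁`, `e₂`, `e₃` and these factors by `α₁`, `α₂`, `α₃`. -/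
theorem det_eq_zero_of_three {K : Type*} [Field K] {A B C e₁ e₂ e₃ α₁ α₂ α₃ : K} (hA : A ≠ 0)
    (h0 : A + B + C = 0) (h1 : e₁ * A + e₂ * B + e₃ * C = 0)
    (h2 : α₁ * e₁ * (e₁ * A) + α₂ * e₂ * (e₂ * B) + α₃ * e₃ * (e₃ * C) = 0) :
    α₁ * e₁ ^ 2 * (e₂ - e₃) + α₂ * e₂ ^ 2 * (e₃ - e₁) + α₃ * e₃ ^ 2 * (e₁ - e₂) = 0 := by
  apply mul_left_cancel₀ hA
  linear_combination (e₂ - e₃) * h2 + (α₃ * e₃ ^ 2 - α₂ * e₂ ^ 2) * h1 +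
    (α₂ * e₂ ^ 2 * e₃ - α₃ * e₃ ^ 2 * e₂) * h0

section Types

variable {ι : Type} [Fintype ι] {τ : UpperHalfPlane}

/-- Three sections of pairwise different line bundles have sum zero only if they are zero: two
translations of the relation give a linear system with a nonzero determinant. -/
theorem HasType.three_add_ne_zero {A B C : Mero ι} {M₁ M₂ M₃ : Matrix ι ι ℤ} (hA : HasType τ A M₁)
    (hB : HasType τ B M₂) (hC : HasType τ C M₃) (h12 : M₁ ≠ M₂) (h23 : M₂ ≠ M₃) (h13 : M₁ ≠ M₃)
    (hA0 : A ≠ 0) : A + B + C ≠ 0 := by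
  classical
  intro h0
  obtain ⟨l, s, hls⟩ := exists_bilin_ne_zero {M₁ - M₂, M₂ - M₃, M₁ - M₃} (by
    simp [sub_eq_zero, h12, h23, h13])
  simp only [Finset.mem_insert, Finset.mem_singleton, forall_eq_or_imp, forall_eq, bilin_sub,
    sub_ne_zero] at hls
  obtain ⟨d12, d23, d13⟩ := hls
  set T := Mero.translate (fun v => (((0 : ι → ℤ) v : ℤ) : ℂ) + (l v : ℂ) * (τ : ℂ)) with hT
  have h1 := congrArg T h0
  rw [RingHom.map_add, RingHom.map_add, RingHom.map_zero, hA.2, hB.2, hC.2] at h1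
  have h2 := congrArg T h1
  rw [RingHom.map_add, RingHom.map_add, RingHom.map_zero, RingHom.map_mul, RingHom.map_mul,
    RingHom.map_mul, hA.2, hB.2, hC.2, hT, translate_automorphy, translate_automorphy,
    translate_automorphy] at h2
  have hdet := det_eq_zero_of_three hA0 h0 h1 h2
  simp only [automorphy_eq, IsScalarTower.algebraMap_apply ℂ (Entire ι) (Mero ι)] at hdet
  simp only [← RingHom.map_mul, ← RingHom.map_pow, ← RingHom.map_sub, ← RingHom.map_add] at hdet
  have hz := congrArg Subtype.val
    (algebraMap_entire_injective (hdet.trans (RingHom.map_zero _).symm))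
  have hp : ∀ p q : ℤ, p ≠ q → 2 * Real.pi * (p : ℝ) ≠ 2 * Real.pi * q := fun p q hpq h =>
    hpq (by exact_mod_cast mul_left_cancel₀ (by positivity : 2 * Real.pi ≠ 0) h)
  have hline : ∀ (M : Matrix ι ι ℤ) (y : ℝ), automorphyFun τ M 0 l (fun v => I * y * s v) =
      automorphyFun τ M 0 l 0 * (Real.exp (y * (2 * Real.pi * bilin M l s)) : ℂ) := by
    intro M y
    rw [automorphyFun_line]
    ring_nf
  obtain ⟨y, hy⟩ := exists_vandermonde_exp_ne_zero (hp _ _ d12) (hp _ _ d23) (hp _ _ d13)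
    (automorphyFun_ne_zero τ M₁ 0 l 0) (automorphyFun_ne_zero τ M₂ 0 l 0)
    (automorphyFun_ne_zero τ M₃ 0 l 0) (exp_ne_zero _ : automorphyConst τ M₁ l ≠ 0)
    (exp_ne_zero _ : automorphyConst τ M₂ l ≠ 0) (exp_ne_zero _ : automorphyConst τ M₃ l ≠ 0)
    (hline M₁) (hline M₂) (hline M₃)
  exact hy (congrFun hz _)

/-- If the sum of two nonzero pure functions is pure, then they have the same type. -/
theorem HasType.eq_of_isPure_add {A B : Mero ι} {M N : Matrix ι ι ℤ} (hA : HasType τ A M)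
    (hB : HasType τ B N) (hA0 : A ≠ 0) (hB0 : B ≠ 0) (h : IsPure τ (A + B)) : M = N := by
  obtain ⟨Q, hQ⟩ := h
  by_contra hne
  have eB : B = (A + B) + -A := by ring
  have eA : A = (A + B) + -B := by ring
  by_cases h1 : M = Q
  · subst h1
    have := hQ.add hA.neg
    rw [← eB] at this
    exact hne (this.unique hB hB0)
  by_cases h2 : N = Q
  · subst h2
    have := hQ.add hB.neg
    rw [← eA] at this
    exact hne (hA.unique this hA0)
  exact hA.three_add_ne_zero hB hQ.neg hne h2 h1 hA0 (add_neg_cancel (A + B))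

end Types

/-! ### Identities of Kronecker functions -/

section Kronecker

variable {K A : Type*} [Field K] [AddCommGroup A]

/-- `κ Θ(a + b) / (Θ(a) Θ(b))`; it is `δ(a, b)` when `Θ` is the theta function and `κ` its
derivative at zero. -/
def kron (κ : K) (Θ : A → K) (a b : A) : K := κ * Θ (a + b) / (Θ a * Θ b)

/-- An odd function that satisfies the three-term identity. -/
structure IsThetaLike (Θ : A → K) : Prop where
  neg : ∀ a, Θ (-a) = -Θ a
  fay : ∀ x y a b, Θ (x + a) * Θ (y + b) * Θ (a + b) * Θ (y - x) =
    Θ (x + a + b) * Θ (y - x + b) * Θ y * Θ a - Θ (y + a + b) * Θ (x - y + a) * Θ x * Θ b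

variable {Θ : A → K}

/-- The three-term identity for `kron`. -/
theorem IsThetaLike.kron_fay (hΘ : IsThetaLike Θ) (κ : K) {x y a b : A} (hx : Θ x ≠ 0)
    (hy : Θ y ≠ 0) (hyx : Θ (y - x) ≠ 0) (ha : Θ a ≠ 0) (hb : Θ b ≠ 0) (hab : Θ (a + b) ≠ 0) :
    kron κ Θ x a * kron κ Θ y b =
      kron κ Θ x (a + b) * kron κ Θ (y - x) b + kron κ Θ y (a + b) * kron κ Θ (x - y) a := by
  have h := hΘ.fay x y a b
  have hn : Θ (x - y) = -Θ (y - x) := by rw [← hΘ.neg, neg_sub]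
  simp only [kron, hn, ← add_assoc]
  field_simp
  linear_combination κ ^ 2 * h

theorem IsThetaLike.kron_mul_kron_neg_sub (hΘ : IsThetaLike Θ) (κ : K) {x y h : A} (hx : Θ x ≠ 0)
    (hy : Θ y ≠ 0) (hh : Θ h ≠ 0) :
    kron κ Θ (-y) h * kron κ Θ y h - kron κ Θ (-x) h * kron κ Θ x h =
      κ ^ 2 * (Θ (y - x) * Θ (x + y)) / (Θ x ^ 2 * Θ y ^ 2) := by
  have e := hΘ.fay x h h (y - h)
  have e1 : Θ (-y + h) = -Θ (y - h) := by rw [← hΘ.neg]; congr 1; abel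
  rw [show x + h + (y - h) = x + y by abel, show h + (y - h) = y by abel,
    show h - x + (y - h) = y - x by abel, show h + h + (y - h) = y + h by abel,
    show x - h + h = x by abel, show h - x = -x + h by abel] at e
  simp only [kron, hΘ.neg, e1]
  field_simp
  linear_combination κ ^ 2 * e

/-- The last factor is that of `kron_mul_kron_neg_sub`, and the two identities combine to
`kron_cubic`. -/
theorem IsThetaLike.kron_cubic_sub (hΘ : IsThetaLike Θ) (κ : K) {x y a b : A} (hx : Θ x ≠ 0)
    (hy : Θ y ≠ 0) (hxy : Θ (x + y) ≠ 0) (ha : Θ a ≠ 0) (hb : Θ b ≠ 0) (hab : Θ (a + b) ≠ 0) :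
    kron κ Θ x b * kron κ Θ y (a + b) * kron κ Θ x a -
      kron κ Θ y a * kron κ Θ x (a + b) * kron κ Θ y b =
      kron κ Θ (x + y) (a + b) *
        (κ ^ 2 * (Θ (y - x) * Θ (x + y)) / (Θ x ^ 2 * Θ y ^ 2)) := by
  have e := hΘ.fay (x + b) b a y
  rw [show x + b + a + y = x + y + (a + b) by abel, show x + b + a = x + (a + b) by abel,
    show b - (x + b) = -x by abel, show -x + y = y - x by abel, hΘ.neg, add_comm b y,
    add_comm a y, show b + a + y = y + (a + b) by abel, show x + b - b + a = x + a by abel] at e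
  simp only [kron]
  field_simp
  linear_combination κ ^ 3 * e

/-- The identity behind the coefficient of the identity in the braid relation. -/
theorem IsThetaLike.kron_cubic (hΘ : IsThetaLike Θ) (κ : K) {x y a b h : A} (hx : Θ x ≠ 0)
    (hy : Θ y ≠ 0) (hxy : Θ (x + y) ≠ 0) (ha : Θ a ≠ 0) (hb : Θ b ≠ 0) (hab : Θ (a + b) ≠ 0)
    (hh : Θ h ≠ 0) :
    kron κ Θ x b * kron κ Θ y (a + b) * kron κ Θ x a +
      kron κ Θ (-x) h * kron κ Θ (x + y) (a + b) * kron κ Θ x h =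
    kron κ Θ y a * kron κ Θ x (a + b) * kron κ Θ y b +
      kron κ Θ (-y) h * kron κ Θ (x + y) (a + b) * kron κ Θ y h := by
  linear_combination hΘ.kron_cubic_sub κ hx hy hxy ha hb hab -
    kron κ Θ (x + y) (a + b) * hΘ.kron_mul_kron_neg_sub κ hx hy hh

theorem IsThetaLike.kron_quadratic_sub (hΘ : IsThetaLike Θ) (κ : K) {p s t v h : A}
    (hpv : p + s = t + v) (hp : Θ p ≠ 0) (hs : Θ s ≠ 0) (ht : Θ t ≠ 0) (hv : Θ v ≠ 0)
    (hps : Θ (p + s) ≠ 0) (hh : Θ h ≠ 0) :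
    kron κ Θ p h * kron κ Θ s h - kron κ Θ t h * kron κ Θ v h =
      kron κ Θ (p + s) h * (κ * (Θ (p + s) * Θ (t - p) * Θ (s - t)) /
        (Θ p * Θ s * Θ t * Θ v)) := by
  obtain rfl : v = p + s - t := by rw [hpv]; abel
  have e := hΘ.fay (p + h) h (t - p) (p + s - t)
  rw [show p + h + (t - p) = t + h by abel, show h + (p + s - t) = p + s - t + h by abel,
    show t - p + (p + s - t) = s by abel, show h - (p + h) = -p by abel,
    show t + h + (p + s - t) = p + s + h by abel, show -p + (p + s - t) = s - t by abel,
    show h + (t - p) + (p + s - t) = s + h by abel, show p + h - h + (t - p) = t by abel,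
    hΘ.neg] at e
  simp only [kron]
  field_simp
  linear_combination κ ^ 2 * e

/-- The last factor is that of `kron_quadratic_sub`, and the two identities combine to
`kron_exchange`. -/
theorem IsThetaLike.kron_cubic_sub' (hΘ : IsThetaLike Θ) (κ : K) {p s t v μ μ' : A}
    (hpv : p + s = t + v) (hp : Θ p ≠ 0) (hs : Θ s ≠ 0) (ht : Θ t ≠ 0) (hv : Θ v ≠ 0)
    (hps : Θ (p + s) ≠ 0) (hst : Θ (s - t) ≠ 0) (hμ : Θ μ ≠ 0) (hμ' : Θ μ' ≠ 0)
    (hμμ : Θ (μ - μ') ≠ 0) :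
    kron κ Θ (-t) (μ - μ') * kron κ Θ v μ' * kron κ Θ s μ -
      kron κ Θ (-p) (μ - μ') * kron κ Θ v μ * kron κ Θ s μ' =
      kron κ Θ (s - t) μ * kron κ Θ (p + s) μ' * (κ * (Θ (p + s) * Θ (t - p) * Θ (s - t)) /
        (Θ p * Θ s * Θ t * Θ v)) := by
  obtain rfl : v = p + s - t := by rw [hpv]; abel
  have e := hΘ.fay p (μ - μ') (t - p) (p + s - t + μ')
  have e1 : Θ (p - (μ - μ') + (t - p)) = -Θ (-t + (μ - μ')) := by rw [← hΘ.neg]; congr 1; abel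
  rw [e1, show p + (t - p) = t by abel,
    show μ - μ' + (p + s - t + μ') = p + s - t + μ by abel,
    show t - p + (p + s - t + μ') = s + μ' by abel,
    show t + (p + s - t + μ') = p + s + μ' by abel,
    show μ - μ' - p + (p + s - t + μ') = s - t + μ by abel,
    show μ - μ' + (t - p) + (p + s - t + μ') = s + μ by abel,
    show μ - μ' - p = -p + (μ - μ') by abel] at e
  simp only [kron, hΘ.neg]
  field_simp
  linear_combination κ ^ 3 * e

/-- The four-term identity behind the exchange of two neighbouring arrows of a link pattern. -/
theorem IsThetaLike.kron_exchange (hΘ : IsThetaLike Θ) (κ : K) {a b c d μ μ' h : A}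
    (hab : Θ (a - b) ≠ 0) (hbd : Θ (b - d) ≠ 0) (hcd : Θ (c - d) ≠ 0) (hac : Θ (a - c) ≠ 0)
    (had : Θ (a - d) ≠ 0) (hbc : Θ (b - c) ≠ 0) (hμ : Θ μ ≠ 0) (hμ' : Θ μ' ≠ 0)
    (hμμ : Θ (μ - μ') ≠ 0) (hh : Θ h ≠ 0) :
    kron κ Θ (d - c) (μ - μ') *
        (kron κ Θ (a - c) μ' * kron κ Θ (a - d) h * kron κ Θ (b - d) μ) +
      kron κ Θ (c - d) h * (kron κ Θ (a - d) μ' * kron κ Θ (a - c) h * kron κ Θ (b - c) μ) =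
    kron κ Θ (b - a) (μ - μ') *
        (kron κ Θ (a - c) μ * kron κ Θ (a - d) h * kron κ Θ (b - d) μ') +
      kron κ Θ (a - b) h * (kron κ Θ (b - c) μ * kron κ Θ (b - d) h * kron κ Θ (a - d) μ') := by
  have e : (a - b) + (b - d) = (c - d) + (a - c) := by abel
  have e1 : (a - b) + (b - d) = a - d := by abel
  have e2 : b - d - (c - d) = b - c := by abel
  have h1 := hΘ.kron_quadratic_sub κ (h := h) e hab hbd hcd hac (by rwa [e1]) hh
  have h2 := hΘ.kron_cubic_sub' κ e hab hbd hcd hac (by rwa [e1]) (by rwa [e2]) hμ hμ' hμμ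
  rw [e1] at h1
  rw [e1, e2, neg_sub, neg_sub] at h2
  rw [e2] at h1
  linear_combination kron κ Θ (a - d) h * h2 - kron κ Θ (b - c) μ * kron κ Θ (a - d) μ' * h1

/-- The braid relation for operators of the shape `f ↦ d f + e s(f)`, where the coefficients
satisfy two quadratic relations and a cubic one. -/
theorem braid_of_relations {s t : K →+* K} {f : K} (hss : s (s f) = f) (htt : t (t f) = f)
    (hsts : s (t (s f)) = t (s (t f)))
    {d12a d12b d12c d23a d23b d23c d13a d13b d13c d21a d32b h12 h23 h13 h21 h32 : K}
    (t12 : t d12a = d13a) (th12 : t h12 = h13) (s23 : s d23c = d13c) (sh23 : s h23 = h13)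
    (s12 : s d12a = d21a) (sh12 : s h12 = h21) (s13 : s d13a = d23a) (sh13 : s h13 = h23)
    (s23b : s d23b = d13b) (t12c : t d12c = d13c) (t23b : t d23b = d32b) (th23 : t h23 = h32)
    (t13b : t d13b = d12b) (th13 : t h13 = h12)
    (fay1 : d12b * d13a = d12c * d23a + d13c * d32b)
    (fay2 : d23a * d13b = d23c * d12b + d13c * d21a)
    (cubic : d12b * d23c * d12a + h12 * d13c * h21 = d23a * d12c * d23b + h23 * d13c * h32) :
    d12b * (d23c * (d12a * f + h12 * s f) + h23 * t (d12a * f + h12 * s f)) +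
        h12 * s (d23c * (d12a * f + h12 * s f) + h23 * t (d12a * f + h12 * s f)) =
      d23a * (d12c * (d23b * f + h23 * t f) + h12 * s (d23b * f + h23 * t f)) +
        h23 * t (d12c * (d23b * f + h23 * t f) + h12 * s (d23b * f + h23 * t f)) := by
  simp only [map_add, map_mul, t12, th12, s23, sh23, s12, sh12, s13, sh13, s23b, t12c, t23b, th23,
    t13b, th13, hss, htt, hsts]
  linear_combination f * cubic + h23 * t f * fay1 - h12 * s f * fay2

end Kronecker

section Delta

variable {ι : Type} [Fintype ι]

theorem ofLinForm_apply {g : ℂ → ℂ} (hg : Differentiable ℂ g) (c : ι → ℤ) :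
    ofLinForm g hg c = algebraMap (Entire ι) (Mero ι) ⟨fun z => g (linForm c z), fun z _ =>
      AnalyticAt.fun_comp (hg.analyticAt _) (analyticAt_linForm c z)⟩ := rfl

theorem linForm_sub (c d : ι → ℤ) (z : ι → ℂ) :
    linForm (c - d) z = linForm c z - linForm d z := by
  rw [sub_eq_add_neg, linForm_add, linForm_neg, sub_eq_add_neg]

theorem isThetaLike_thetaAt (τ : UpperHalfPlane) :
    IsThetaLike (thetaAt τ : (ι → ℤ) → Mero ι) where
  neg a := by
    simp only [thetaAt, ofLinForm_apply]
    rw [← RingHom.map_neg]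
    congr 1
    apply Subtype.ext
    funext z
    change theta τ (linForm (-a) z) = -theta τ (linForm a z)
    rw [linForm_neg, theta_neg]
  fay x y a b := by
    simp only [thetaAt, ofLinForm_apply]
    simp only [← RingHom.map_mul, ← RingHom.map_sub]
    congr 1
    apply Subtype.ext
    funext z
    have h := theta_fay τ (linForm x z) (linForm y z) (linForm a z) (linForm b z)
    simp only [← linForm_add, ← linForm_sub] at h
    exact h

theorem delta_fay (τ : UpperHalfPlane) {x y z z' a b c : ι → ℤ} (hz : y - x = z) (hz' : x - y = z')
    (hc : a + b = c) (hx : x ≠ 0) (hy : y ≠ 0) (hz0 : z ≠ 0) (ha : a ≠ 0) (hb : b ≠ 0)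
    (hc0 : c ≠ 0) :
    delta τ x a * delta τ y b = delta τ x c * delta τ z b + delta τ y c * delta τ z' a := by
  subst hz hz' hc
  exact (isThetaLike_thetaAt τ).kron_fay _ (thetaAt_ne_zero τ hx) (thetaAt_ne_zero τ hy)
    (thetaAt_ne_zero τ hz0) (thetaAt_ne_zero τ ha) (thetaAt_ne_zero τ hb) (thetaAt_ne_zero τ hc0)

theorem delta_cubic (τ : UpperHalfPlane) {x y z x' y' a b c h : ι → ℤ} (hz : x + y = z)
    (hx' : -x = x') (hy' : -y = y') (hc : a + b = c) (hx : x ≠ 0) (hy : y ≠ 0) (hz0 : z ≠ 0)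
    (ha : a ≠ 0) (hb : b ≠ 0) (hc0 : c ≠ 0) (hh : h ≠ 0) :
    delta τ x b * delta τ y c * delta τ x a + delta τ x' h * delta τ z c * delta τ x h =
      delta τ y a * delta τ x c * delta τ y b + delta τ y' h * delta τ z c * delta τ y h := by
  subst hz hx' hy' hc
  exact (isThetaLike_thetaAt τ).kron_cubic _ (thetaAt_ne_zero τ hx) (thetaAt_ne_zero τ hy)
    (thetaAt_ne_zero τ hz0) (thetaAt_ne_zero τ ha) (thetaAt_ne_zero τ hb) (thetaAt_ne_zero τ hc0)
    (thetaAt_ne_zero τ hh)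

theorem delta_exchange (τ : UpperHalfPlane) {a b c d μ μ' h : ι → ℤ}
    (hab : a - b ≠ 0) (hbd : b - d ≠ 0) (hcd : c - d ≠ 0) (hac : a - c ≠ 0)
    (had : a - d ≠ 0) (hbc : b - c ≠ 0) (hμ : μ ≠ 0) (hμ' : μ' ≠ 0)
    (hμμ : μ - μ' ≠ 0) (hh : h ≠ 0) :
    delta τ (d - c) (μ - μ') * (delta τ (a - c) μ' * delta τ (a - d) h * delta τ (b - d) μ) +
      delta τ (c - d) h * (delta τ (a - d) μ' * delta τ (a - c) h * delta τ (b - c) μ) =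
    delta τ (b - a) (μ - μ') * (delta τ (a - c) μ * delta τ (a - d) h * delta τ (b - d) μ') +
      delta τ (a - b) h * (delta τ (b - c) μ * delta τ (b - d) h * delta τ (a - d) μ') :=
  (isThetaLike_thetaAt τ).kron_exchange _ (thetaAt_ne_zero τ hab) (thetaAt_ne_zero τ hbd)
    (thetaAt_ne_zero τ hcd) (thetaAt_ne_zero τ hac) (thetaAt_ne_zero τ had) (thetaAt_ne_zero τ hbc)
    (thetaAt_ne_zero τ hμ) (thetaAt_ne_zero τ hμ') (thetaAt_ne_zero τ hμμ) (thetaAt_ne_zero τ hh)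

theorem rename_delta (τ : UpperHalfPlane) (π : Equiv.Perm ι) (a b : ι → ℤ) :
    Mero.rename π (delta τ a b) = delta τ (fun v => a (π.symm v)) (fun v => b (π.symm v)) := by
  simp only [delta, thetaAt, map_div₀, RingHom.map_mul, rename_ofLinForm]
  rw [show Mero.rename π (algebraMap ℂ (Mero ι) (deriv (theta τ) 0)) = _ from
    Mero.comp_const _ _ _ _]
  rfl

end Delta

/-! ### Relations between elliptic Demazure operations -/

section Demazure

variable {m r : ℕ}

/-- The action of `w ∈ S_m` on linear forms, `x_i ↦ x_{w i}`. -/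
def formX (w : Equiv.Perm (Fin m)) (c : Var m r → ℤ) : Var m r → ℤ := fun v =>
  c ((Equiv.sumCongr (Equiv.sumCongr w (Equiv.refl _)) (Equiv.refl _)).symm v)

/-- The action of `σ ∈ S_r` on linear forms, `μ_j ↦ μ_{σ j}`. -/
def formMu (σ : Equiv.Perm (Fin r)) (c : Var m r → ℤ) : Var m r → ℤ := fun v =>
  c ((Equiv.sumCongr (Equiv.sumCongr (Equiv.refl _) σ) (Equiv.refl _)).symm v)

theorem formX_add (w : Equiv.Perm (Fin m)) (c d : Var m r → ℤ) :
    formX w (c + d) = formX w c + formX w d := rfl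

theorem formX_sub (w : Equiv.Perm (Fin m)) (c d : Var m r → ℤ) :
    formX w (c - d) = formX w c - formX w d := rfl

theorem formMu_add (σ : Equiv.Perm (Fin r)) (c d : Var m r → ℤ) :
    formMu σ (c + d) = formMu σ c + formMu σ d := rfl

theorem formMu_sub (σ : Equiv.Perm (Fin r)) (c d : Var m r → ℤ) :
    formMu σ (c - d) = formMu σ c - formMu σ d := rfl

theorem single_symm {ι : Type} [DecidableEq ι] (π : Equiv.Perm ι) (i : ι) :
    (fun v => (Pi.single i 1 : ι → ℤ) (π.symm v)) = Pi.single (π i) 1 := by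
  funext v
  by_cases h : v = π i
  · subst h
    simp
  · rw [Pi.single_eq_of_ne h, Pi.single_eq_of_ne]
    exact fun h' => h (by rw [← h', Equiv.apply_symm_apply])

@[simp] theorem formX_X (w : Equiv.Perm (Fin m)) (i : Fin m) :
    formX w (X i : Var m r → ℤ) = X (w i) := single_symm _ _

@[simp] theorem formX_U (w : Equiv.Perm (Fin m)) : formX w (U : Var m r → ℤ) = U := single_symm _ _

@[simp] theorem formMu_X (σ : Equiv.Perm (Fin r)) (i : Fin m) :
    formMu σ (X i : Var m r → ℤ) = X i := single_symm _ _

@[simp] theorem formMu_Mu (σ : Equiv.Perm (Fin r)) (j : Fin r) :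
    formMu σ (Mu j : Var m r → ℤ) = Mu (σ j) := single_symm _ _

@[simp] theorem formMu_U (σ : Equiv.Perm (Fin r)) : formMu σ (U : Var m r → ℤ) = U :=
  single_symm _ _

@[simp] theorem formMu_H (σ : Equiv.Perm (Fin r)) : formMu σ (H : Var m r → ℤ) = H :=
  single_symm _ _

theorem IsParameter.formX {ν : Var m r → ℤ} (h : IsParameter ν) (w : Equiv.Perm (Fin m)) :
    formX w ν = ν := by
  funext v
  rcases v with (i | j) | b
  · exact (h.1 _).trans (h.1 _).symm
  · rfl
  · rfl

theorem isParameter_H : IsParameter (H : Var m r → ℤ) :=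
  ⟨fun _ => by simp [H], by simp [H]⟩

theorem isParameter_Mu (j : Fin r) : IsParameter (Mu j : Var m r → ℤ) :=
  ⟨fun _ => by simp [Mu], by simp [Mu]⟩

theorem IsParameter.add {ν ρ : Var m r → ℤ} (h : IsParameter ν) (h' : IsParameter ρ) :
    IsParameter (ν + ρ) := ⟨fun i => by simp [h.1, h'.1], by simp [h.2, h'.2]⟩

theorem IsParameter.sub {ν ρ : Var m r → ℤ} (h : IsParameter ν) (h' : IsParameter ρ) :
    IsParameter (ν - ρ) := ⟨fun i => by simp [h.1, h'.1], by simp [h.2, h'.2]⟩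

theorem IsParameter.zsmul {ν : Var m r → ℤ} (h : IsParameter ν) (n : ℤ) :
    IsParameter (n • ν) := ⟨fun i => by simp [h.1], by simp [h.2]⟩

theorem X_apply (i j : Fin m) :
    (X i : Var m r → ℤ) (Sum.inl (Sum.inl j)) = if j = i then 1 else 0 := by
  simp [X, Pi.single_apply]

theorem H_apply : (H : Var m r → ℤ) (Sum.inr true) = 1 := by simp [H]

theorem H_ne_zero : (H : Var m r → ℤ) ≠ 0 := fun h => by
  have := congrFun h (Sum.inr true)
  rw [H_apply] at this
  exact one_ne_zero this

theorem Mu_apply (i j : Fin r) :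
    (Mu i : Var m r → ℤ) (Sum.inl (Sum.inr j)) = if j = i then 1 else 0 := by
  simp [Mu, Pi.single_apply]

theorem X_sub_X_ne_zero {i j : Fin m} (h : i ≠ j) : (X i - X j : Var m r → ℤ) ≠ 0 := fun h0 => by
  have := congrFun h0 (Sum.inl (Sum.inl i))
  simp [X_apply, h] at this

theorem permX_delta (τ : UpperHalfPlane) (w : Equiv.Perm (Fin m)) (a b : Var m r → ℤ) :
    permX (r := r) w (delta τ a b) = delta τ (formX w a) (formX w b) := rename_delta τ _ a b

theorem permMu_delta (τ : UpperHalfPlane) (σ : Equiv.Perm (Fin r)) (a b : Var m r → ℤ) :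
    permMu (m := m) σ (delta τ a b) = delta τ (formMu σ a) (formMu σ b) := rename_delta τ _ a b

theorem permX_delta_X_sub_X (τ : UpperHalfPlane) (w : Equiv.Perm (Fin m)) (i j : Fin m)
    {ν : Var m r → ℤ} (hν : IsParameter ν) :
    permX (r := r) w (delta τ (X i - X j) ν) = delta τ (X (w i) - X (w j)) ν := by
  rw [permX_delta, formX_sub, formX_X, formX_X, hν.formX]

theorem permX_permX (w w' : Equiv.Perm (Fin m)) (f : Mero (Var m r)) :
    permX (r := r) w (permX (r := r) w' f) = permX (r := r) (w * w') f := by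
  refine (rename_rename _ _ f).trans ?_
  congr 1
  congr 1
  ext v : 1
  rcases v with (i | j) | b <;> rfl

theorem rename_one {ι : Type} [Fintype ι] (f : Mero ι) : Mero.rename 1 f = f := by
  have h := rename_rename 1 1 f
  rw [mul_one] at h
  exact RingHom.injective _ h

theorem permX_one (f : Mero (Var m r)) : permX (r := r) 1 f = f := by
  refine Eq.trans ?_ (rename_one f)
  unfold permX
  congr 1
  congr 1
  ext v : 1
  rcases v with (i | j) | b <;> rfl

theorem permMu_permMu (σ σ' : Equiv.Perm (Fin r)) (f : Mero (Var m r)) :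
    permMu (m := m) σ (permMu (m := m) σ' f) = permMu (m := m) (σ * σ') f := by
  refine (rename_rename _ _ f).trans ?_
  congr 1
  congr 1
  ext v : 1
  rcases v with (i | j) | b <;> rfl

theorem permX_permMu (w : Equiv.Perm (Fin m)) (σ : Equiv.Perm (Fin r)) (f : Mero (Var m r)) :
    permX (r := r) w (permMu (m := m) σ f) = permMu (m := m) σ (permX (r := r) w f) := by
  refine (rename_rename _ _ f).trans (Eq.trans ?_ (rename_rename _ _ f).symm)
  congr 1
  congr 1
  ext v : 1
  rcases v with (i | j) | b <;> rfl

theorem permMu_demazure (τ : UpperHalfPlane) (σ : Equiv.Perm (Fin r)) (i : Fin (m - 1))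
    (ν : Var m r → ℤ) (f : Mero (Var m r)) :
    permMu (m := m) σ (demazure τ i ν f) = demazure τ i (formMu σ ν) (permMu (m := m) σ f) := by
  simp only [demazure, RingHom.map_add, RingHom.map_mul, permMu_delta, formMu_sub, formMu_X,
    formMu_H, permX_permMu]

theorem lo_ne_hi (i : Fin (m - 1)) : lo i ≠ hi i := fun h => by
  simpa [lo, hi] using congrArg Fin.val h

theorem simple_mul_self (i : Fin (m - 1)) : simple i * simple i = 1 := Equiv.swap_mul_self _ _

theorem simple_lo (i : Fin (m - 1)) : simple i (lo i) = hi i := Equiv.swap_apply_left _ _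

theorem simple_hi (i : Fin (m - 1)) : simple i (hi i) = lo i := Equiv.swap_apply_right _ _

theorem simple_comm {i j : Fin (m - 1)} (h1 : lo j ≠ lo i) (h2 : lo j ≠ hi i) (h3 : hi j ≠ lo i)
    (h4 : hi j ≠ hi i) : simple i * simple j = simple j * simple i :=
  (Equiv.Perm.Disjoint.commute (by
    intro x
    unfold simple
    by_cases h : x = lo j ∨ x = hi j
    · left
      rcases h with rfl | rfl
      · exact Equiv.swap_apply_of_ne_of_ne h1 h2
      · exact Equiv.swap_apply_of_ne_of_ne h3 h4
    · right
      push Not at h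
      exact Equiv.swap_apply_of_ne_of_ne h.1 h.2)).eq

theorem demazure_comm (τ : UpperHalfPlane) {i j : Fin (m - 1)} (h1 : lo j ≠ lo i)
    (h2 : lo j ≠ hi i) (h3 : hi j ≠ lo i) (h4 : hi j ≠ hi i) {ν ρ : Var m r → ℤ}
    (hν : IsParameter ν) (hρ : IsParameter ρ) (f : Mero (Var m r)) :
    demazure τ i ν (demazure τ j ρ f) = demazure τ j ρ (demazure τ i ν f) := by
  have a1 : simple i (lo j) = lo j := Equiv.swap_apply_of_ne_of_ne h1 h2
  have a2 : simple i (hi j) = hi j := Equiv.swap_apply_of_ne_of_ne h3 h4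
  have a3 : simple j (lo i) = lo i := Equiv.swap_apply_of_ne_of_ne h1.symm h3.symm
  have a4 : simple j (hi i) = hi i := Equiv.swap_apply_of_ne_of_ne h2.symm h4.symm
  simp only [demazure, RingHom.map_add, RingHom.map_mul, permX_delta_X_sub_X τ _ _ _ hν,
    permX_delta_X_sub_X τ _ _ _ hρ, permX_delta_X_sub_X τ _ _ _ isParameter_H, a1, a2, a3, a4,
    permX_permX, simple_comm h1 h2 h3 h4]
  ring

theorem simple_braid {i j : Fin (m - 1)} (h : hi i = lo j) :
    simple i * simple j * simple i = simple j * simple i * simple j := by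
  have n1 : lo i ≠ hi i := lo_ne_hi i
  have n2 : lo j ≠ hi j := lo_ne_hi j
  have n3 : lo i ≠ hi j := fun h' => by
    have e1 := congrArg Fin.val h
    have e2 := congrArg Fin.val h'
    simp only [lo, hi] at e1 e2
    omega
  unfold simple
  rw [h] at *
  have e1 := Equiv.swap_mul_swap_mul_swap n2.symm n3.symm
  rw [Equiv.swap_comm (lo j) (lo i), Equiv.swap_comm (hi j) (lo j)] at e1
  rw [e1, Equiv.swap_mul_swap_mul_swap n1 n3, Equiv.swap_comm]

/-- The braid relation for elliptic Demazure operations with the parameters `p₁ - p₂`, `p₁ - p₃`,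
`p₂ - p₃`, written with `a = p₁ - p₂` and `b = p₂ - p₃`. -/
theorem demazure_braid (τ : UpperHalfPlane) {i j : Fin (m - 1)} (hij : hi i = lo j)
    {a b : Var m r → ℤ} (ha : IsParameter a) (hb : IsParameter b) (ha0 : a ≠ 0) (hb0 : b ≠ 0)
    (hab0 : a + b ≠ 0) (f : Mero (Var m r)) :
    demazure τ i b (demazure τ j (a + b) (demazure τ i a f)) =
      demazure τ j a (demazure τ i (a + b) (demazure τ j b f)) := by
  have n1 : lo i ≠ lo j := hij ▸ lo_ne_hi i
  have n2 : lo j ≠ hi j := lo_ne_hi j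
  have n3 : lo i ≠ hi j := fun h' => by
    have e1 := congrArg Fin.val hij
    have e2 := congrArg Fin.val h'
    simp only [lo, hi] at e1 e2
    omega
  have hab := ha.add hb
  have s1 : simple i (lo i) = lo j := hij ▸ simple_lo i
  have s2 : simple i (lo j) = lo i := hij ▸ simple_hi i
  have s3 : simple i (hi j) = hi j := Equiv.swap_apply_of_ne_of_ne n3.symm (hij ▸ n2.symm)
  have t1 : simple j (lo i) = lo i := Equiv.swap_apply_of_ne_of_ne n1 n3
  have t2 := simple_lo j
  have t3 := simple_hi j
  have x12 := X_sub_X_ne_zero (r := r) n1.symm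
  have x23 := X_sub_X_ne_zero (r := r) n2.symm
  have x13 := X_sub_X_ne_zero (r := r) n3.symm
  have fay1 := delta_fay τ (x := X (lo j) - X (lo i)) (y := X (hi j) - X (lo i))
    (z := X (hi j) - X (lo j)) (z' := X (lo j) - X (hi j)) (by abel) (by abel) (add_comm b a)
    x12 x13 x23 hb0 ha0 hab0
  have fay2 := delta_fay τ (x := X (hi j) - X (lo j)) (y := X (hi j) - X (lo i))
    (z := X (lo j) - X (lo i)) (z' := X (lo i) - X (lo j)) (by abel) (by abel) rfl
    x23 x13 x12 ha0 hb0 hab0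
  have cubic := delta_cubic τ (x := X (lo j) - X (lo i)) (y := X (hi j) - X (lo j))
    (z := X (hi j) - X (lo i)) (x' := X (lo i) - X (lo j)) (y' := X (lo j) - X (hi j)) (by abel)
    (by abel) (by abel) rfl x12 x23 x13 ha0 hb0 hab0 H_ne_zero
  have hss : permX (r := r) (simple i) (permX (r := r) (simple i) f) = f := by
    rw [permX_permX, simple_mul_self, permX_one]
  have htt : permX (r := r) (simple j) (permX (r := r) (simple j) f) = f := by
    rw [permX_permX, simple_mul_self, permX_one]
  have hsts : permX (r := r) (simple i) (permX (r := r) (simple j) (permX (r := r) (simple i) f)) =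
      permX (r := r) (simple j) (permX (r := r) (simple i) (permX (r := r) (simple j) f)) := by
    simp only [permX_permX, ← mul_assoc, simple_braid hij]
  simp only [demazure, hij]
  apply braid_of_relations hss htt hsts (d13a := delta τ (X (hi j) - X (lo i)) a)
    (d13b := delta τ (X (hi j) - X (lo i)) b) (d13c := delta τ (X (hi j) - X (lo i)) (a + b))
    (h13 := delta τ (X (lo i) - X (hi j)) H) (fay1 := fay1) (fay2 := fay2) (cubic := cubic)
  all_goals
    simp only [permX_delta_X_sub_X τ _ _ _ ha, permX_delta_X_sub_X τ _ _ _ hb,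
      permX_delta_X_sub_X τ _ _ _ hab, permX_delta_X_sub_X τ _ _ _ isParameter_H, s1, s2, s3, t1,
      t2, t3]

end Demazure

/-! ### Lengths and reduced words -/

section Words

variable {m : ℕ}

theorem perm_inv_apply_self (w : Equiv.Perm (Fin m)) (p : Fin m) : w⁻¹ (w p) = p :=
  w.symm_apply_apply p

theorem perm_apply_inv_self (w : Equiv.Perm (Fin m)) (p : Fin m) : w (w⁻¹ p) = p :=
  w.apply_symm_apply p

theorem simple_lt_simple_iff (i : Fin (m - 1)) {a b : Fin m} (_ : a ≠ b) :
    simple i a < simple i b ↔ (a < b ∧ ¬(a = lo i ∧ b = hi i)) ∨ (a = hi i ∧ b = lo i) := by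
  have hlt : (hi i : ℕ) = (lo i : ℕ) + 1 := rfl
  have key : ∀ a : Fin m, (simple i a : ℕ) =
      if a = lo i then (lo i : ℕ) + 1 else if a = hi i then (lo i : ℕ) else a := by
    intro a
    unfold simple
    rw [Equiv.swap_apply_def]
    split_ifs <;> simp [hlt]
  rw [Fin.lt_def, Fin.lt_def, key, key]
  simp only [Fin.ext_iff] at *
  split_ifs <;> omega

theorem len_simple_mul_of_lt {i : Fin (m - 1)} {w : Equiv.Perm (Fin m)}
    (h : w⁻¹ (lo i) < w⁻¹ (hi i)) : len (simple i * w) = len w + 1 := by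
  classical
  have e : (Finset.univ.filter fun p : Fin m × Fin m =>
        p.1 < p.2 ∧ (simple i * w) p.2 < (simple i * w) p.1) =
      insert (w⁻¹ (lo i), w⁻¹ (hi i))
        (Finset.univ.filter fun p : Fin m × Fin m => p.1 < p.2 ∧ w p.2 < w p.1) := by
    ext ⟨a, b⟩
    rw [Finset.mem_insert, Finset.mem_filter_univ, Finset.mem_filter_univ, Prod.mk.injEq,
      Equiv.Perm.eq_inv_iff_eq, Equiv.Perm.eq_inv_iff_eq]
    simp only [Equiv.Perm.mul_apply]
    constructor
    · rintro ⟨h1, h2⟩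
      rcases (simple_lt_simple_iff i (w.injective.ne h1.ne')).mp h2 with h3 | h3
      · exact Or.inr ⟨h1, h3.1⟩
      · exact Or.inl ⟨h3.2, h3.1⟩
    · rintro (⟨h1, h2⟩ | ⟨h1, h2⟩)
      · have hab : a < b := by
          rwa [← h1, ← h2, perm_inv_apply_self, perm_inv_apply_self] at h
        exact ⟨hab, (simple_lt_simple_iff i (w.injective.ne hab.ne')).mpr (Or.inr ⟨h2, h1⟩)⟩
      · refine ⟨h1, (simple_lt_simple_iff i (w.injective.ne h1.ne')).mpr (Or.inl ⟨h2, ?_⟩)⟩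
        rintro ⟨h3, h4⟩
        rw [← h3, ← h4, perm_inv_apply_self, perm_inv_apply_self] at h
        exact lt_asymm h h1
  rw [len, e, Finset.card_insert_of_notMem, len]
  rw [Finset.mem_filter_univ, perm_apply_inv_self, perm_apply_inv_self, not_and]
  intro _ h'
  have := Fin.lt_def.mp h'
  simp only [lo, hi] at this
  omega

theorem simple_inv (i : Fin (m - 1)) : (simple i)⁻¹ = simple i := Equiv.swap_inv _ _

theorem simple_mul_simple_mul (i : Fin (m - 1)) (w : Equiv.Perm (Fin m)) :
    simple i * (simple i * w) = w := by rw [← mul_assoc, simple_mul_self, one_mul]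

theorem simple_mul_inv_apply (i : Fin (m - 1)) (w : Equiv.Perm (Fin m)) (p : Fin m) :
    (simple i * w)⁻¹ p = w⁻¹ (simple i p) := by rw [mul_inv_rev, simple_inv, Equiv.Perm.mul_apply]

theorem len_simple_mul_of_gt {i : Fin (m - 1)} {w : Equiv.Perm (Fin m)}
    (h : w⁻¹ (hi i) < w⁻¹ (lo i)) : len (simple i * w) + 1 = len w := by
  have := len_simple_mul_of_lt (i := i) (w := simple i * w) (by
    rwa [simple_mul_inv_apply, simple_mul_inv_apply, simple_lo, simple_hi])
  rw [simple_mul_simple_mul] at this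
  exact this.symm

theorem inv_lo_ne_inv_hi (w : Equiv.Perm (Fin m)) (i : Fin (m - 1)) : w⁻¹ (lo i) ≠ w⁻¹ (hi i) :=
  w⁻¹.injective.ne (lo_ne_hi i)

theorem len_inv (w : Equiv.Perm (Fin m)) : len w⁻¹ = len w := by
  unfold len
  apply Finset.card_bij (fun p _ => (w⁻¹ p.2, w⁻¹ p.1))
  · rintro ⟨a, b⟩ h
    rw [Finset.mem_filter_univ] at h ⊢
    rw [perm_apply_inv_self, perm_apply_inv_self]
    exact ⟨h.2, h.1⟩
  · rintro ⟨a, b⟩ _ ⟨a', b'⟩ _ h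
    simp only [Prod.mk.injEq, EmbeddingLike.apply_eq_iff_eq] at h
    rw [h.1, h.2]
  · rintro ⟨a, b⟩ h
    rw [Finset.mem_filter_univ] at h
    exact ⟨(w b, w a), by simp [h], by simp⟩

theorem len_mul_simple_of_lt {i : Fin (m - 1)} {w : Equiv.Perm (Fin m)} (h : w (lo i) < w (hi i)) :
    len (w * simple i) = len w + 1 := by
  rw [← len_inv, mul_inv_rev, simple_inv, len_simple_mul_of_lt (by simpa using h), len_inv]

theorem len_mul_simple_of_gt {i : Fin (m - 1)} {w : Equiv.Perm (Fin m)} (h : w (hi i) < w (lo i)) :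
    len (w * simple i) + 1 = len w := by
  rw [← len_inv, mul_inv_rev, simple_inv, len_simple_mul_of_gt (by simpa using h), len_inv]

theorem strictMono_of_lo_lt_hi {α : Type*} [Preorder α] {f : Fin m → α}
    (h : ∀ i, f (lo i) < f (hi i)) : StrictMono f := by
  cases m with
  | zero => exact fun a => a.elim0
  | succ n => exact Fin.strictMono_iff_lt_succ.mpr fun i => h i

theorem eq_one_of_lo_lt_hi {w : Equiv.Perm (Fin m)} (h : ∀ i, w (lo i) < w (hi i)) : w = 1 := by
  have hw := strictMono_of_lo_lt_hi h
  have : hw.orderIsoOfSurjective w w.surjective = OrderIso.refl _ := Subsingleton.elim _ _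
  ext p
  exact congrArg Fin.val (DFunLike.congr_fun this p)

theorem exists_reducedWord (w : Equiv.Perm (Fin m)) : ∃ L, IsReducedWord L w := by
  induction hn : len w using Nat.strong_induction_on generalizing w with
  | _ n ih =>
    by_cases h : ∀ i, w⁻¹ (lo i) < w⁻¹ (hi i)
    · obtain rfl : w = 1 := inv_eq_one.mp (eq_one_of_lo_lt_hi h)
      refine ⟨[], rfl, ?_⟩
      symm
      rw [List.length_nil, len, Finset.card_eq_zero, Finset.filter_eq_empty_iff]
      rintro p - ⟨h1, h2⟩
      exact lt_asymm h1 h2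
    · push Not at h
      obtain ⟨i, hi⟩ := h
      have hl := len_simple_mul_of_gt (lt_of_le_of_ne hi (inv_lo_ne_inv_hi w i).symm)
      obtain ⟨L, hL, hL'⟩ := ih _ (by omega) (simple i * w) rfl
      refine ⟨i :: L, ?_, ?_⟩
      · rw [List.map_cons, List.prod_cons, hL, simple_mul_simple_mul]
      · rw [List.length_cons, hL', hl]

theorem len_prod_le (L : List (Fin (m - 1))) : len (L.map simple).prod ≤ L.length := by
  induction L with
  | nil =>
    rw [List.map_nil, List.prod_nil, List.length_nil, Nat.le_zero, len, Finset.card_eq_zero,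
      Finset.filter_eq_empty_iff]
    rintro p - ⟨h1, h2⟩
    exact lt_asymm h1 h2
  | cons i L ih =>
    rw [List.map_cons, List.prod_cons, List.length_cons]
    rcases (inv_lo_ne_inv_hi (L.map simple).prod i).lt_or_gt with h | h
    · rw [len_simple_mul_of_lt h]
      omega
    · have := len_simple_mul_of_gt h
      omega

theorem IsReducedWord.of_cons {i : Fin (m - 1)} {L : List (Fin (m - 1))} {w : Equiv.Perm (Fin m)}
    (h : IsReducedWord (i :: L) w) :
    IsReducedWord L (simple i * w) ∧ w⁻¹ (hi i) < w⁻¹ (lo i) := by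
  obtain ⟨h1, h2⟩ := h
  rw [List.map_cons, List.prod_cons] at h1
  rw [List.length_cons] at h2
  have h3 : (L.map simple).prod = simple i * w := by rw [← h1, simple_mul_simple_mul]
  have h4 := len_prod_le L
  rw [h3] at h4
  rcases (inv_lo_ne_inv_hi w i).lt_or_gt with h | h
  · have := len_simple_mul_of_lt h
    omega
  · have := len_simple_mul_of_gt h
    exact ⟨⟨h3, by omega⟩, h⟩

/-- `u` precedes `w = s_i u` in the weak order, so a reduced word of `u` extends to one of `w`. -/
theorem IsReducedWord.cons {i : Fin (m - 1)} {L : List (Fin (m - 1))} {w : Equiv.Perm (Fin m)}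
    (h : w⁻¹ (hi i) < w⁻¹ (lo i)) (hL : IsReducedWord L (simple i * w)) :
    IsReducedWord (i :: L) w := by
  refine ⟨?_, ?_⟩
  · rw [List.map_cons, List.prod_cons, hL.1, simple_mul_simple_mul]
  · rw [List.length_cons, hL.2, len_simple_mul_of_gt h]

theorem IsReducedWord.append_singleton {i : Fin (m - 1)} {L : List (Fin (m - 1))}
    {w : Equiv.Perm (Fin m)} (hL : IsReducedWord L w) (h : w (lo i) < w (hi i)) :
    IsReducedWord (L ++ [i]) (w * simple i) := by
  refine ⟨?_, ?_⟩
  · rw [List.map_append, List.prod_append, hL.1, List.map_singleton, List.prod_singleton]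
  · rw [List.length_append, hL.2, len_mul_simple_of_lt h, List.length_singleton]

/-- Matsumoto's theorem: a function on words that is compatible with prepending letters and
invariant under commutation and braid moves at the front takes the same value on all reduced words
of a permutation. -/
theorem eq_of_isReducedWord {G : Type*} {W : List (Fin (m - 1)) → G}
    (hcons : ∀ i L L', (L.map simple).prod = (L'.map simple).prod → W L = W L' →
      W (i :: L) = W (i :: L'))
    (hcomm : ∀ i j L, lo j ≠ lo i → lo j ≠ hi i → hi j ≠ lo i → hi j ≠ hi i →
      W (i :: j :: L) = W (j :: i :: L))
    (hbraid : ∀ i j L, hi i = lo j → W (i :: j :: i :: L) = W (j :: i :: j :: L))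
    {L L' : List (Fin (m - 1))} {w : Equiv.Perm (Fin m)} (hL : IsReducedWord L w)
    (hL' : IsReducedWord L' w) : W L = W L' := by
  induction hn : L.length using Nat.strong_induction_on generalizing L L' w with
  | _ n ih =>
    have hlen : L.length = L'.length := hL.2.trans hL'.2.symm
    rcases L with _ | ⟨i, L⟩
    · rw [List.length_nil] at hlen
      rw [List.length_eq_zero_iff.mp hlen.symm]
    rcases L' with _ | ⟨j, L'⟩
    · simp at hlen
    rw [List.length_cons] at hn
    -- Two words of `w` beginning with `i` and `j` are connected through words of `w` beginning with
    -- a reduced word of the longest element of the group generated by `s_i` and `s_j`.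
    have adj : ∀ {i j : Fin (m - 1)} {L L' : List (Fin (m - 1))}, L.length < n → L'.length < n →
        IsReducedWord (i :: L) w → IsReducedWord (j :: L') w → hi i = lo j →
        W (i :: L) = W (j :: L') := by
      intro i j L L' hn hn' hL hL' hij
      obtain ⟨rL, di⟩ := hL.of_cons
      obtain ⟨rL', dj⟩ := hL'.of_cons
      have n1 : lo i ≠ lo j := hij ▸ lo_ne_hi i
      have n3 : lo i ≠ hi j := fun h' => by
        have e1 := congrArg Fin.val hij
        have e2 := congrArg Fin.val h'
        simp only [lo, hi] at e1 e2
        omega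
      have s1 : simple i (lo i) = lo j := hij ▸ simple_lo i
      have s2 : simple i (lo j) = lo i := hij ▸ simple_hi i
      have s3 : simple i (hi j) = hi j :=
        Equiv.swap_apply_of_ne_of_ne n3.symm (hij ▸ (lo_ne_hi j).symm)
      have t1 : simple j (lo i) = lo i := Equiv.swap_apply_of_ne_of_ne n1 n3
      rw [hij] at di
      obtain ⟨K, hK⟩ := exists_reducedWord (simple i * (simple j * (simple i * w)))
      have hK' := hK
      rw [← mul_assoc, ← mul_assoc, simple_braid hij, mul_assoc, mul_assoc] at hK'
      have r1 : IsReducedWord (j :: i :: K) (simple i * w) := by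
        refine IsReducedWord.cons ?_ (IsReducedWord.cons ?_ hK)
        · simp only [simple_mul_inv_apply, s2, s3]
          exact dj.trans di
        · simp only [simple_mul_inv_apply, hij, t1, simple_lo, s1, s3]
          exact dj
      have r2 : IsReducedWord (i :: j :: K) (simple j * w) := by
        refine IsReducedWord.cons ?_ (IsReducedWord.cons ?_ hK')
        · simp only [simple_mul_inv_apply, hij, simple_lo, t1]
          exact dj.trans di
        · simp only [simple_mul_inv_apply, simple_hi, s2, s3, t1]
          exact di
      rw [hcons i L _ (rL.1.trans r1.1.symm) (ih _ hn rL r1 rfl),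
        hcons j L' _ (rL'.1.trans r2.1.symm) (ih _ hn' rL' r2 rfl), hbraid i j K hij]
    have hlen' : L.length < n ∧ L'.length < n := by
      simp only [List.length_cons] at hlen
      omega
    obtain ⟨rL, di⟩ := hL.of_cons
    obtain ⟨rL', dj⟩ := hL'.of_cons
    by_cases hij : i = j
    · subst hij
      exact hcons i L L' (rL.1.trans rL'.1.symm) (ih _ hlen'.1 rL rL' rfl)
    by_cases h1 : hi i = lo j
    · exact adj hlen'.1 hlen'.2 hL hL' h1
    by_cases h2 : hi j = lo i
    · exact (adj hlen'.2 hlen'.1 hL' hL h2).symm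
    have h3 : lo j ≠ lo i := fun h => hij (Fin.ext (by simpa [lo] using (congrArg Fin.val h).symm))
    have h4 : hi j ≠ hi i := fun h => hij (Fin.ext (by simpa [hi] using (congrArg Fin.val h).symm))
    have hcm := simple_comm h3 (Ne.symm h1) h2 h4
    obtain ⟨K, hK⟩ := exists_reducedWord (simple j * (simple i * w))
    have hK' := hK
    rw [← mul_assoc, ← hcm, mul_assoc] at hK'
    have r1 : IsReducedWord (j :: K) (simple i * w) := by
      refine IsReducedWord.cons ?_ hK
      simp only [simple_mul_inv_apply]
      unfold simple
      rwa [Equiv.swap_apply_of_ne_of_ne h2 h4, Equiv.swap_apply_of_ne_of_ne h3 (Ne.symm h1)]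
    have r2 : IsReducedWord (i :: K) (simple j * w) := by
      refine IsReducedWord.cons ?_ hK'
      simp only [simple_mul_inv_apply]
      unfold simple
      rwa [Equiv.swap_apply_of_ne_of_ne h1 h4.symm, Equiv.swap_apply_of_ne_of_ne h3.symm
        (Ne.symm h2)]
    rw [hcons i L _ (rL.1.trans r1.1.symm) (ih _ hlen'.1 rL r1 rfl),
      hcons j L' _ (rL'.1.trans r2.1.symm) (ih _ hlen'.2 rL' r2 rfl),
      hcomm i j K h3 (Ne.symm h1) h2 h4]

end Words

/-! ### Demazure operations along words -/

section WordVal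

variable {m r : ℕ}

/-- The value at `f` of the product of elliptic Demazure operations along a word. The nodes carry
weights, at the start `wt`, which the letters of the word exchange; the operation at the nodes `i`,
`i + 1` has the difference of their weights as its parameter. -/
def wordVal (τ : UpperHalfPlane) (wt : Fin m → Var m r → ℤ) (f : Mero (Var m r)) :
    List (Fin (m - 1)) → Mero (Var m r)
  | [] => f
  | i :: L => demazure τ i (wt ((L.map simple).prod⁻¹ (lo i)) - wt ((L.map simple).prod⁻¹ (hi i)))
      (wordVal τ wt f L)

/-- Weights that are characters in the variables `μ_1, …, μ_r, h` and pairwise different, so that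
their differences are parameters. -/
structure IsWeight (wt : Fin m → Var m r → ℤ) : Prop where
  isParameter : ∀ p, IsParameter (wt p)
  injective : Function.Injective wt

theorem IsWeight.comp {wt : Fin m → Var m r → ℤ} (h : IsWeight wt) (w : Equiv.Perm (Fin m)) :
    IsWeight (fun p => wt (w p)) :=
  ⟨fun p => h.isParameter (w p), h.injective.comp w.injective⟩

theorem IsWeight.isParameter_sub {wt : Fin m → Var m r → ℤ} (h : IsWeight wt) (p q : Fin m) :
    IsParameter (wt p - wt q) := (h.isParameter p).sub (h.isParameter q)

theorem IsWeight.sub_ne_zero {wt : Fin m → Var m r → ℤ} (h : IsWeight wt) {p q : Fin m}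
    (hpq : p ≠ q) : wt p - wt q ≠ 0 := _root_.sub_ne_zero.mpr (h.injective.ne hpq)

theorem wordVal_eq (τ : UpperHalfPlane) {wt : Fin m → Var m r → ℤ} (h : IsWeight wt)
    (f : Mero (Var m r)) {L L' : List (Fin (m - 1))} {w : Equiv.Perm (Fin m)}
    (hL : IsReducedWord L w) (hL' : IsReducedWord L' w) :
    wordVal τ wt f L = wordVal τ wt f L' := by
  refine eq_of_isReducedWord (W := wordVal τ wt f) ?_ ?_ ?_ hL hL'
  · intro i L L' hp hW
    rw [wordVal, wordVal, hp, hW]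
  · intro i j L h1 h2 h3 h4
    have e1 : simple j (lo i) = lo i := Equiv.swap_apply_of_ne_of_ne h1.symm h3.symm
    have e2 : simple j (hi i) = hi i := Equiv.swap_apply_of_ne_of_ne h2.symm h4.symm
    have e3 : simple i (lo j) = lo j := Equiv.swap_apply_of_ne_of_ne h1 h2
    have e4 : simple i (hi j) = hi j := Equiv.swap_apply_of_ne_of_ne h3 h4
    simp only [wordVal, List.map_cons, List.prod_cons, simple_mul_inv_apply, e1, e2, e3, e4]
    exact demazure_comm τ h1 h2 h3 h4 (h.isParameter_sub _ _) (h.isParameter_sub _ _) _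
  · intro i j L hij
    have n1 : lo i ≠ lo j := hij ▸ lo_ne_hi i
    have n3 : lo i ≠ hi j := fun h' => by
      have e1 := congrArg Fin.val hij
      have e2 := congrArg Fin.val h'
      simp only [lo, hi] at e1 e2
      omega
    have s1 : simple i (lo i) = lo j := hij ▸ simple_lo i
    have s2 : simple i (lo j) = lo i := hij ▸ simple_hi i
    have s3 : simple i (hi j) = hi j :=
      Equiv.swap_apply_of_ne_of_ne n3.symm (hij ▸ (lo_ne_hi j).symm)
    have t1 : simple j (lo i) = lo i := Equiv.swap_apply_of_ne_of_ne n1 n3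
    simp only [wordVal, List.map_cons, List.prod_cons, simple_mul_inv_apply, hij, s1, s2, s3, t1,
      simple_lo, simple_hi]
    set u := (L.map simple).prod
    have key := demazure_braid τ hij (a := wt (u⁻¹ (lo i)) - wt (u⁻¹ (lo j)))
      (b := wt (u⁻¹ (lo j)) - wt (u⁻¹ (hi j))) (h.isParameter_sub _ _) (h.isParameter_sub _ _)
      (h.sub_ne_zero (u⁻¹.injective.ne n1)) (h.sub_ne_zero (u⁻¹.injective.ne (lo_ne_hi j)))
      (by
        rw [sub_add_sub_cancel]
        exact h.sub_ne_zero (u⁻¹.injective.ne n3)) (wordVal τ wt f L)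
    rw [sub_add_sub_cancel] at key
    exact key

theorem wordVal_append_singleton (τ : UpperHalfPlane) (wt : Fin m → Var m r → ℤ)
    (f : Mero (Var m r)) (L : List (Fin (m - 1))) (j : Fin (m - 1)) :
    wordVal τ wt f (L ++ [j]) =
      wordVal τ (fun p => wt (simple j p)) (demazure τ j (wt (lo j) - wt (hi j)) f) L := by
  induction L with
  | nil => rfl
  | cons i L ih =>
    have e : ∀ p, ((L ++ [j]).map simple).prod⁻¹ p = simple j ((L.map simple).prod⁻¹ p) := by
      intro p
      rw [List.map_append, List.prod_append, List.map_singleton, List.prod_singleton, mul_inv_rev,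
        simple_inv, Equiv.Perm.mul_apply]
    rw [List.cons_append, wordVal, wordVal, ih, e, e]

theorem permMu_wordVal (τ : UpperHalfPlane) (σ : Equiv.Perm (Fin r)) (wt : Fin m → Var m r → ℤ)
    (f : Mero (Var m r)) (L : List (Fin (m - 1))) :
    permMu (m := m) σ (wordVal τ wt f L) =
      wordVal τ (fun p => formMu σ (wt p)) (permMu (m := m) σ f) L := by
  induction L with
  | nil => rfl
  | cons i L ih =>
    rw [wordVal, permMu_demazure, ih, formMu_sub]
    rfl

/-! ### Types of elliptic classes -/

/-- The type of the elliptic class of a link pattern whose nodes have the weights `wt`, up to the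
part `u ρ`, which permutations of the nodes leave alone: the coefficient of `x_p` is
`wt p - p h`. -/
def weightType (ρ : Var m r → ℤ) (wt : Fin m → Var m r → ℤ) : Matrix (Var m r) (Var m r) ℤ :=
  ∑ p : Fin m, symProd (X p) (wt p - (p : ℤ) • H) + symProd U ρ

theorem sum_symProd_of_eq_zero (i : Fin (m - 1)) (d : Fin m → Var m r → ℤ)
    (h : ∀ p, p ≠ lo i → p ≠ hi i → d p = 0) :
    ∑ p : Fin m, symProd (X p) (d p) =
      symProd (X (lo i)) (d (lo i)) + symProd (X (hi i)) (d (hi i)) :=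
  Fintype.sum_eq_add (lo i) (hi i) (lo_ne_hi i) fun p hp => by
    rw [h p hp.1 hp.2, symProd_zero_right]

theorem symProd_add_weightType {ρ : Var m r → ℤ} (i : Fin (m - 1)) (wt : Fin m → Var m r → ℤ) :
    symProd (X (hi i) - X (lo i)) (wt (lo i) - wt (hi i)) + weightType ρ wt =
      weightType ρ fun p => wt (simple i p) := by
  have h := sum_symProd_of_eq_zero i (fun p => wt (simple i p) - wt p) fun p h1 h2 => by
    rw [simple, Equiv.swap_apply_of_ne_of_ne h1 h2, sub_self]
  simp only [simple_lo, simple_hi, symProd_sub_right, Finset.sum_sub_distrib] at h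
  simp only [weightType, symProd_sub_right, symProd_sub_left, Finset.sum_sub_distrib]
  rw [sub_eq_iff_eq_add.mp h]
  abel

theorem symProd_add_weightType_submatrix {ρ : Var m r → ℤ} (hρ : IsParameter ρ) (i : Fin (m - 1))
    {wt : Fin m → Var m r → ℤ} (hwt : ∀ p, IsParameter (wt p)) :
    symProd (X (lo i) - X (hi i)) H + (weightType ρ wt).submatrix
        (Equiv.sumCongr (Equiv.sumCongr (simple i) (Equiv.refl _)) (Equiv.refl _)).symm
        (Equiv.sumCongr (Equiv.sumCongr (simple i) (Equiv.refl _)) (Equiv.refl _)).symm =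
      weightType ρ fun p => wt (simple i p) := by
  have e : ∀ M : Fin m → Matrix (Var m r) (Var m r) ℤ, ∀ N : Matrix (Var m r) (Var m r) ℤ,
      ∀ π : Var m r → Var m r,
      (∑ p, M p + N).submatrix π π = ∑ p, (M p).submatrix π π + N.submatrix π π := by
    intro M N π
    ext v w
    simp [Matrix.sum_apply]
  have e1 : ∀ a b : Var m r → ℤ, (symProd a b).submatrix
        (Equiv.sumCongr (Equiv.sumCongr (simple i) (Equiv.refl _)) (Equiv.refl _)).symm
        (Equiv.sumCongr (Equiv.sumCongr (simple i) (Equiv.refl _)) (Equiv.refl _)).symm =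
      symProd (formX (simple i) a) (formX (simple i) b) := fun _ _ => rfl
  have hs : ∑ p : Fin m, symProd (X (simple i p)) (wt p - (p : ℤ) • H) =
      ∑ p : Fin m, symProd (X p) (wt (simple i p) - ((simple i p : Fin m) : ℤ) • H : Var m r → ℤ) :=
    Fintype.sum_equiv (simple i) _ _ fun p => by
      rw [← Equiv.Perm.mul_apply, simple_mul_self, Equiv.Perm.one_apply]
  have h := sum_symProd_of_eq_zero i
    (fun p => ((p : ℤ) - ((simple i p : Fin m) : ℤ)) • (H : Var m r → ℤ)) fun p h1 h2 => by
      rw [simple, Equiv.swap_apply_of_ne_of_ne h1 h2, sub_self, zero_smul]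
  have hlt : ((hi i : Fin m) : ℤ) = ((lo i : Fin m) : ℤ) + 1 := rfl
  rw [simple_lo, simple_hi, hlt] at h
  simp only [sub_smul, symProd_sub_right, Finset.sum_sub_distrib, add_smul, one_smul,
    symProd_add_right] at h
  rw [weightType, e]
  simp only [e1, formX_X, formX_U, hρ.formX, ((hwt _).sub (isParameter_H.zsmul _)).formX]
  rw [hs]
  simp only [weightType, symProd_sub_right, symProd_sub_left, Finset.sum_sub_distrib]
  rw [sub_eq_iff_eq_add.mp h]
  abel

theorem HasType.demazure {τ : UpperHalfPlane} {ρ : Var m r → ℤ} (hρ : IsParameter ρ)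
    {wt : Fin m → Var m r → ℤ} (hwt : ∀ p, IsParameter (wt p)) {f : Mero (Var m r)}
    (hf : HasType τ f (weightType ρ wt)) (i : Fin (m - 1)) :
    HasType τ (demazure τ i (wt (lo i) - wt (hi i)) f) (weightType ρ fun p => wt (simple i p)) := by
  have h1 := (hasType_delta τ (X (hi i) - X (lo i)) (wt (lo i) - wt (hi i))).mul hf
  have h2 := (hasType_delta τ (X (lo i) - X (hi i)) (H : Var m r → ℤ)).mul
    (hf.rename (Equiv.sumCongr (Equiv.sumCongr (simple i) (Equiv.refl _)) (Equiv.refl _)))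
  rw [symProd_add_weightType] at h1
  rw [symProd_add_weightType_submatrix hρ i hwt] at h2
  exact h1.add h2

theorem hasType_wordVal {τ : UpperHalfPlane} {ρ : Var m r → ℤ} (hρ : IsParameter ρ)
    {wt : Fin m → Var m r → ℤ} (hwt : ∀ p, IsParameter (wt p)) {f : Mero (Var m r)}
    (hf : HasType τ f (weightType ρ wt)) (L : List (Fin (m - 1))) :
    HasType τ (wordVal τ wt f L) (weightType ρ fun p => wt ((L.map simple).prod⁻¹ p)) := by
  induction L with
  | nil => simpa [wordVal] using hf
  | cons i L ih =>
    have h := ih.demazure hρ (fun p => hwt _) i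
    rw [wordVal]
    simpa only [List.map_cons, List.prod_cons, simple_mul_inv_apply] using h

theorem permX_ne_zero (w : Equiv.Perm (Fin m)) {f : Mero (Var m r)} (hf : f ≠ 0) :
    permX (r := r) w f ≠ 0 := by
  intro h
  have h' := congrArg (permX (r := r) w⁻¹) h
  rw [permX_permX, inv_mul_cancel, permX_one, RingHom.map_zero] at h'
  exact hf h'

/-- The admissible parameter for a section of type `weightType ρ wt` is the difference of the
weights: the two summands of a pure value have the same type. -/
theorem diamondStep_iff {τ : UpperHalfPlane} {ρ : Var m r → ℤ} (hρ : IsParameter ρ)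
    {wt : Fin m → Var m r → ℤ} (hwt : IsWeight wt) {f g : Mero (Var m r)}
    (hf : HasType τ f (weightType ρ wt)) (i : Fin (m - 1)) :
    DiamondStep τ i f g ↔ g = demazure τ i (wt (lo i) - wt (hi i)) f := by
  constructor
  · rintro ⟨ν, hν, hν0, rfl, hp⟩
    by_cases h0 : f = 0
    · subst h0
      simp only [LinkPattern.demazure, RingHom.map_zero, mul_zero]
    have hne : ∀ p q : Fin m, p ≠ q → ∀ ν : Var m r → ℤ, IsParameter ν →
        (X p - X q + ν : Var m r → ℤ) ≠ 0 := by
      intro p q hpq ν hν h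
      have := congrFun h (Sum.inl (Sum.inl p))
      simp [X_apply, hpq, hν.1] at this
    have h1 := (hasType_delta τ (X (hi i) - X (lo i)) ν).mul hf
    have h2 := (hasType_delta τ (X (lo i) - X (hi i)) (H : Var m r → ℤ)).mul
      (hf.rename (Equiv.sumCongr (Equiv.sumCongr (simple i) (Equiv.refl _)) (Equiv.refl _)))
    have hA : delta τ (X (hi i) - X (lo i)) ν * f ≠ 0 := mul_ne_zero
      (delta_ne_zero τ (X_sub_X_ne_zero (lo_ne_hi i).symm) hν0 (hne _ _ (lo_ne_hi i).symm _ hν)) h0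
    have hB : delta τ (X (lo i) - X (hi i)) H * permX (r := r) (simple i) f ≠ 0 := mul_ne_zero
      (delta_ne_zero τ (X_sub_X_ne_zero (lo_ne_hi i)) H_ne_zero
        (hne _ _ (lo_ne_hi i) _ isParameter_H)) (permX_ne_zero _ h0)
    rw [LinkPattern.demazure] at hp
    have h3 := h1.eq_of_isPure_add h2 hA hB hp
    rw [symProd_add_weightType_submatrix hρ i hwt.isParameter, ← symProd_add_weightType] at h3
    have h4 := add_right_cancel h3
    congr 1
    funext v
    have hpar := hwt.isParameter_sub (lo i) (hi i)
    by_cases hv : ∃ p : Fin m, v = Sum.inl (Sum.inl p)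
    · obtain ⟨p, rfl⟩ := hv
      rw [hν.1, hpar.1]
    · have hX : ∀ p : Fin m, (X p : Var m r → ℤ) v = 0 := fun p =>
        Pi.single_eq_of_ne (fun h => hv ⟨p, h⟩) _
      have h5 := congrFun (congrFun h4 (Sum.inl (Sum.inl (hi i)))) v
      simpa [symProd_apply, X_apply, (lo_ne_hi i).symm, hX] using h5
  · rintro rfl
    exact ⟨_, hwt.isParameter_sub _ _, hwt.sub_ne_zero (lo_ne_hi i), rfl, _,
      hf.demazure hρ hwt.isParameter i⟩

theorem diamondWord_iff {τ : UpperHalfPlane} {ρ : Var m r → ℤ} (hρ : IsParameter ρ)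
    {wt : Fin m → Var m r → ℤ} (hwt : IsWeight wt) {f : Mero (Var m r)}
    (hf : HasType τ f (weightType ρ wt)) (L : List (Fin (m - 1))) (g : Mero (Var m r)) :
    DiamondWord τ L f g ↔ g = wordVal τ wt f L := by
  induction L generalizing g with
  | nil => rfl
  | cons i L ih =>
    have h := hasType_wordVal hρ hwt.isParameter hf L
    have hs := fun g => diamondStep_iff (g := g) hρ (hwt.comp (L.map simple).prod⁻¹) h i
    constructor
    · rintro ⟨g', h1, h2⟩
      rw [ih] at h1
      subst h1
      exact (hs g).mp h2
    · intro hg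
      exact ⟨wordVal τ wt f L, (ih _).mpr rfl, (hs g).mpr hg⟩

theorem isDiamond_wordVal {τ : UpperHalfPlane} {ρ : Var m r → ℤ} (hρ : IsParameter ρ)
    {wt : Fin m → Var m r → ℤ} (hwt : IsWeight wt) {f : Mero (Var m r)}
    (hf : HasType τ f (weightType ρ wt)) {L : List (Fin (m - 1))} {w : Equiv.Perm (Fin m)}
    (hL : IsReducedWord L w) : IsDiamond τ w f (wordVal τ wt f L) := by
  refine ⟨⟨L, hL⟩, fun L' hL' g => ?_⟩
  rw [diamondWord_iff hρ hwt hf, wordVal_eq τ hwt f hL' hL]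

end WordVal

/-! ### The minimal link pattern and its weights -/

/-- The weights of the nodes of the minimal link pattern. With nodes counted from `1`, these are
`μ_i + r h` at the target of the arrow `i`, `k h` at an isolated node `k`, and `-μ_i + (m-r+1) h` at
the source of the arrow `i`, up to the common summand `h`. -/
def minWeight (m r : ℕ) (p : Fin m) : Var m r → ℤ :=
  if h : (p : ℕ) < r then Mu ⟨p, h⟩ + ((r : ℤ) - 1) • H
  else if h' : (p : ℕ) < m - r then (p : ℤ) • H
  else -Mu ⟨p - (m - r), by have := p.2; omega⟩ + ((m - r : ℕ) : ℤ) • H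

section MinPattern

variable {m r : ℕ}

/-- The target of the `i`-th arrow of the minimal link pattern. -/
def tgt (hm : 2 * r ≤ m) (i : Fin r) : Fin m := ⟨i, by have := i.2; omega⟩

/-- The source of the `i`-th arrow of the minimal link pattern. -/
def src (_ : 2 * r ≤ m) (i : Fin r) : Fin m := ⟨m - r + i, by have := i.2; omega⟩

/-- The simple transposition of the targets of the arrows `j`, `j + 1`, as an index. -/
def tgtIdx (hm : 2 * r ≤ m) (j : Fin (r - 1)) : Fin (m - 1) := ⟨j, by have := j.2; omega⟩

/-- The simple transposition of the sources of the arrows `j`, `j + 1`, as an index. -/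
def srcIdx (_ : 2 * r ≤ m) (j : Fin (r - 1)) : Fin (m - 1) :=
  ⟨m - r + j, by have := j.2; omega⟩

variable (hm : 2 * r ≤ m)

theorem lo_tgtIdx (j : Fin (r - 1)) : lo (tgtIdx hm j) = tgt hm (lo j) := rfl

theorem hi_tgtIdx (j : Fin (r - 1)) : hi (tgtIdx hm j) = tgt hm (hi j) := rfl

theorem lo_srcIdx (j : Fin (r - 1)) : lo (srcIdx hm j) = src hm (lo j) := rfl

theorem hi_srcIdx (j : Fin (r - 1)) : hi (srcIdx hm j) = src hm (hi j) := rfl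

theorem tgt_injective : Function.Injective (tgt hm) := fun i i' h => by
  simpa [tgt, Fin.ext_iff] using h

theorem src_injective : Function.Injective (src hm) := fun i i' h => by
  simpa [src, Fin.ext_iff] using h

theorem tgt_ne_src (i i' : Fin r) : tgt hm i ≠ src hm i' := fun h => by
  have := congrArg Fin.val h
  have := i.2
  simp only [tgt, src] at *
  omega

theorem exists_of_node (p : Fin m) :
    (∃ i, p = tgt hm i) ∨ (∃ i, p = src hm i) ∨ (r ≤ (p : ℕ) ∧ (p : ℕ) < m - r) := by
  by_cases h : (p : ℕ) < r
  · exact Or.inl ⟨⟨p, h⟩, rfl⟩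
  by_cases h' : (p : ℕ) < m - r
  · exact Or.inr (Or.inr ⟨not_lt.mp h, h'⟩)
  · have hp := p.2
    exact Or.inr (Or.inl ⟨⟨p - (m - r), by omega⟩, Fin.ext (by simp only [src]; omega)⟩)

theorem ne_src_of_middle {p : Fin m} (hp : r ≤ (p : ℕ) ∧ (p : ℕ) < m - r) (i : Fin r) :
    p ≠ src hm i := fun h => by
  have := congrArg Fin.val h
  simp only [src] at this
  omega

theorem ne_tgt_of_middle {p : Fin m} (hp : r ≤ (p : ℕ) ∧ (p : ℕ) < m - r) (i : Fin r) :
    p ≠ tgt hm i := fun h => by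
  have := congrArg Fin.val h
  have := i.2
  simp only [tgt] at *
  omega

theorem simple_tgtIdx_tgt (j : Fin (r - 1)) (i : Fin r) :
    simple (tgtIdx hm j) (tgt hm i) = tgt hm (simple j i) := by
  rw [simple, simple, (tgt_injective hm).map_swap]
  rfl

theorem simple_srcIdx_src (j : Fin (r - 1)) (i : Fin r) :
    simple (srcIdx hm j) (src hm i) = src hm (simple j i) := by
  rw [simple, simple, (src_injective hm).map_swap]
  rfl

theorem simple_tgtIdx_of_ne (j : Fin (r - 1)) {p : Fin m} (h : ∀ i, p ≠ tgt hm i) :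
    simple (tgtIdx hm j) p = p :=
  Equiv.swap_apply_of_ne_of_ne (h (lo j)) (h (hi j))

theorem simple_srcIdx_of_ne (j : Fin (r - 1)) {p : Fin m} (h : ∀ i, p ≠ src hm i) :
    simple (srcIdx hm j) p = p :=
  Equiv.swap_apply_of_ne_of_ne (h (lo j)) (h (hi j))

theorem minWeight_tgt (i : Fin r) : minWeight m r (tgt hm i) = Mu i + ((r : ℤ) - 1) • H := by
  rw [minWeight, dif_pos (show ((tgt hm i : Fin m) : ℕ) < r from i.2)]
  rfl

theorem minWeight_src (i : Fin r) :
    minWeight m r (src hm i) = -Mu i + ((m - r : ℕ) : ℤ) • H := by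
  have h1 : ((src hm i : Fin m) : ℕ) = m - r + i := rfl
  rw [minWeight, dif_neg (by omega), dif_neg (by omega)]
  congr 3
  exact Fin.ext (by simp [h1])

theorem minWeight_middle {p : Fin m} (hp : r ≤ (p : ℕ) ∧ (p : ℕ) < m - r) :
    minWeight m r p = (p : ℤ) • H := by
  rw [minWeight, dif_neg (by omega), dif_pos hp.2]

theorem H_apply_mu (i : Fin r) : (H : Var m r → ℤ) (Sum.inl (Sum.inr i)) = 0 := by simp [H]

theorem IsParameter.neg {ν : Var m r → ℤ} (h : IsParameter ν) : IsParameter (-ν) :=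
  ⟨fun i => by simp [h.1], by simp [h.2]⟩

theorem isWeight_minWeight (hm : 2 * r ≤ m) : IsWeight (minWeight m r) where
  isParameter p := by
    rcases exists_of_node hm p with ⟨i, rfl⟩ | ⟨i, rfl⟩ | hp
    · rw [minWeight_tgt]
      exact (isParameter_Mu i).add (isParameter_H.zsmul _)
    · rw [minWeight_src]
      exact (isParameter_Mu i).neg.add (isParameter_H.zsmul _)
    · rw [minWeight_middle hp]
      exact isParameter_H.zsmul _
  injective p p' h := by
    -- The coefficients of the `μ_i` tell whether a node is the target or the source of an arrow.
    have hμ : ∀ i, minWeight m r p (Sum.inl (Sum.inr i)) = minWeight m r p' (Sum.inl (Sum.inr i)) :=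
      fun i => congrFun h _
    have ht : ∀ i i', minWeight m r (tgt hm i) (Sum.inl (Sum.inr i')) = if i' = i then 1 else 0 :=
      fun i i' => by simp [minWeight_tgt, Mu_apply, H_apply_mu]
    have hs : ∀ i i', minWeight m r (src hm i) (Sum.inl (Sum.inr i')) = -if i' = i then 1 else 0 :=
      fun i i' => by simp [minWeight_src, Mu_apply, H_apply_mu]
    have h0 : ∀ {p : Fin m}, (r ≤ (p : ℕ) ∧ (p : ℕ) < m - r) → ∀ i',
        minWeight m r p (Sum.inl (Sum.inr i')) = 0 :=
      fun hp i' => by simp [minWeight_middle hp, H_apply_mu]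
    rcases exists_of_node hm p with ⟨i, rfl⟩ | ⟨i, rfl⟩ | hp <;>
      rcases exists_of_node hm p' with ⟨i', rfl⟩ | ⟨i', rfl⟩ | hp'
    · have := hμ i
      rw [ht, ht] at this
      grind
    · have := hμ i
      rw [ht, hs] at this
      grind
    · have := hμ i
      rw [ht, h0 hp'] at this
      grind
    · have := hμ i
      rw [ht, hs] at this
      grind
    · have := hμ i
      rw [hs, hs] at this
      grind
    · have := hμ i
      rw [hs, h0 hp'] at this
      grind
    · have := hμ i'
      rw [ht, h0 hp] at this
      grind
    · have := hμ i'
      rw [hs, h0 hp] at this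
      grind
    · have hh := congrFun h (Sum.inr true)
      rw [minWeight_middle hp, minWeight_middle hp'] at hh
      simp only [Pi.smul_apply, H_apply, smul_eq_mul, mul_one] at hh
      exact Fin.ext (by exact_mod_cast hh)

/-! ### The type of the elliptic class of the minimal link pattern -/

theorem symProd_zsmul_right {ι : Type} (a b : ι → ℤ) (n : ℤ) :
    symProd a (n • b) = n • symProd a b := by
  ext v w
  simp only [symProd_apply, Pi.smul_apply, Matrix.smul_apply, smul_eq_mul]
  ring

theorem symProd_neg_right {ι : Type} (a b : ι → ℤ) : symProd a (-b) = -symProd a b := by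
  ext v w
  simp only [symProd_apply, Pi.neg_apply, Matrix.neg_apply]
  ring

/-- The nodes to the right of a source are the sources of the later arrows. -/
theorem filter_src_lt (i : Fin r) :
    (Finset.univ.filter fun p : Fin m => src hm i < p) =
      (Finset.univ.filter fun i' : Fin r => i < i').image (src hm) := by
  ext p
  rw [Finset.mem_filter_univ, Finset.mem_image]
  constructor
  · intro h
    rcases exists_of_node hm p with ⟨i', rfl⟩ | ⟨i', rfl⟩ | hp
    · have := Fin.lt_def.mp h
      have := i'.2
      simp only [src, tgt] at *
      omega
    · refine ⟨i', ?_, rfl⟩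
      rw [Finset.mem_filter_univ]
      rw [Fin.lt_def] at h ⊢
      exact lt_of_add_lt_add_left h
    · have := Fin.lt_def.mp h
      simp only [src] at this
      omega
  · rintro ⟨i', hi', rfl⟩
    rw [Finset.mem_filter_univ] at hi'
    rw [Fin.lt_def] at hi' ⊢
    exact Nat.add_lt_add_left hi' _

theorem card_filter_gt (i : Fin r) :
    (((Finset.univ.filter fun i' : Fin r => i < i').card : ℕ) : ℤ) = (r : ℤ) - 1 - (i : ℕ) := by
  have h : (Finset.univ.filter fun i' : Fin r => i < i') = Finset.Ioi i := by
    ext i'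
    rw [Finset.mem_filter_univ, Finset.mem_Ioi]
  have := i.2
  rw [h, Fin.card_Ioi]
  omega

theorem card_filter_lt (i : Fin r) :
    (Finset.univ.filter fun i' : Fin r => i' < i).card = (i : ℕ) := by
  have h : (Finset.univ.filter fun i' : Fin r => i' < i) = Finset.Iio i := by
    ext i'
    rw [Finset.mem_filter_univ, Finset.mem_Iio]
  rw [h, Fin.card_Iio]

theorem sum_symProd_minWeight :
    ∑ p : Fin m, symProd (X p) (minWeight m r p - (p : ℤ) • H) =
      ∑ i : Fin r, symProd (X (tgt hm i)) (minWeight m r (tgt hm i) - (i : ℤ) • H) +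
      ∑ i : Fin r, symProd (X (src hm i))
        (minWeight m r (src hm i) - (((m - r : ℕ) : ℤ) + (i : ℤ)) • H) := by
  symm
  refine (Fintype.sum_sum_type (Sum.elim
    (fun i : Fin r => symProd (X (tgt hm i)) (minWeight m r (tgt hm i) - (i : ℤ) • H))
    (fun i : Fin r => symProd (X (src hm i))
      (minWeight m r (src hm i) - (((m - r : ℕ) : ℤ) + (i : ℤ)) • H)))).symm.trans ?_
  apply Fintype.sum_of_injective (Sum.elim (tgt hm) (src hm))
  · exact Function.Injective.sumElim (tgt_injective hm) (src_injective hm) (tgt_ne_src hm)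
  · intro p hp
    rcases exists_of_node hm p with ⟨i, rfl⟩ | ⟨i, rfl⟩ | hp'
    · exact absurd ⟨Sum.inl i, rfl⟩ hp
    · exact absurd ⟨Sum.inr i, rfl⟩ hp
    · rw [minWeight_middle hp', sub_self, symProd_zero_right]
  · rintro (i | i)
    · rfl
    · simp [src]

theorem hasType_ellMin (τ : UpperHalfPlane) :
    HasType τ (ellMin τ hm)
      (weightType (∑ i : Fin r, (Mu i + ((r : ℤ) - 1 - (i : ℕ)) • H)) (minWeight m r)) := by
  have h : HasType τ (ellMin τ hm) (∑ i : Fin r,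
      (symProd (U + X (tgt hm i) - X (src hm i)) (Mu i) +
        ∑ p ∈ Finset.univ.filter (fun p : Fin m => src hm i < p),
          symProd (U + X (tgt hm i) - X p) H)) :=
    HasType.prod fun i _ => (hasType_delta τ _ _).mul (HasType.prod fun p _ => hasType_delta τ _ _)
  convert h using 1
  have hs : ∑ i : Fin r, ∑ i' ∈ Finset.univ.filter (fun i' : Fin r => i < i'),
        symProd (X (src hm i')) (H : Var m r → ℤ) =
      ∑ i : Fin r, (i : ℤ) • symProd (X (src hm i)) (H : Var m r → ℤ) := by
    rw [Finset.sum_comm' (t' := Finset.univ)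
      (s' := fun i' => Finset.univ.filter fun i : Fin r => i < i') (by simp)]
    refine Finset.sum_congr rfl fun i _ => ?_
    rw [Finset.sum_const, card_filter_lt, natCast_zsmul]
  have hin : ∀ i : Fin r, ∑ p ∈ Finset.univ.filter (fun p : Fin m => src hm i < p),
        symProd (U + X (tgt hm i) - X p) (H : Var m r → ℤ) =
      ((r : ℤ) - 1 - (i : ℕ)) • symProd (U + X (tgt hm i)) H -
        ∑ i' ∈ Finset.univ.filter (fun i' : Fin r => i < i'), symProd (X (src hm i')) H := by
    intro i
    rw [filter_src_lt, Finset.sum_image (src_injective hm).injOn]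
    simp only [symProd_sub_left (U + X (tgt hm i)), Finset.sum_sub_distrib]
    rw [Finset.sum_const, ← natCast_zsmul, card_filter_gt]
  rw [weightType, sum_symProd_minWeight hm, symProd_sum_right]
  simp only [hin, minWeight_tgt, minWeight_src]
  rw [Finset.sum_add_distrib, Finset.sum_sub_distrib, hs, ← Finset.sum_sub_distrib]
  simp only [← Finset.sum_add_distrib]
  refine Finset.sum_congr rfl fun i _ => ?_
  simp only [symProd_sub_left, symProd_add_left, symProd_sub_right, symProd_add_right,
    symProd_zsmul_right, symProd_neg_right]
  module

theorem isParameter_sum {κ : Type*} (s : Finset κ) {ν : κ → Var m r → ℤ}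
    (h : ∀ i ∈ s, IsParameter (ν i)) : IsParameter (∑ i ∈ s, ν i) := by
  refine ⟨fun p => ?_, ?_⟩
  · rw [Finset.sum_apply]
    exact Finset.sum_eq_zero fun i hi => (h i hi).1 p
  · rw [Finset.sum_apply]
    exact Finset.sum_eq_zero fun i hi => (h i hi).2

/-- The value of the elliptic Demazure operation of a permutation at the elliptic class of the
minimal link pattern. -/
def ellOf (τ : UpperHalfPlane) (w : Equiv.Perm (Fin m)) : Mero (Var m r) :=
  wordVal τ (minWeight m r) (ellMin τ hm) (exists_reducedWord w).choose

theorem isDiamond_ellOf (τ : UpperHalfPlane) (w : Equiv.Perm (Fin m)) :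
    IsDiamond τ w (ellMin τ hm) (ellOf hm τ w) :=
  isDiamond_wordVal
    (isParameter_sum _ fun i _ => (isParameter_Mu i).add (isParameter_H.zsmul _))
    (isWeight_minWeight hm) (hasType_ellMin hm τ) (exists_reducedWord w).choose_spec

theorem ellOf_eq (τ : UpperHalfPlane) {w : Equiv.Perm (Fin m)} {L : List (Fin (m - 1))}
    (hL : IsReducedWord L w) : ellOf hm τ w = wordVal τ (minWeight m r) (ellMin τ hm) L :=
  wordVal_eq τ (isWeight_minWeight hm) _ (exists_reducedWord w).choose_spec hL

end MinPattern

/-! ### Exchanging two neighbouring arrows -/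

section Exchange

variable {m r : ℕ}

/-- The factors `∏_{k > b} δ(u x_a / x_k, h)` of the elliptic class of the minimal link pattern. -/
def tailProd (τ : UpperHalfPlane) (a b : Fin m) : Mero (Var m r) :=
  ∏ k ∈ Finset.univ.filter (fun k : Fin m => b < k), delta τ (U + X a - X k) H

theorem lt_simple_iff {k : Fin (m - 1)} {b : Fin m} (hb : b ≠ lo k) (p : Fin m) :
    b < simple k p ↔ b < p := by
  have hlt : (hi k : ℕ) = (lo k : ℕ) + 1 := rfl
  have hb' : (b : ℕ) ≠ lo k := fun h => hb (Fin.ext h)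
  by_cases h1 : p = lo k
  · rw [h1, simple_lo, Fin.lt_def, Fin.lt_def]
    omega
  by_cases h2 : p = hi k
  · rw [h2, simple_hi, Fin.lt_def, Fin.lt_def]
    omega
  rw [simple, Equiv.swap_apply_of_ne_of_ne h1 h2]

theorem permX_tailProd (τ : UpperHalfPlane) {k : Fin (m - 1)} {b : Fin m} (hb : b ≠ lo k)
    (a : Fin m) :
    permX (r := r) (simple k) (tailProd τ a b) = tailProd τ (simple k a) b := by
  rw [tailProd, tailProd, map_prod]
  simp only [permX_delta, formX_sub, formX_add, formX_X, formX_U, isParameter_H.formX]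
  refine Finset.prod_equiv (simple k) (fun p => ?_) fun p _ => rfl
  rw [Finset.mem_filter_univ, Finset.mem_filter_univ, lt_simple_iff hb]

theorem permMu_tailProd (τ : UpperHalfPlane) (σ : Equiv.Perm (Fin r)) (a b : Fin m) :
    permMu (m := m) σ (tailProd τ a b) = tailProd τ a b := by
  rw [tailProd, map_prod]
  simp only [permMu_delta, formMu_sub, formMu_add, formMu_X, formMu_U, formMu_H]

theorem tailProd_lo (τ : UpperHalfPlane) (k : Fin (m - 1)) (a : Fin m) :
    (tailProd τ a (lo k) : Mero (Var m r)) =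
      delta τ (U + X a - X (hi k)) H * tailProd τ a (hi k) := by
  have h : (Finset.univ.filter fun p : Fin m => lo k < p) =
      insert (hi k) (Finset.univ.filter fun p : Fin m => hi k < p) := by
    ext p
    have hlt : (hi k : ℕ) = (lo k : ℕ) + 1 := rfl
    rw [Finset.mem_insert, Finset.mem_filter_univ, Finset.mem_filter_univ, Fin.ext_iff, Fin.lt_def,
      Fin.lt_def]
    omega
  rw [tailProd, h, Finset.prod_insert (by
    rw [Finset.mem_filter_univ]
    exact lt_irrefl _)]
  rfl

variable (hm : 2 * r ≤ m)

/-- The factors of the elliptic class of the minimal link pattern that are unchanged when the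
arrows `j` and `j + 1` exchange their sources, targets or labels. -/
def restProd (τ : UpperHalfPlane) (j : Fin (r - 1)) : Mero (Var m r) :=
  tailProd τ (tgt hm (lo j)) (src hm (hi j)) * tailProd τ (tgt hm (hi j)) (src hm (hi j)) *
    ∏ i ∈ ({lo j, hi j} : Finset (Fin r))ᶜ,
      (delta τ (U + X (tgt hm i) - X (src hm i)) (Mu i) * tailProd τ (tgt hm i) (src hm i))

theorem ellMin_eq_mul_restProd (τ : UpperHalfPlane) (j : Fin (r - 1)) :
    ellMin τ hm =
      delta τ (U + X (tgt hm (lo j)) - X (src hm (lo j))) (Mu (lo j)) *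
        delta τ (U + X (tgt hm (lo j)) - X (src hm (hi j))) H *
        delta τ (U + X (tgt hm (hi j)) - X (src hm (hi j))) (Mu (hi j)) * restProd hm τ j := by
  have h : ellMin τ hm = ∏ i : Fin r,
      (delta τ (U + X (tgt hm i) - X (src hm i)) (Mu i) * tailProd τ (tgt hm i) (src hm i)) := rfl
  have h' := tailProd_lo (r := r) τ (srcIdx hm j) (tgt hm (lo j))
  rw [lo_srcIdx, hi_srcIdx] at h'
  rw [h, ← Finset.prod_mul_prod_compl {lo j, hi j}, Finset.prod_pair (lo_ne_hi j), restProd, h']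
  ring

theorem mem_compl_pair {j : Fin (r - 1)} {i : Fin r} :
    i ∈ ({lo j, hi j} : Finset (Fin r))ᶜ ↔ i ≠ lo j ∧ i ≠ hi j := by
  rw [Finset.mem_compl, Finset.mem_insert, Finset.mem_singleton, not_or]

theorem simple_tgtIdx_src (j : Fin (r - 1)) (i : Fin r) :
    simple (tgtIdx hm j) (src hm i) = src hm i :=
  simple_tgtIdx_of_ne hm j fun i' => (tgt_ne_src hm i' i).symm

theorem simple_srcIdx_tgt (j : Fin (r - 1)) (i : Fin r) :
    simple (srcIdx hm j) (tgt hm i) = tgt hm i :=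
  simple_srcIdx_of_ne hm j fun i' => tgt_ne_src hm i i'

theorem permX_tgtIdx_restProd (τ : UpperHalfPlane) (j : Fin (r - 1)) :
    permX (r := r) (simple (tgtIdx hm j)) (restProd hm τ j) = restProd hm τ j := by
  have hs : ∀ i, src hm i ≠ lo (tgtIdx hm j) := fun i => (tgt_ne_src hm (lo j) i).symm
  rw [restProd, RingHom.map_mul, RingHom.map_mul, permX_tailProd τ (hs _), permX_tailProd τ (hs _),
    map_prod, simple_tgtIdx_tgt, simple_tgtIdx_tgt, simple_lo, simple_hi]
  rw [mul_comm (tailProd τ (tgt hm (hi j)) (src hm (hi j)))]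
  congr 1
  refine Finset.prod_congr rfl fun i hi' => ?_
  rw [mem_compl_pair] at hi'
  rw [RingHom.map_mul, permX_tailProd τ (hs _), permX_delta, formX_sub, formX_add, formX_X, formX_X,
    formX_U, (isParameter_Mu i).formX, simple_tgtIdx_src, simple_tgtIdx_tgt, simple,
    Equiv.swap_apply_of_ne_of_ne hi'.1 hi'.2]

theorem permX_srcIdx_restProd (τ : UpperHalfPlane) (j : Fin (r - 1)) :
    permX (r := r) (simple (srcIdx hm j)) (restProd hm τ j) = restProd hm τ j := by
  have hs : ∀ i, i ≠ lo j → src hm i ≠ lo (srcIdx hm j) := fun i hi' => (src_injective hm).ne hi'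
  rw [restProd, RingHom.map_mul, RingHom.map_mul, permX_tailProd τ (hs _ (lo_ne_hi j).symm),
    permX_tailProd τ (hs _ (lo_ne_hi j).symm), map_prod, simple_srcIdx_tgt, simple_srcIdx_tgt]
  congr 1
  refine Finset.prod_congr rfl fun i hi' => ?_
  rw [mem_compl_pair] at hi'
  rw [RingHom.map_mul, permX_tailProd τ (hs _ hi'.1), permX_delta, formX_sub, formX_add, formX_X,
    formX_X, formX_U, (isParameter_Mu i).formX, simple_srcIdx_src, simple_srcIdx_tgt, simple,
    Equiv.swap_apply_of_ne_of_ne hi'.1 hi'.2]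

theorem permMu_restProd (τ : UpperHalfPlane) (j : Fin (r - 1)) :
    permMu (m := m) (simple j) (restProd hm τ j) = restProd hm τ j := by
  rw [restProd, RingHom.map_mul, RingHom.map_mul, permMu_tailProd, permMu_tailProd, map_prod]
  congr 1
  refine Finset.prod_congr rfl fun i hi' => ?_
  rw [mem_compl_pair] at hi'
  rw [RingHom.map_mul, permMu_tailProd, permMu_delta, formMu_sub, formMu_add, formMu_X, formMu_X,
    formMu_U, formMu_Mu, simple, Equiv.swap_apply_of_ne_of_ne hi'.1 hi'.2]

theorem Mu_ne_zero (i : Fin r) : (Mu i : Var m r → ℤ) ≠ 0 := fun h => by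
  have := congrFun h (Sum.inl (Sum.inr i))
  simp [Mu_apply] at this

theorem Mu_sub_Mu_ne_zero {i i' : Fin r} (h : i ≠ i') : (Mu i - Mu i' : Var m r → ℤ) ≠ 0 :=
  fun h0 => by
    have := congrFun h0 (Sum.inl (Sum.inr i))
    simp [Mu_apply, h] at this

theorem U_add_X_sub_X_ne_zero (p q : Fin m) : (U + X p - X q : Var m r → ℤ) ≠ 0 := fun h => by
  have := congrFun h (Sum.inr false)
  simp [U, X] at this

/-- Up to a permutation of the labels, the operation at the sources and the operation at the targets
of two neighbouring arrows agree on the elliptic class of the minimal link pattern. -/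
theorem demazure_exchange (τ : UpperHalfPlane) (j : Fin (r - 1)) :
    permMu (m := m) (simple j) (demazure τ (tgtIdx hm j)
        (minWeight m r (tgt hm (lo j)) - minWeight m r (tgt hm (hi j))) (ellMin τ hm)) =
      demazure τ (srcIdx hm j)
        (minWeight m r (src hm (lo j)) - minWeight m r (src hm (hi j))) (ellMin τ hm) := by
  have key := delta_exchange τ (a := U + X (tgt hm (lo j))) (b := U + X (tgt hm (hi j)))
    (c := X (src hm (lo j))) (d := X (src hm (hi j))) (μ := Mu (hi j)) (μ' := Mu (lo j))
    (h := (H : Var m r → ℤ))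
    (by rw [add_sub_add_left_eq_sub]; exact X_sub_X_ne_zero ((tgt_injective hm).ne (lo_ne_hi j)))
    (U_add_X_sub_X_ne_zero _ _) (X_sub_X_ne_zero ((src_injective hm).ne (lo_ne_hi j)))
    (U_add_X_sub_X_ne_zero _ _) (U_add_X_sub_X_ne_zero _ _) (U_add_X_sub_X_ne_zero _ _)
    (Mu_ne_zero _) (Mu_ne_zero _) (Mu_sub_Mu_ne_zero (lo_ne_hi j).symm) H_ne_zero
  rw [add_sub_add_left_eq_sub, add_sub_add_left_eq_sub] at key
  have e1 : minWeight m r (src hm (lo j)) - minWeight m r (src hm (hi j)) =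
      Mu (hi j) - Mu (lo j) := by
    rw [minWeight_src, minWeight_src]
    abel
  have e2 : minWeight m r (tgt hm (lo j)) - minWeight m r (tgt hm (hi j)) =
      Mu (lo j) - Mu (hi j) := by
    rw [minWeight_tgt, minWeight_tgt]
    abel
  rw [e1, e2, ellMin_eq_mul_restProd hm τ j]
  simp only [demazure, RingHom.map_add, RingHom.map_mul, permX_srcIdx_restProd,
    permX_tgtIdx_restProd, permMu_restProd, permX_delta, permMu_delta, formX_sub, formX_add,
    formX_X, formX_U, (isParameter_Mu _).formX, isParameter_H.formX, formMu_sub, formMu_add,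
    formMu_X, formMu_U, formMu_Mu, formMu_H, lo_srcIdx, hi_srcIdx, lo_tgtIdx, hi_tgtIdx,
    simple_srcIdx_src, simple_srcIdx_tgt, simple_tgtIdx_src, simple_tgtIdx_tgt, simple_lo,
    simple_hi]
  linear_combination -restProd hm τ j * key

theorem formMu_zsmul (σ : Equiv.Perm (Fin r)) (n : ℤ) (c : Var m r → ℤ) :
    formMu σ (n • c) = n • formMu σ c := rfl

theorem formMu_neg (σ : Equiv.Perm (Fin r)) (c : Var m r → ℤ) :
    formMu σ (-c) = -formMu σ c := rfl

/-- Exchanging the labels of two neighbouring arrows of the minimal link pattern has the same effect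
on the weights as exchanging both their sources and their targets. -/
theorem formMu_minWeight (j : Fin (r - 1)) (p : Fin m) :
    formMu (simple j) (minWeight m r (simple (tgtIdx hm j) p)) =
      minWeight m r (simple (srcIdx hm j) p) := by
  rcases exists_of_node hm p with ⟨i, rfl⟩ | ⟨i, rfl⟩ | hp
  · rw [simple_srcIdx_tgt, simple_tgtIdx_tgt, minWeight_tgt, minWeight_tgt, formMu_add,
      formMu_zsmul, formMu_Mu, formMu_H, ← Equiv.Perm.mul_apply, simple_mul_self,
      Equiv.Perm.one_apply]
  · rw [simple_srcIdx_src, simple_tgtIdx_src, minWeight_src, minWeight_src, formMu_add,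
      formMu_zsmul, formMu_neg, formMu_Mu, formMu_H]
  · rw [simple_srcIdx_of_ne hm j (ne_src_of_middle hm hp),
      simple_tgtIdx_of_ne hm j (ne_tgt_of_middle hm hp), minWeight_middle hp, formMu_zsmul,
      formMu_H]

/-- A permutation that inverts the sources of two neighbouring arrows but not their targets can be
replaced by the one that inverts the targets but not the sources. -/
theorem ellOf_exchange (τ : UpperHalfPlane) {w : Equiv.Perm (Fin m)} {j : Fin (r - 1)}
    (ht : w (tgt hm (lo j)) < w (tgt hm (hi j))) (hs : w (src hm (hi j)) < w (src hm (lo j))) :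
    ellOf hm τ w = permMu (m := m) (simple j)
      (ellOf hm τ (w * simple (srcIdx hm j) * simple (tgtIdx hm j))) := by
  obtain ⟨K, hK⟩ := exists_reducedWord (w * simple (srcIdx hm j))
  have h1 : IsReducedWord (K ++ [srcIdx hm j]) w := by
    have h := hK.append_singleton (i := srcIdx hm j) (by
      rw [Equiv.Perm.mul_apply, Equiv.Perm.mul_apply, simple_lo, simple_hi]
      exact hs)
    rwa [mul_assoc, simple_mul_self, mul_one] at h
  have h2 : IsReducedWord (K ++ [tgtIdx hm j])
      (w * simple (srcIdx hm j) * simple (tgtIdx hm j)) := by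
    refine hK.append_singleton ?_
    rw [Equiv.Perm.mul_apply, Equiv.Perm.mul_apply, lo_tgtIdx, hi_tgtIdx, simple_srcIdx_tgt,
      simple_srcIdx_tgt]
    exact ht
  rw [ellOf_eq hm τ h1, ellOf_eq hm τ h2, wordVal_append_singleton, wordVal_append_singleton,
    permMu_wordVal, lo_tgtIdx, hi_tgtIdx, lo_srcIdx, hi_srcIdx, demazure_exchange]
  simp only [formMu_minWeight]

end Exchange

/-! ### Minimal presentations of link patterns -/

section Presentations

variable {m r : ℕ}

/-- The isolated nodes of the minimal link pattern. -/
def mid (hm : 2 * r ≤ m) (k : Fin (m - 2 * r)) : Fin m := ⟨r + k, by have := k.2; omega⟩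

/-- The simple transposition of the isolated nodes `k`, `k + 1`, as an index. -/
def midIdx (hm : 2 * r ≤ m) (k : Fin (m - 2 * r - 1)) : Fin (m - 1) :=
  ⟨r + k, by have := k.2; omega⟩

variable (hm : 2 * r ≤ m)

theorem mid_isolated (k : Fin (m - 2 * r)) : r ≤ (mid hm k : ℕ) ∧ (mid hm k : ℕ) < m - r := by
  have hk := k.2
  have h : (mid hm k : ℕ) = r + k := rfl
  omega

theorem exists_eq_mid {p : Fin m} (hp : r ≤ (p : ℕ) ∧ (p : ℕ) < m - r) : ∃ k, p = mid hm k :=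
  ⟨⟨p - r, by omega⟩, Fin.ext (by simp only [mid]; omega)⟩

variable {hm} {P : Pattern m r} {σ σ' : Equiv.Perm (Fin r)} {w w' : Equiv.Perm (Fin m)}

theorem eq_act_iff :
    P = (minPattern m r hm).act σ w ↔
      (∀ i, P.source (σ i) = w (src hm i)) ∧ ∀ i, P.target (σ i) = w (tgt hm i) := by
  rw [Pattern.ext_iff, funext_iff, funext_iff]
  refine and_congr ?_ ?_ <;>
  · refine (σ.forall_congr fun i => ?_).symm
    simp only [Pattern.act, Equiv.symm_apply_apply]
    rfl

variable (hm P) in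
theorem exists_eq_act : ∃ w, P = (minPattern m r hm).act 1 w := by
  classical
  let e := (Equiv.ofInjective _ (minPattern m r hm).distinct).symm.trans
    (Equiv.ofInjective _ P.distinct)
  have he : ∀ x, e.extendSubtype
      (Sum.elim (minPattern m r hm).source (minPattern m r hm).target x) =
        Sum.elim P.source P.target x := by
    intro x
    rw [Equiv.extendSubtype_apply_of_mem _ _ (Set.mem_range_self x)]
    have : (⟨_, Set.mem_range_self x⟩ : Set.range _) =
        Equiv.ofInjective _ (minPattern m r hm).distinct x := rfl
    simp only [e, Equiv.trans_apply]
    rw [this, Equiv.symm_apply_apply]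
    rfl
  exact ⟨e.extendSubtype, eq_act_iff.mpr
    ⟨fun i => (he (Sum.inl i)).symm, fun i => (he (Sum.inr i)).symm⟩⟩

variable (hm P) in
theorem exists_isMinimalPresentation : ∃ σ w, IsMinimalPresentation hm P σ w := by
  obtain ⟨w₀, h₀⟩ := exists_eq_act hm P
  obtain ⟨⟨σ, w⟩, h, hmin⟩ := (measure fun p : Equiv.Perm (Fin r) × Equiv.Perm (Fin m) =>
    len p.2).wf.has_min {p | P = (minPattern m r hm).act p.1 p.2} ⟨(1, w₀), h₀⟩
  exact ⟨σ, w, h, fun σ' w' h' => not_lt.mp (hmin (σ', w') h')⟩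

/-- A minimal presentation keeps the isolated nodes in order. -/
theorem IsMinimalPresentation.strictMono_mid (h : IsMinimalPresentation hm P σ w) :
    StrictMono fun k => w (mid hm k) := by
  refine strictMono_of_lo_lt_hi fun k => lt_of_not_ge fun hk => ?_
  have hk' : w (hi (midIdx hm k)) < w (lo (midIdx hm k)) :=
    lt_of_le_of_ne hk (w.injective.ne (lo_ne_hi (midIdx hm k)).symm)
  have hlen := len_mul_simple_of_gt hk'
  have hs : ∀ p, p ≠ mid hm (lo k) → p ≠ mid hm (hi k) →
      (w * simple (midIdx hm k)) p = w p := fun p h1 h2 =>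
    congrArg w (Equiv.swap_apply_of_ne_of_ne h1 h2)
  have hP := eq_act_iff.mp h.1
  have := h.2 σ (w * simple (midIdx hm k)) (eq_act_iff.mpr
    ⟨fun i => by
      rw [hP.1, hs _ (ne_src_of_middle hm (mid_isolated hm _) i).symm
        (ne_src_of_middle hm (mid_isolated hm _) i).symm],
    fun i => by
      rw [hP.2, hs _ (ne_tgt_of_middle hm (mid_isolated hm _) i).symm
        (ne_tgt_of_middle hm (mid_isolated hm _) i).symm]⟩)
  omega

/-- If a minimal presentation inverts the sources of two neighbouring arrows, then it does not
invert their targets, and exchanging the two arrows yields another minimal presentation. -/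
theorem IsMinimalPresentation.exchange (h : IsMinimalPresentation hm P σ w) {j : Fin (r - 1)}
    (hs : w (src hm (hi j)) < w (src hm (lo j))) :
    w (tgt hm (lo j)) < w (tgt hm (hi j)) ∧
      IsMinimalPresentation hm P (σ * simple j)
        (w * simple (srcIdx hm j) * simple (tgtIdx hm j)) := by
  have hP := eq_act_iff.mp h.1
  have hact : P = (minPattern m r hm).act (σ * simple j)
      (w * simple (srcIdx hm j) * simple (tgtIdx hm j)) := by
    refine eq_act_iff.mpr ⟨fun i => ?_, fun i => ?_⟩
    · rw [Equiv.Perm.mul_apply, Equiv.Perm.mul_apply, Equiv.Perm.mul_apply, simple_tgtIdx_src,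
        simple_srcIdx_src, hP.1]
    · rw [Equiv.Perm.mul_apply, Equiv.Perm.mul_apply, Equiv.Perm.mul_apply, simple_tgtIdx_tgt,
        simple_srcIdx_tgt, hP.2]
  have h1 : len (w * simple (srcIdx hm j)) + 1 = len w := len_mul_simple_of_gt hs
  have ht : w (tgt hm (lo j)) < w (tgt hm (hi j)) := by
    refine lt_of_not_ge fun hge => ?_
    have hgt := lt_of_le_of_ne hge (w.injective.ne ((tgt_injective hm).ne (lo_ne_hi j).symm))
    have h2 := len_mul_simple_of_gt (i := tgtIdx hm j) (w := w * simple (srcIdx hm j)) (by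
      rw [Equiv.Perm.mul_apply, Equiv.Perm.mul_apply, lo_tgtIdx, hi_tgtIdx, simple_srcIdx_tgt,
        simple_srcIdx_tgt]
      exact hgt)
    have := h.2 _ _ hact
    omega
  have h2 := len_mul_simple_of_lt (i := tgtIdx hm j) (w := w * simple (srcIdx hm j)) (by
    rw [Equiv.Perm.mul_apply, Equiv.Perm.mul_apply, lo_tgtIdx, hi_tgtIdx, simple_srcIdx_tgt,
      simple_srcIdx_tgt]
    exact ht)
  refine ⟨ht, hact, fun σ' w' h' => ?_⟩
  have := h.2 σ' w' h'
  omega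

theorem sum_mul_simple_lt {n : ℕ} (c : Fin n → ℕ) {j : Fin (n - 1)} (h : c (hi j) < c (lo j)) :
    ∑ i : Fin n, (n - i) * c (simple j i) < ∑ i : Fin n, (n - i) * c i := by
  have e : ∑ i : Fin n, (n - i) * c (simple j i) = ∑ i : Fin n, (n - simple j i) * c i :=
    Fintype.sum_equiv (simple j) _ _ fun i => by
      rw [← Equiv.Perm.mul_apply, simple_mul_self, Equiv.Perm.one_apply]
  have hlt : ((hi j : Fin n) : ℤ) = ((lo j : Fin n) : ℤ) + 1 := rfl
  have key : ∑ i : Fin n, (((simple j i : Fin n) : ℤ) - (i : ℤ)) * (c i : ℤ) =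
      (((simple j (lo j) : Fin n) : ℤ) - (lo j : ℤ)) * (c (lo j) : ℤ) +
        (((simple j (hi j) : Fin n) : ℤ) - (hi j : ℤ)) * (c (hi j) : ℤ) :=
    Fintype.sum_eq_add (lo j) (hi j) (lo_ne_hi j) fun i hi' => by
      rw [simple, Equiv.swap_apply_of_ne_of_ne hi'.1 hi'.2, sub_self, zero_mul]
  have hsub : ∀ i : Fin n, ((n - i : ℕ) : ℤ) = n - i := fun i => Nat.cast_sub i.2.le
  rw [simple_lo, simple_hi, hlt] at key
  rw [e]
  zify
  simp only [hsub]
  rw [← sub_pos, ← Finset.sum_sub_distrib]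
  have e2 : ∀ i : Fin n, ((n : ℤ) - i) * c i - (n - (simple j i : Fin n)) * c i =
      (((simple j i : Fin n) : ℤ) - i) * c i := fun i => by ring
  simp only [e2]
  rw [key]
  have : (c (hi j) : ℤ) < c (lo j) := by exact_mod_cast h
  linarith

/-- By exchanges of neighbouring arrows, each minimal presentation can be replaced by one that keeps
the sources in order, without a change of the resulting function. -/
theorem IsMinimalPresentation.exists_strictMono_src (τ : UpperHalfPlane)
    (h : IsMinimalPresentation hm P σ w) :
    ∃ σ' w', IsMinimalPresentation hm P σ' w' ∧ (StrictMono fun i => w' (src hm i)) ∧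
      permMu (m := m) σ (ellOf hm τ w) = permMu (m := m) σ' (ellOf hm τ w') := by
  -- Exchanging arrows with inverted sources decreases the sum of `(r - i) w(a_i)`.
  induction hn : ∑ i : Fin r, (r - i) * (w (src hm i) : ℕ) using Nat.strong_induction_on
    generalizing σ w with
  | _ n ih =>
    by_cases hs : ∀ j : Fin (r - 1), w (src hm (lo j)) < w (src hm (hi j))
    · exact ⟨σ, w, h, strictMono_of_lo_lt_hi hs, rfl⟩
    push Not at hs
    obtain ⟨j, hj⟩ := hs
    have hj' := lt_of_le_of_ne hj (w.injective.ne ((src_injective hm).ne (lo_ne_hi j).symm))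
    obtain ⟨ht, h'⟩ := h.exchange hj'
    have hlt := sum_mul_simple_lt (fun i => (w (src hm i) : ℕ)) hj'
    have e : ∀ i, (w * simple (srcIdx hm j) * simple (tgtIdx hm j)) (src hm i) =
        w (src hm (simple j i)) := fun i => by
      rw [Equiv.Perm.mul_apply, Equiv.Perm.mul_apply, simple_tgtIdx_src, simple_srcIdx_src]
    obtain ⟨σ', w', h1, h2, h3⟩ := ih _ (by rw [← hn]; exact hlt) h' (by simp only [e])
    refine ⟨σ', w', h1, h2, ?_⟩
    rw [← h3, ellOf_exchange hm τ ht hj', permMu_permMu]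

theorem range_mid_of_eq_act (h : P = (minPattern m r hm).act σ w) :
    Set.range (fun k => w (mid hm k)) = {x | ∀ i, x ≠ P.source i ∧ x ≠ P.target i} := by
  obtain ⟨hS, hT⟩ := eq_act_iff.mp h
  ext x
  constructor
  · rintro ⟨k, rfl⟩ i
    obtain ⟨i, rfl⟩ := σ.surjective i
    rw [hS, hT]
    exact ⟨w.injective.ne (ne_src_of_middle hm (mid_isolated hm k) i),
      w.injective.ne (ne_tgt_of_middle hm (mid_isolated hm k) i)⟩
  · intro hx
    obtain ⟨p, rfl⟩ := w.surjective x
    rcases exists_of_node hm p with ⟨i, rfl⟩ | ⟨i, rfl⟩ | hp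
    · exact absurd (hT i).symm (hx (σ i)).2
    · exact absurd (hS i).symm (hx (σ i)).1
    · obtain ⟨k, rfl⟩ := exists_eq_mid hm hp
      exact ⟨k, rfl⟩

theorem IsMinimalPresentation.eq_of_strictMono_src (h : IsMinimalPresentation hm P σ w)
    (h' : IsMinimalPresentation hm P σ' w') (hs : StrictMono fun i => w (src hm i))
    (hs' : StrictMono fun i => w' (src hm i)) : σ = σ' ∧ w = w' := by
  obtain ⟨hS, hT⟩ := eq_act_iff.mp h.1
  obtain ⟨hS', hT'⟩ := eq_act_iff.mp h'.1
  have hsrc : (fun i => w (src hm i)) = fun i => w' (src hm i) := by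
    refine (hs.range_inj hs').mp ?_
    simp only [← hS, ← hS']
    exact (σ.surjective.range_comp P.source).trans (σ'.surjective.range_comp P.source).symm
  have hinj : Function.Injective P.source := P.distinct.comp Sum.inl_injective
  obtain rfl : σ = σ' := Equiv.ext fun i => hinj (by rw [hS, hS', congrFun hsrc i])
  have hmid := (h.strictMono_mid.range_inj h'.strictMono_mid).mp
    ((range_mid_of_eq_act h.1).trans (range_mid_of_eq_act h'.1).symm)
  refine ⟨rfl, Equiv.ext fun p => ?_⟩
  rcases exists_of_node hm p with ⟨i, rfl⟩ | ⟨i, rfl⟩ | hp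
  · rw [← hT, hT']
  · exact congrFun hsrc i
  · obtain ⟨k, rfl⟩ := exists_eq_mid hm hp
    exact congrFun hmid k

theorem IsMinimalPresentation.permMu_ellOf_eq (τ : UpperHalfPlane)
    (h : IsMinimalPresentation hm P σ w) (h' : IsMinimalPresentation hm P σ' w') :
    permMu (m := m) σ (ellOf hm τ w) = permMu (m := m) σ' (ellOf hm τ w') := by
  obtain ⟨σ₁, w₁, h1, h2, h3⟩ := h.exists_strictMono_src τ
  obtain ⟨σ₂, w₂, h1', h2', h3'⟩ := h'.exists_strictMono_src τ
  obtain ⟨rfl, rfl⟩ := h1.eq_of_strictMono_src h1' h2 h2'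
  rw [h3, h3']

theorem IsDiamond.unique {τ : UpperHalfPlane} {f g g' : Mero (Var m r)} (h : IsDiamond τ w f g)
    (h' : IsDiamond τ w f g') : g = g' := by
  obtain ⟨L, hL⟩ := h.1
  exact (h'.2 L hL g).mp ((h.2 L hL g).mpr rfl)

end Presentations

end LinkPattern

end

theorem mainTheorem3 (τ : UpperHalfPlane) (m r : ℕ) (hm : 2 * r ≤ m)
    (P : LinkPattern.Pattern m r) :
    ∃! E : LinkPattern.Mero (LinkPattern.Var m r),
      ∀ (σ : Equiv.Perm (Fin r)) (w : Equiv.Perm (Fin m)),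
        LinkPattern.IsMinimalPresentation hm P σ w →
          ∃ g : LinkPattern.Mero (LinkPattern.Var m r),
            LinkPattern.IsDiamond τ w (LinkPattern.ellMin τ hm) g ∧
              LinkPattern.permMu σ g = E := by
  obtain ⟨σ₀, w₀, h₀⟩ := LinkPattern.exists_isMinimalPresentation hm P
  refine ⟨LinkPattern.permMu (m := m) σ₀ (LinkPattern.ellOf hm τ w₀),
    fun σ w h => ⟨LinkPattern.ellOf hm τ w, LinkPattern.isDiamond_ellOf hm τ w,
      h.permMu_ellOf_eq τ h₀⟩, fun E hE => ?_⟩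
  obtain ⟨g, hg, rfl⟩ := hE σ₀ w₀ h₀
  rw [hg.unique (LinkPattern.isDiamond_ellOf hm τ w₀)]
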